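/- Notation. $L^2(0,1)$, $L^2(\mathbb{R})$, $L^2(\mathbb{R}_\pm)$ are the complex Hilbert spaces, $\mathbb{R}_+=\,]0,\infty[$, $\mathbb{R}_-=\,]-\infty,0[$; $P_\pm:L^2(\mathbb{R})\to L^2(\mathbb{R}_\pm)$ is the restriction and $P_\pm^*$ its adjoint (extension by $0$); $\mathcal{F}$ is the unitary Fourier transformation on $L^2(\mathbb{R})$ with $(\mathcal{F}f)(x)=(2\pi)^{-1/2}\int_{\mathbb{R}} e^{-ixy}f(y)\,dy$ for $f\in L^1\cap L^2$; $\operatorname{l.i.m.}$ is the limit in $L^2$; $\ln$ is the principal branch. For $s\in\,]0,1[$ and $w\in\mathbb{C}\setminus[-1,1]$ let $$Q_s(w)=\frac{w}{w^2-1}\exp\Big(-\tfrac12\ln\frac{w^2}{w^2-1}\Big)\exp\Big(\frac{i}{2\pi}\ln\big(\tfrac1s-1\big)\ln\frac{w-1}{w+1}\Big),$$ and for $b>0$, $x\in\mathbb{R}\setminus\{0\}$ let $$q_s^\pm(x)=(2\pi)^{-1/2}\lim_{A\to\infty}\int_{-A\pm ib}^{A\pm ib}e^{-ixw}Q_s(w)\,dw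 .$$ Put $n(s)=\frac{i}{\pi}(2s)^{-1/2}$ and $q_+(s,x)=n(s)\,q_s^+(x)$ for $x>0$, $q_-(s,x)=-n(1-s)\,q_s^-(x)$ for $x<0$. Let $l_+(s)=s(1-s)^{1/2}$, $l_-(s)=l_+(1-s)$. Let $R_\pm:L^2(0,1)\to L^2(\mathbb{R},\mathbb{C}^2)=L^2(\mathbb{R})\oplus L^2(\mathbb{R})$ be the isometries $$(R_\pm h)(x)=(2\pi)^{1/2}\begin{pmatrix} l_\pm(s)\\ \pm\, l_\mp(s)\end{pmatrix}h(s),\qquad s=(1+e^{-2\pi x})^{-1},$$ and let $S:L^2(\mathbb{R})\to L^2(\mathbb{R},\mathbb{C}^2)$ be the Hilbert space isomorphism $$(Sf)(x)=\sqrt2\,e^{x/2}\begin{pmatrix}(1+e^x)^{-1}f\big((1-e^x)(1+e^x)^{-1}\big)\\ i\,(1-e^x)^{-1}f\big((1+e^x)(1-e^x)^{-1}\big)\end{pmatrix}.$$ Theorem. Let $b>0$. The limits defining $q_s^\pm(x)$ exist for all $s\in\,]0,1[$ and $x\neq0$, and the operators $V_\pm:L^2(0,1)\to L^2(\mathbb{R}_\pm)$,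 $$V_\pm h=\operatorname*{l.i.m.}_{0<\alpha,\alpha'\to0}\int_\alpha^{1-\alpha'}q_\pm(s,\cdot)\,h(s)\,ds,$$ are well defined and are Hilbert space isomorphisms (surjective linear isometries), with inverses $$V_+^{-1}g=\operatorname*{l.i.m.}_{A\to\infty}\int_0^A q_+(\cdot,x)\,g(x)\,dx,\qquad V_-^{-1}g=\operatorname*{l.i.m.}_{A\to\infty}\int_{-A}^0 q_-(\cdot,x)\,g(x)\,dx .$$ Moreover $$P_\pm^*V_\pm=\mathcal{F}^{-1}S^{-1}\big(\mathcal{F}^{-1}\oplus\mathcal{F}^{-1}\big)R_\pm .$$ -/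

import Mathlib

open MeasureTheory Set Filter Topology
open scoped ENNReal

namespace SincWH

noncomputable section

/-! ### Weighted composition operators between `L²`-spaces -/

/-- Abbreviation for the complex Hilbert space `L²(ν)` over the real line. -/
abbrev L2 (ν : Measure ℝ) : Type := Lp ℂ 2 ν

/-- The measure estimate `∫ |w|² g ∘ φ dμ ≤ ∫ g dν` for all measurable `g ≥ 0`, which makes
`f ↦ w · (f ∘ φ)` a well-defined contraction `L²(ν) → L²(μ)`. -/
structure IsWeight (ν μ : Measure ℝ) (w : ℝ → ℂ) (φ : ℝ → ℝ) : Prop where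
  meas_w : Measurable w
  meas_φ : Measurable φ
  le : ∀ g : ℝ → ℝ≥0∞, Measurable g → ∫⁻ x, ‖w x‖ₑ ^ 2 * g (φ x) ∂μ ≤ ∫⁻ u, g u ∂ν

section WeightedComp

variable {ν μ : Measure ℝ} {w : ℝ → ℂ} {φ : ℝ → ℝ}

theorem enorm_sq_eq_lintegral (f : L2 ν) : ‖f‖ₑ ^ 2 = ∫⁻ x, ‖f x‖ₑ ^ 2 ∂ν := by
  have h := eLpNorm_nnreal_pow_eq_lintegral (μ := ν) (f := f) (p := 2) (by norm_num)
  rw [Lp.enorm_def]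
  simpa using h

theorem IsWeight.ae (H : IsWeight ν μ w φ) {p : ℝ → Prop} (hp : ∀ᵐ u ∂ν, p u) :
    ∀ᵐ x ∂μ, w x ≠ 0 → p (φ x) := by
  set N := toMeasurable ν {u | ¬ p u} with hN
  have hN0 : ν N = 0 := by rw [hN, measure_toMeasurable]; exact hp
  have hNm : MeasurableSet N := measurableSet_toMeasurable _ _
  have h := H.le (N.indicator 1) (measurable_one.indicator hNm)
  rw [lintegral_indicator_one hNm, hN0, nonpos_iff_eq_zero, lintegral_eq_zero_iff] at h
  · filter_upwards [h] with x hx hw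
    by_contra hc
    have hmem : φ x ∈ N := subset_toMeasurable _ _ hc
    simp [indicator_of_mem hmem, hw] at hx
  · exact (H.meas_w.enorm.pow_const 2).mul ((measurable_one.indicator hNm).comp H.meas_φ)

theorem IsWeight.congr (H : IsWeight ν μ w φ) {f g : ℝ → ℂ} (hfg : f =ᵐ[ν] g) :
    (fun x => w x * f (φ x)) =ᵐ[μ] fun x => w x * g (φ x) := by
  filter_upwards [H.ae hfg] with x hx
  by_cases hw : w x = 0
  · simp [hw]
  · rw [hx hw]

theorem IsWeight.memLp (H : IsWeight ν μ w φ) (f : L2 ν) :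
    MemLp (fun x => w x * f (φ x)) 2 μ := by
  have hm : Measurable f := (Lp.stronglyMeasurable f).measurable
  refine ⟨(H.meas_w.mul (hm.comp H.meas_φ)).aestronglyMeasurable, ?_⟩
  have h := eLpNorm_nnreal_pow_eq_lintegral (μ := μ) (f := fun x => w x * f (φ x)) (p := 2)
    (by norm_num)
  have h1 : eLpNorm (fun x => w x * f (φ x)) 2 μ ^ 2 ≤ ‖f‖ₑ ^ 2 := by
    rw [enorm_sq_eq_lintegral]
    refine le_trans (le_of_eq ?_) (H.le (fun u => ‖f u‖ₑ ^ 2) (hm.enorm.pow_const 2))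
    simpa [enorm_mul, mul_pow] using h
  have h2 := (ENNReal.pow_le_pow_left_iff (two_ne_zero)).1 h1
  exact h2.trans_lt enorm_lt_top

/-- The operator `f ↦ w · (f ∘ φ)` from `L²(ν)` to `L²(μ)`. -/
def weightedComp (H : IsWeight ν μ w φ) : L2 ν →ₗ[ℂ] L2 μ where
  toFun f := (H.memLp f).toLp (fun x => w x * f (φ x))
  map_add' f g := by
    rw [← MemLp.toLp_add]
    refine MemLp.toLp_congr _ _ ?_
    filter_upwards [H.congr (Lp.coeFn_add f g)] with x hx
    simp only [hx, Pi.add_apply, mul_add]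
  map_smul' c f := by
    rw [RingHom.id_apply, ← MemLp.toLp_const_smul]
    refine MemLp.toLp_congr _ _ ?_
    filter_upwards [H.congr (Lp.coeFn_smul c f)] with x hx
    simp only [hx, Pi.smul_apply, smul_eq_mul]
    ring

theorem coeFn_weightedComp (H : IsWeight ν μ w φ) (f : L2 ν) :
    weightedComp H f =ᵐ[μ] fun x => w x * f (φ x) :=
  MemLp.coeFn_toLp (H.memLp f)

theorem enorm_weightedComp_sq (H : IsWeight ν μ w φ) (f : L2 ν) :
    ‖weightedComp H f‖ₑ ^ 2 = ∫⁻ x, ‖w x‖ₑ ^ 2 * ‖f (φ x)‖ₑ ^ 2 ∂μ := by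
  rw [enorm_sq_eq_lintegral]
  refine lintegral_congr_ae ?_
  filter_upwards [coeFn_weightedComp H f] with x hx
  rw [hx, enorm_mul, mul_pow]

end WeightedComp

/-- The isometry `f ↦ (w₁ · (f ∘ φ₁), w₂ · (f ∘ φ₂))` from `L²(ν)` to
`L²(ℝ, ℂ²) = L²(ℝ) ⊕ L²(ℝ)` (Hilbert space sum). -/
def pairIsometry {ν : Measure ℝ} {w₁ w₂ : ℝ → ℂ} {φ₁ φ₂ : ℝ → ℝ}
    (H₁ : IsWeight ν volume w₁ φ₁) (H₂ : IsWeight ν volume w₂ φ₂)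
    (hsum : ∀ g : ℝ → ℝ≥0∞, Measurable g →
      (∫⁻ x, ‖w₁ x‖ₑ ^ 2 * g (φ₁ x)) + ∫⁻ x, ‖w₂ x‖ₑ ^ 2 * g (φ₂ x) = ∫⁻ u, g u ∂ν) :
    L2 ν →ₗᵢ[ℂ] WithLp 2 (L2 volume × L2 volume) where
  toFun f := WithLp.toLp 2 (weightedComp H₁ f, weightedComp H₂ f)
  map_add' f g := by rw [map_add, map_add]; rfl
  map_smul' c f := by rw [map_smul, map_smul]; rfl
  norm_map' f := by
    have hm : Measurable f := (Lp.stronglyMeasurable f).measurable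
    have h := hsum (fun u => ‖f u‖ₑ ^ 2) (hm.enorm.pow_const 2)
    rw [← enorm_weightedComp_sq H₁ f, ← enorm_weightedComp_sq H₂ f, ← enorm_sq_eq_lintegral] at h
    have h' := congrArg ENNReal.toReal h
    rw [ENNReal.toReal_add (by finiteness) (by finiteness)] at h'
    simp only [ENNReal.toReal_pow, toReal_enorm] at h'
    have h3 := WithLp.prod_norm_sq_eq_of_L2 (WithLp.toLp 2 (weightedComp H₁ f, weightedComp H₂ f))
    simp only [WithLp.toLp_fst, WithLp.toLp_snd] at h3
    rw [h'] at h3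
    exact (pow_left_inj₀ (norm_nonneg _) (norm_nonneg _) two_ne_zero).1 h3

/-- Change of variables, in the form in which it is used below. -/
theorem lintegral_weight {φ φ' : ℝ → ℝ} {w : ℝ → ℂ} {s t : Set ℝ} {c : ℝ → ℝ≥0∞}
    (hs : MeasurableSet s) (hd : ∀ x ∈ s, HasDerivAt φ (φ' x) x) (hi : InjOn φ s)
    (ht : φ '' s = t) (hw : ∀ x ∈ s, ‖w x‖ₑ ^ 2 = ENNReal.ofReal |φ' x| * c (φ x))
    (g : ℝ → ℝ≥0∞) :
    ∫⁻ x in s, ‖w x‖ₑ ^ 2 * g (φ x) = ∫⁻ u in t, c u * g u := by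
  rw [← ht, lintegral_image_eq_lintegral_abs_deriv_mul hs
    (fun x hx => (hd x hx).hasDerivWithinAt) hi]
  refine setLIntegral_congr_fun hs fun x hx => ?_
  simp only [hw x hx, mul_assoc]

theorem weightedComp_comp {ν μ ρ : Measure ℝ} {w a : ℝ → ℂ} {φ ψ : ℝ → ℝ}
    (H : IsWeight ν μ w φ) (H' : IsWeight ρ ν a ψ) (f : L2 ρ) :
    weightedComp H (weightedComp H' f) =ᵐ[μ] fun x => w x * (a (φ x) * f (ψ (φ x))) :=
  (coeFn_weightedComp H _).trans (H.congr (coeFn_weightedComp H' f))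

/-! ### The Fourier transformation `(𝓕 f)(x) = (2π)^{-1/2} ∫ e^{-ixy} f(y) dy` on `L²(ℝ)` -/

theorem lintegral_dilation (c : ℝ) (hc : 0 < c) (g : ℝ → ℝ≥0∞) :
    ∫⁻ x, ‖((Real.sqrt c : ℝ) : ℂ)‖ₑ ^ 2 * g (c * x) = ∫⁻ u, g u := by
  have h := lintegral_weight (φ := fun x => c * x) (φ' := fun _ => c)
    (w := fun _ => ((Real.sqrt c : ℝ) : ℂ)) (s := univ) (t := univ) (c := fun _ => 1)
    MeasurableSet.univ (fun x _ => by simpa using (hasDerivAt_id x).const_mul c)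
    (fun x _ y _ hxy => mul_left_cancel₀ hc.ne' hxy)
    (by
      rw [image_univ, range_eq_univ]
      exact fun u => ⟨u / c, by field_simp⟩)
    (fun x _ => by
      rw [mul_one, abs_of_pos hc, ← ofReal_norm, ← ENNReal.ofReal_pow (norm_nonneg _),
        Complex.norm_real, Real.norm_eq_abs, sq_abs, Real.sq_sqrt hc.le])
    g
  simpa using h

theorem isWeight_dilation (c : ℝ) (hc : 0 < c) :
    IsWeight volume volume (fun _ => ((Real.sqrt c : ℝ) : ℂ)) (fun x => c * x) where
  meas_w := measurable_const
  meas_φ := measurable_const_mul c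
  le g _ := (lintegral_dilation c hc g).le

/-- The unitary dilation `f ↦ √c · f(c ·)` of `L²(ℝ)`. -/
def dilation (c : ℝ) (hc : 0 < c) : L2 volume ≃ₗᵢ[ℂ] L2 volume :=
  LinearIsometryEquiv.ofSurjective
    { weightedComp (isWeight_dilation c hc) with
      norm_map' := fun f => by
        have hm : Measurable f := (Lp.stronglyMeasurable f).measurable
        have h := enorm_weightedComp_sq (isWeight_dilation c hc) f
        rw [lintegral_dilation c hc (fun u => ‖f u‖ₑ ^ 2), ← enorm_sq_eq_lintegral] at h
        have h' := congrArg ENNReal.toReal h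
        simp only [ENNReal.toReal_pow, toReal_enorm] at h'
        exact (pow_left_inj₀ (norm_nonneg _) (norm_nonneg _) two_ne_zero).1 h' }
    (fun f => by
      refine ⟨weightedComp (isWeight_dilation c⁻¹ (inv_pos.2 hc)) f, ?_⟩
      refine Lp.ext ((weightedComp_comp (isWeight_dilation c hc)
        (isWeight_dilation c⁻¹ (inv_pos.2 hc)) f).trans (Eventually.of_forall fun x => ?_))
      have h1 : Real.sqrt c * Real.sqrt c⁻¹ = 1 := by
        rw [← Real.sqrt_mul hc.le, mul_inv_cancel₀ hc.ne', Real.sqrt_one]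
      simp only
      rw [inv_mul_cancel_left₀ hc.ne', ← mul_assoc, ← Complex.ofReal_mul, h1]
      simp)

theorem coeFn_dilation (c : ℝ) (hc : 0 < c) (f : L2 volume) :
    dilation c hc f =ᵐ[volume] fun x => ((Real.sqrt c : ℝ) : ℂ) * f (c * x) :=
  coeFn_weightedComp (isWeight_dilation c hc) f

/-- The unitary Fourier transformation `𝓕` on `L²(ℝ)` with kernel `(2π)^{-1/2} e^{-ixy}`:
`(𝓕 f)(x) = (2π)^{-1/2} f̂(x / 2π)`, where `f̂` is the Fourier transform of `f` with kernel
`e^{-2πixy}`. -/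
def fourierL2 : L2 volume ≃ₗᵢ[ℂ] L2 volume :=
  (Lp.fourierTransformₗᵢ ℝ ℂ).trans (dilation (2 * Real.pi)⁻¹ (by positivity))

/-- On Schwartz functions `fourierL2` is given by the integral formula. -/
theorem fourierL2_schwartz (f : SchwartzMap ℝ ℂ) :
    fourierL2 (f.toLp 2) =ᵐ[volume] fun x =>
      (((Real.sqrt (2 * Real.pi))⁻¹ : ℝ) : ℂ) *
        ∫ y : ℝ, Complex.exp (-Complex.I * x * y) * f y := by
  have h0 : Lp.fourierTransformₗᵢ ℝ ℂ (f.toLp 2) = (FourierTransform.fourier f).toLp 2 :=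
    SchwartzMap.toLp_fourier_eq f
  have hpos : (0 : ℝ) < (2 * Real.pi)⁻¹ := by positivity
  have h1 := coeFn_dilation (2 * Real.pi)⁻¹ hpos ((FourierTransform.fourier f).toLp 2)
  have h2 := (isWeight_dilation (2 * Real.pi)⁻¹ hpos).congr
    (SchwartzMap.coeFn_toLp (FourierTransform.fourier f) 2 volume)
  have h3 : fourierL2 (f.toLp 2) = dilation (2 * Real.pi)⁻¹ hpos
      ((FourierTransform.fourier f).toLp 2) := by
    rw [← h0]; rfl
  rw [h3]
  refine (h1.trans h2).trans (Eventually.of_forall fun x => ?_)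
  simp only [Real.sqrt_inv, SchwartzMap.fourier_coe, Real.fourier_real_eq_integral_exp_smul,
    smul_eq_mul]
  congr 1
  refine integral_congr_ae (Eventually.of_forall fun y => ?_)
  simp only
  congr 2
  have : (Real.pi : ℂ) ≠ 0 := by exact_mod_cast Real.pi_ne_zero
  push_cast
  field_simp

/-! ### The isometries `R₊`, `R₋` -/

/-- `s = (1 + e^{-2πx})⁻¹`. -/
def sig (x : ℝ) : ℝ := (1 + Real.exp (-2 * Real.pi * x))⁻¹

/-- `l₊(s) = s (1 - s)^{1/2}`. -/
def lPlus (s : ℝ) : ℝ := s * Real.sqrt (1 - s)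

/-- `l₋(s) = l₊(1 - s)`. -/
def lMinus (s : ℝ) : ℝ := lPlus (1 - s)

theorem sig_mem (x : ℝ) : sig x ∈ Ioo (0 : ℝ) 1 := by
  have h := Real.exp_pos (-2 * Real.pi * x)
  refine ⟨by unfold sig; positivity, ?_⟩
  unfold sig
  exact inv_lt_one_of_one_lt₀ (by linarith)

theorem measurable_sig : Measurable sig := by
  unfold sig; fun_prop

theorem hasDerivAt_sig (x : ℝ) : HasDerivAt sig (2 * Real.pi * (sig x * (1 - sig x))) x := by
  have hpos := Real.exp_pos (-2 * Real.pi * x)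
  have h1 : HasDerivAt (fun y : ℝ => 1 + Real.exp (-2 * Real.pi * y))
      (Real.exp (-2 * Real.pi * x) * (-2 * Real.pi)) x := by
    have := (((hasDerivAt_id x).const_mul (-2 * Real.pi)).exp).const_add 1
    simpa using this
  have h2 := h1.inv (by positivity)
  have h3 : sig = (fun y : ℝ => 1 + Real.exp (-2 * Real.pi * y))⁻¹ := rfl
  rw [← h3] at h2
  refine h2.congr_deriv ?_
  have h4 : sig x = (1 + Real.exp (-2 * Real.pi * x))⁻¹ := rfl
  rw [h4]
  field_simp
  ring

theorem injective_sig : Function.Injective sig := by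
  intro x y h
  unfold sig at h
  have h1 := Real.exp_injective (add_left_cancel (inv_injective h))
  exact mul_left_cancel₀ (by simp [Real.pi_ne_zero]) h1

theorem image_sig : sig '' univ = Ioo 0 1 := by
  refine Subset.antisymm (by rintro _ ⟨x, -, rfl⟩; exact sig_mem x) fun s hs => ?_
  have hpos : 0 < 1 / s - 1 := by
    rw [sub_pos, lt_div_iff₀ hs.1]; linarith [hs.2]
  refine ⟨-(2 * Real.pi)⁻¹ * Real.log (1 / s - 1), mem_univ _, ?_⟩
  have h : -2 * Real.pi * (-(2 * Real.pi)⁻¹ * Real.log (1 / s - 1)) = Real.log (1 / s - 1) := by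
    have := Real.pi_ne_zero
    field_simp
  unfold sig
  rw [h, Real.exp_log hpos]
  simp

theorem lintegral_sig {w : ℝ → ℂ} {c : ℝ → ℝ}
    (hw : ∀ x, ‖w x‖ ^ 2 = 2 * Real.pi * (sig x * (1 - sig x)) * c (sig x)) (g : ℝ → ℝ≥0∞) :
    ∫⁻ x, ‖w x‖ₑ ^ 2 * g (sig x) = ∫⁻ s in Ioo (0 : ℝ) 1, ENNReal.ofReal (c s) * g s := by
  rw [← setLIntegral_univ]
  refine lintegral_weight MeasurableSet.univ (fun x _ => hasDerivAt_sig x)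
    injective_sig.injOn image_sig (fun x _ => ?_) g
  have h := sig_mem x
  have h0 : 0 ≤ 2 * Real.pi * (sig x * (1 - sig x)) := by
    have := mul_nonneg h.1.le (sub_nonneg.2 h.2.le)
    positivity
  rw [abs_of_nonneg h0, ← ENNReal.ofReal_mul h0, ← hw x, ← ofReal_norm,
    ENNReal.ofReal_pow (norm_nonneg _)]

/-- The weights `(2π)^{1/2} l₊(s)` and `(2π)^{1/2} l₋(s)` with `s = (1 + e^{-2πx})⁻¹`. -/
def rp (x : ℝ) : ℂ := ((Real.sqrt (2 * Real.pi) * lPlus (sig x) : ℝ) : ℂ)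

/-- See `rp`. -/
def rm (x : ℝ) : ℂ := ((Real.sqrt (2 * Real.pi) * lMinus (sig x) : ℝ) : ℂ)

theorem norm_rp_sq (x : ℝ) :
    ‖rp x‖ ^ 2 = 2 * Real.pi * (sig x * (1 - sig x)) * sig x := by
  have h := sig_mem x
  unfold rp lPlus
  rw [Complex.norm_real, Real.norm_eq_abs, sq_abs, mul_pow, mul_pow,
    Real.sq_sqrt (by positivity), Real.sq_sqrt (by linarith [h.2])]
  ring

theorem norm_rm_sq (x : ℝ) :
    ‖rm x‖ ^ 2 = 2 * Real.pi * (sig x * (1 - sig x)) * (1 - sig x) := by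
  have h := sig_mem x
  unfold rm lMinus lPlus
  rw [Complex.norm_real, Real.norm_eq_abs, sq_abs, mul_pow, mul_pow,
    Real.sq_sqrt (by positivity), Real.sq_sqrt (by linarith [h.1])]
  ring

theorem measurable_rp : Measurable rp := by
  have := measurable_sig
  unfold rp lPlus
  fun_prop

theorem measurable_rm : Measurable rm := by
  have := measurable_sig
  unfold rm lMinus lPlus
  fun_prop

theorem isWeight_sig {w : ℝ → ℂ} {c : ℝ → ℝ} (hm : Measurable w)
    (hw : ∀ x, ‖w x‖ ^ 2 = 2 * Real.pi * (sig x * (1 - sig x)) * c (sig x))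
    (hc : ∀ s ∈ Ioo (0 : ℝ) 1, c s ≤ 1) :
    IsWeight (volume.restrict (Ioo 0 1)) volume w sig where
  meas_w := hm
  meas_φ := measurable_sig
  le g hg := by
    rw [lintegral_sig hw]
    refine setLIntegral_mono hg fun s hs => ?_
    exact mul_le_of_le_one_left' (by simpa using hc s hs)

theorem lintegral_sig_add {w₁ w₂ : ℝ → ℂ} {c₁ c₂ : ℝ → ℝ}
    (hw₁ : ∀ x, ‖w₁ x‖ ^ 2 = 2 * Real.pi * (sig x * (1 - sig x)) * c₁ (sig x))
    (hw₂ : ∀ x, ‖w₂ x‖ ^ 2 = 2 * Real.pi * (sig x * (1 - sig x)) * c₂ (sig x))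
    (hm : Measurable c₁) (hc : ∀ s ∈ Ioo (0 : ℝ) 1, 0 ≤ c₁ s ∧ 0 ≤ c₂ s ∧ c₁ s + c₂ s = 1)
    (g : ℝ → ℝ≥0∞) (hg : Measurable g) :
    (∫⁻ x, ‖w₁ x‖ₑ ^ 2 * g (sig x)) + ∫⁻ x, ‖w₂ x‖ₑ ^ 2 * g (sig x) =
      ∫⁻ s in Ioo (0 : ℝ) 1, g s := by
  rw [lintegral_sig hw₁, lintegral_sig hw₂, ← lintegral_add_left
    (show Measurable fun s => ENNReal.ofReal (c₁ s) * g s from hm.ennreal_ofReal.mul hg)]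
  refine setLIntegral_congr_fun measurableSet_Ioo fun s hs => ?_
  obtain ⟨h1, h2, h3⟩ := hc s hs
  rw [← add_mul, ← ENNReal.ofReal_add h1 h2, h3, ENNReal.ofReal_one, one_mul]

/-- `R₊ : L²(0,1) → L²(ℝ, ℂ²)`, `(R₊ h)(x) = (2π)^{1/2} (l₊(s), l₋(s)) h(s)` with
`s = (1 + e^{-2πx})⁻¹`. -/
def Rplus : L2 (volume.restrict (Ioo 0 1)) →ₗᵢ[ℂ] WithLp 2 (L2 volume × L2 volume) :=
  pairIsometry (w₁ := rp) (w₂ := rm) (φ₁ := sig) (φ₂ := sig)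
    (isWeight_sig (c := fun s => s) measurable_rp norm_rp_sq fun _ hs => hs.2.le)
    (isWeight_sig (c := fun s => 1 - s) measurable_rm norm_rm_sq
      fun s hs => by linarith [hs.1])
    (lintegral_sig_add (c₁ := fun s => s) (c₂ := fun s => 1 - s) norm_rp_sq norm_rm_sq
      measurable_id fun s hs => ⟨hs.1.le, by linarith [hs.2], by ring⟩)

/-- `R₋ : L²(0,1) → L²(ℝ, ℂ²)`, `(R₋ h)(x) = (2π)^{1/2} (l₋(s), -l₊(s)) h(s)` with
`s = (1 + e^{-2πx})⁻¹`. -/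
def Rminus : L2 (volume.restrict (Ioo 0 1)) →ₗᵢ[ℂ] WithLp 2 (L2 volume × L2 volume) :=
  pairIsometry (w₁ := rm) (w₂ := fun x => -rp x) (φ₁ := sig) (φ₂ := sig)
    (isWeight_sig (c := fun s => 1 - s) measurable_rm norm_rm_sq
      fun s hs => by linarith [hs.1])
    (isWeight_sig (c := fun s => s) measurable_rp.neg
      (fun x => by rw [norm_neg]; exact norm_rp_sq x) fun _ hs => hs.2.le)
    (lintegral_sig_add (c₁ := fun s => 1 - s) (c₂ := fun s => s) norm_rm_sq
      (fun x => by rw [norm_neg]; exact norm_rp_sq x)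
      (measurable_const.sub measurable_id)
      fun s hs => ⟨by linarith [hs.2], hs.1.le, by ring⟩)

/-! ### The unitary operator `S` -/

/-- `(1 - e^x) / (1 + e^x)`. -/
def sφ₁ (x : ℝ) : ℝ := (1 - Real.exp x) * (1 + Real.exp x)⁻¹

/-- `(1 + e^x) / (1 - e^x)`. -/
def sφ₂ (x : ℝ) : ℝ := (1 + Real.exp x) * (1 - Real.exp x)⁻¹

/-- `√2 e^{x/2} (1 + e^x)⁻¹`. -/
def sw₁ (x : ℝ) : ℂ := ((Real.sqrt 2 * Real.exp (x / 2) * (1 + Real.exp x)⁻¹ : ℝ) : ℂ)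

/-- `√2 e^{x/2} i (1 - e^x)⁻¹`. -/
def sw₂ (x : ℝ) : ℂ := Complex.I * ((Real.sqrt 2 * Real.exp (x / 2) * (1 - Real.exp x)⁻¹ : ℝ) : ℂ)

/-- `ln |(1 - u) / (1 + u)|`. -/
def sψ (u : ℝ) : ℝ := Real.log |(1 - u) / (1 + u)|

/-- `√2 |1 - u²|^{-1/2}` on `|u| < 1`, and `0` elsewhere. -/
def sa₁ (u : ℝ) : ℂ :=
  if |u| < 1 then ((Real.sqrt 2 * (Real.sqrt |1 - u ^ 2|)⁻¹ : ℝ) : ℂ) else 0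

/-- `√2 |1 - u²|^{-1/2} (i sgn u)⁻¹` on `|u| > 1`, and `0` elsewhere. -/
def sa₂ (u : ℝ) : ℂ :=
  if 1 < |u| then
    ((Real.sqrt 2 * (Real.sqrt |1 - u ^ 2|)⁻¹ : ℝ) : ℂ) * (Complex.I * (u / |u| : ℝ))⁻¹
  else 0

theorem one_sub_exp_ne {x : ℝ} (hx : x ≠ 0) : 1 - Real.exp x ≠ 0 :=
  fun h => hx (Real.exp_eq_one_iff x |>.1 (by linarith))

theorem abs_sφ₁ (x : ℝ) : |sφ₁ x| < 1 := by
  have := Real.exp_pos x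
  unfold sφ₁
  rw [← div_eq_mul_inv, abs_lt, lt_div_iff₀ (by positivity), div_lt_iff₀ (by positivity)]
  constructor <;> linarith

theorem abs_sφ₂ {x : ℝ} (hx : x ≠ 0) : 1 < |sφ₂ x| := by
  have := Real.exp_pos x
  have h := one_sub_exp_ne hx
  unfold sφ₂
  rw [abs_mul, abs_inv, ← div_eq_mul_inv, one_lt_div (abs_pos.2 h),
    abs_of_pos (by positivity : 0 < 1 + Real.exp x), abs_lt]
  constructor <;> linarith

theorem sψ_sφ₁ (x : ℝ) : sψ (sφ₁ x) = x := by
  have := Real.exp_pos x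
  have h : (1 - sφ₁ x) / (1 + sφ₁ x) = Real.exp x := by
    unfold sφ₁
    have h1 : 1 + (1 - Real.exp x) * (1 + Real.exp x)⁻¹ = 2 * (1 + Real.exp x)⁻¹ := by
      field_simp; ring
    rw [h1]
    field_simp; ring
  rw [sψ, h, abs_of_pos this, Real.log_exp]

theorem sψ_sφ₂ {x : ℝ} (hx : x ≠ 0) : sψ (sφ₂ x) = x := by
  have := Real.exp_pos x
  have h0 := one_sub_exp_ne hx
  have h : (1 - sφ₂ x) / (1 + sφ₂ x) = -Real.exp x := by
    unfold sφ₂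
    have h1 : 1 + (1 + Real.exp x) * (1 - Real.exp x)⁻¹ = 2 * (1 - Real.exp x)⁻¹ := by
      field_simp; ring
    rw [h1]
    field_simp; ring
  rw [sψ, h, abs_neg, abs_of_pos this, Real.log_exp]

theorem image_sφ₁ : sφ₁ '' univ = {u | |u| < 1} := by
  refine Subset.antisymm (by rintro _ ⟨x, -, rfl⟩; exact abs_sφ₁ x) fun u hu => ⟨sψ u, trivial, ?_⟩
  obtain ⟨h1, h2⟩ := abs_lt.1 (mem_ofPred_eq ▸ hu)
  have hp : 0 < (1 - u) / (1 + u) := div_pos (by linarith) (by linarith)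
  have h3 : 1 + u ≠ 0 := by linarith
  unfold sφ₁ sψ
  rw [abs_of_pos hp, Real.exp_log hp]
  have h4 : 1 + (1 - u) / (1 + u) = 2 * (1 + u)⁻¹ := by field_simp; ring
  rw [h4]
  field_simp; ring

theorem image_sφ₂ : sφ₂ '' {0}ᶜ = {u | 1 < |u|} := by
  refine Subset.antisymm (by rintro _ ⟨x, hx, rfl⟩; exact abs_sφ₂ hx) fun u hu => ?_
  have hn : (1 - u) / (1 + u) < 0 := by
    rcases lt_abs.1 (mem_ofPred_eq ▸ hu) with h | h
    · exact div_neg_of_neg_of_pos (by linarith) (by linarith)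
    · exact div_neg_of_pos_of_neg (by linarith) (by linarith)
  have h3 : 1 + u ≠ 0 := fun h => by simp [h] at hn
  have he : Real.exp (sψ u) = -((1 - u) / (1 + u)) := by
    unfold sψ
    rw [abs_of_neg hn, Real.exp_log (by linarith)]
  have hu0 : u ≠ 0 := by rintro rfl; norm_num at hu
  have h4 : 1 - -((1 - u) / (1 + u)) = 2 * (1 + u)⁻¹ := by field_simp; ring
  refine ⟨sψ u, fun h0 => ?_, ?_⟩
  · rw [mem_singleton_iff] at h0
    rw [h0, Real.exp_zero] at he
    rw [← he] at h4
    have : (1 + u)⁻¹ ≠ 0 := inv_ne_zero h3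
    simp [h3] at h4
  · unfold sφ₂
    rw [he, h4]
    field_simp; ring

theorem hasDerivAt_sφ₁ (x : ℝ) :
    HasDerivAt sφ₁ (-(2 * Real.exp x * ((1 + Real.exp x) ^ 2)⁻¹)) x := by
  have hp := Real.exp_pos x
  have h0 : 1 + Real.exp x ≠ 0 := by positivity
  have h := ((Real.hasDerivAt_exp x).const_sub 1).mul
    (((Real.hasDerivAt_exp x).const_add 1).inv h0)
  refine HasDerivAt.congr_deriv (f := sφ₁) h ?_
  simp only [Pi.inv_apply]
  field_simp
  ring

theorem hasDerivAt_sφ₂ {x : ℝ} (hx : x ≠ 0) :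
    HasDerivAt sφ₂ (2 * Real.exp x * ((1 - Real.exp x) ^ 2)⁻¹) x := by
  have h0 := one_sub_exp_ne hx
  have h := ((Real.hasDerivAt_exp x).const_add 1).mul
    (((Real.hasDerivAt_exp x).const_sub 1).inv h0)
  refine HasDerivAt.congr_deriv (f := sφ₂) h ?_
  simp only [Pi.inv_apply]
  field_simp
  ring

theorem norm_sw₁_sq (x : ℝ) : ‖sw₁ x‖ ^ 2 = 2 * Real.exp x * ((1 + Real.exp x) ^ 2)⁻¹ := by
  have h : Real.exp (x / 2) ^ 2 = Real.exp x := by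
    rw [← Real.exp_nat_mul]; congr 1; push_cast; ring
  unfold sw₁
  rw [Complex.norm_real, Real.norm_eq_abs, sq_abs, mul_pow, mul_pow, h,
    Real.sq_sqrt (by norm_num), inv_pow]

theorem norm_sw₂_sq (x : ℝ) : ‖sw₂ x‖ ^ 2 = 2 * Real.exp x * ((1 - Real.exp x) ^ 2)⁻¹ := by
  have h : Real.exp (x / 2) ^ 2 = Real.exp x := by
    rw [← Real.exp_nat_mul]; congr 1; push_cast; ring
  unfold sw₂
  rw [norm_mul, Complex.norm_I, one_mul, Complex.norm_real, Real.norm_eq_abs, sq_abs, mul_pow,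
    mul_pow, h, Real.sq_sqrt (by norm_num), inv_pow]

theorem setLIntegral_compl_zero (f : ℝ → ℝ≥0∞) : ∫⁻ x in {(0 : ℝ)}ᶜ, f x = ∫⁻ x, f x := by
  rw [restrict_compl_singleton]

theorem lintegral_sφ₁ (g : ℝ → ℝ≥0∞) :
    ∫⁻ x, ‖sw₁ x‖ₑ ^ 2 * g (sφ₁ x) = ∫⁻ u in {u : ℝ | |u| < 1}, g u := by
  rw [← setLIntegral_univ]
  refine (lintegral_weight MeasurableSet.univ (fun x _ => hasDerivAt_sφ₁ x)
    (Function.LeftInverse.injective sψ_sφ₁).injOn image_sφ₁ (c := 1) (fun x _ => ?_) g).trans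
    (by simp)
  rw [abs_neg, abs_of_nonneg (by positivity), Pi.one_apply, mul_one, ← norm_sw₁_sq,
    ← ofReal_norm, ENNReal.ofReal_pow (norm_nonneg _)]

theorem lintegral_sφ₂ (g : ℝ → ℝ≥0∞) :
    ∫⁻ x, ‖sw₂ x‖ₑ ^ 2 * g (sφ₂ x) = ∫⁻ u in {u : ℝ | 1 < |u|}, g u := by
  rw [← setLIntegral_compl_zero]
  refine (lintegral_weight (measurableSet_singleton 0).compl (fun x hx => hasDerivAt_sφ₂ hx)
    (fun x hx y hy hxy => by rw [← sψ_sφ₂ hx, hxy, sψ_sφ₂ hy]) image_sφ₂ (c := 1)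
    (fun x _ => ?_) g).trans (by simp)
  rw [abs_of_nonneg (by positivity), Pi.one_apply, mul_one, ← norm_sw₂_sq,
    ← ofReal_norm, ENNReal.ofReal_pow (norm_nonneg _)]

theorem measurable_sφ₁ : Measurable sφ₁ := by unfold sφ₁; fun_prop

theorem measurable_sφ₂ : Measurable sφ₂ := by unfold sφ₂; fun_prop

theorem isWeight_sφ₁ : IsWeight volume volume sw₁ sφ₁ where
  meas_w := by unfold sw₁; fun_prop
  meas_φ := measurable_sφ₁
  le g _ := by rw [lintegral_sφ₁]; exact setLIntegral_le_lintegral _ _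

theorem isWeight_sφ₂ : IsWeight volume volume sw₂ sφ₂ where
  meas_w := by unfold sw₂; fun_prop
  meas_φ := measurable_sφ₂
  le g _ := by rw [lintegral_sφ₂]; exact setLIntegral_le_lintegral _ _

theorem measurableSet_lt_one : MeasurableSet {u : ℝ | |u| < 1} :=
  measurableSet_lt (by fun_prop) measurable_const

theorem measurableSet_one_lt : MeasurableSet {u : ℝ | 1 < |u|} :=
  measurableSet_lt measurable_const (by fun_prop)

theorem lintegral_sφ_add (g : ℝ → ℝ≥0∞) (_hg : Measurable g) :
    (∫⁻ x, ‖sw₁ x‖ₑ ^ 2 * g (sφ₁ x)) + ∫⁻ x, ‖sw₂ x‖ₑ ^ 2 * g (sφ₂ x) = ∫⁻ u, g u := by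
  rw [lintegral_sφ₁, lintegral_sφ₂, ← lintegral_add_compl (μ := volume) g
    measurableSet_lt_one]
  congr 1
  refine setLIntegral_congr ?_
  have h : ∀ᵐ u : ℝ, u ∉ ({1, -1} : Set ℝ) :=
    measure_eq_zero_iff_ae_notMem.1 ((toFinite _).measure_zero _)
  filter_upwards [h] with u hu
  simp only [mem_insert_iff, mem_singleton_iff, not_or] at hu
  refine propext ⟨fun h1 => not_lt.2 (le_of_lt h1), fun h1 => ?_⟩
  refine lt_of_le_of_ne (not_lt.1 h1) fun h2 => ?_
  rcases eq_or_eq_neg_of_abs_eq h2.symm with h3 | h3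
  · exact hu.1 h3
  · exact hu.2 h3

theorem isWeight_inv {w a : ℝ → ℂ} {φ ψ : ℝ → ℝ} {s t : Set ℝ} (ht : MeasurableSet t)
    (ha : Measurable a) (hψ : Measurable ψ)
    (H : ∀ g : ℝ → ℝ≥0∞, ∫⁻ x, ‖w x‖ₑ ^ 2 * g (φ x) = ∫⁻ u in t, g u)
    (hsn : volume sᶜ = 0) (h0 : ∀ u ∉ t, a u = 0) (h1 : ∀ x ∈ s, w x * a (φ x) = 1)
    (h2 : ∀ x ∈ s, ψ (φ x) = x) : IsWeight volume volume a ψ where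
  meas_w := ha
  meas_φ := hψ
  le g _ := by
    have e1 : ∫⁻ u, ‖a u‖ₑ ^ 2 * g (ψ u) = ∫⁻ u in t, ‖a u‖ₑ ^ 2 * g (ψ u) := by
      rw [← lintegral_indicator ht]
      refine lintegral_congr fun u => ?_
      by_cases hu : u ∈ t
      · rw [indicator_of_mem hu]
      · rw [indicator_of_notMem hu, h0 u hu]; simp
    rw [e1, ← H fun u => ‖a u‖ₑ ^ 2 * g (ψ u)]
    refine le_of_eq (lintegral_congr_ae ?_)
    have hae : ∀ᵐ x : ℝ, x ∈ s := by rw [ae_iff]; exact hsn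
    filter_upwards [hae] with x hx
    rw [h2 x hx, ← mul_assoc, ← mul_pow, ← enorm_mul, h1 x hx]
    simp

theorem sqrt_two_mul_aux {y p q : ℝ} (hp : p ^ 2 = y) (hp0 : 0 < p) (hq : 0 < q) :
    Real.sqrt 2 * p * q⁻¹ * (Real.sqrt 2 * (Real.sqrt (4 * y / q ^ 2))⁻¹) = 1 := by
  have h : Real.sqrt (4 * y / q ^ 2) = 2 * p / q := by
    rw [← hp, show 4 * p ^ 2 / q ^ 2 = (2 * p / q) ^ 2 by ring]
    exact Real.sqrt_sq (by positivity)
  have h2 : Real.sqrt 2 * Real.sqrt 2 = 2 := Real.mul_self_sqrt (by norm_num)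
  rw [h]
  field_simp
  linarith

theorem sw₁_mul_sa₁ (x : ℝ) : sw₁ x * sa₁ (sφ₁ x) = 1 := by
  have hp := Real.exp_pos x
  have h : Real.exp (x / 2) ^ 2 = Real.exp x := by
    rw [← Real.exp_nat_mul]; congr 1; push_cast; ring
  have h1 : |1 - sφ₁ x ^ 2| = 4 * Real.exp x / (1 + Real.exp x) ^ 2 := by
    have : 1 - sφ₁ x ^ 2 = 4 * Real.exp x / (1 + Real.exp x) ^ 2 := by
      unfold sφ₁; field_simp; ring
    rw [this, abs_of_nonneg (by positivity)]
  unfold sw₁ sa₁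
  rw [if_pos (abs_sφ₁ x), ← Complex.ofReal_mul, h1,
    sqrt_two_mul_aux h (Real.exp_pos _) (by positivity), Complex.ofReal_one]

theorem I_mul_aux (p q r : ℂ) : Complex.I * p * (q * (Complex.I * r)⁻¹) = p * q * r⁻¹ := by
  rw [mul_inv, Complex.inv_I]
  linear_combination (-(p * q * r⁻¹)) * Complex.I_sq

theorem sw₂_mul_sa₂ {x : ℝ} (hx : x ≠ 0) : sw₂ x * sa₂ (sφ₂ x) = 1 := by
  have hp := Real.exp_pos x
  have h0 := one_sub_exp_ne hx
  have h : Real.exp (x / 2) ^ 2 = Real.exp x := by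
    rw [← Real.exp_nat_mul]; congr 1; push_cast; ring
  have h1 : |1 - sφ₂ x ^ 2| = 4 * Real.exp x / |1 - Real.exp x| ^ 2 := by
    have : 1 - sφ₂ x ^ 2 = -(4 * Real.exp x / (1 - Real.exp x) ^ 2) := by
      unfold sφ₂; field_simp; ring
    rw [this, abs_neg, abs_of_nonneg (by positivity), sq_abs]
  have h2 := sqrt_two_mul_aux h (Real.exp_pos _) (abs_pos.2 h0)
  unfold sw₂ sa₂
  rw [if_pos (abs_sφ₂ hx), h1]
  rcases lt_or_gt_of_ne h0 with hneg | hpos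
  · have hs : sφ₂ x < 0 := mul_neg_of_pos_of_neg (by positivity) (inv_lt_zero.2 hneg)
    have hs' : sφ₂ x / |sφ₂ x| = -1 := by rw [abs_of_neg hs, div_neg, div_self hs.ne]
    rw [abs_of_neg hneg, inv_neg] at h2
    rw [abs_of_neg hneg, hs', I_mul_aux, ← Complex.ofReal_mul, ← Complex.ofReal_inv,
      ← Complex.ofReal_mul, ← Complex.ofReal_one]
    congr 1
    norm_num at h2 ⊢
    linarith
  · have hs : 0 < sφ₂ x := mul_pos (by positivity) (inv_pos.2 hpos)
    have hs' : sφ₂ x / |sφ₂ x| = 1 := by rw [abs_of_pos hs, div_self hs.ne']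
    rw [abs_of_pos hpos] at h2
    rw [abs_of_pos hpos, hs', I_mul_aux, ← Complex.ofReal_mul, h2]
    simp

theorem isWeight_sa₁ : IsWeight volume volume sa₁ sψ :=
  isWeight_inv measurableSet_lt_one
    (Measurable.ite measurableSet_lt_one (by fun_prop) measurable_const)
    (by unfold sψ; fun_prop) (s := univ) lintegral_sφ₁ (by simp)
    (fun u hu => if_neg hu) (fun x _ => sw₁_mul_sa₁ x) (fun x _ => sψ_sφ₁ x)

theorem isWeight_sa₂ : IsWeight volume volume sa₂ sψ :=
  isWeight_inv (s := {0}ᶜ) measurableSet_one_lt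
    (Measurable.ite measurableSet_one_lt (by fun_prop) measurable_const)
    (by unfold sψ; fun_prop) lintegral_sφ₂ (by simp)
    (fun u hu => if_neg hu) (fun x hx => sw₂_mul_sa₂ hx) (fun x hx => sψ_sφ₂ hx)

/-- The isometry underlying `S`, see `opS`. -/
def opSIsometry : L2 volume →ₗᵢ[ℂ] WithLp 2 (L2 volume × L2 volume) :=
  pairIsometry isWeight_sφ₁ isWeight_sφ₂ lintegral_sφ_add

theorem opSIsometry_surjective : Function.Surjective opSIsometry := by
  intro p
  have hae : ∀ᵐ x : ℝ, x ≠ 0 := by simp [ae_iff]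
  refine ⟨weightedComp isWeight_sa₁ p.fst + weightedComp isWeight_sa₂ p.snd, ?_⟩
  refine WithLp.ofLp_injective 2 (Prod.ext (Lp.ext ?_) (Lp.ext ?_))
  · change weightedComp isWeight_sφ₁ _ =ᵐ[volume] p.fst
    rw [map_add]
    filter_upwards [Lp.coeFn_add (weightedComp isWeight_sφ₁ (weightedComp isWeight_sa₁ p.fst))
      (weightedComp isWeight_sφ₁ (weightedComp isWeight_sa₂ p.snd)),
      weightedComp_comp isWeight_sφ₁ isWeight_sa₁ p.fst,
      weightedComp_comp isWeight_sφ₁ isWeight_sa₂ p.snd] with x h1 h2 h3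
    have h4 : sa₂ (sφ₁ x) = 0 := if_neg (not_lt.2 (abs_sφ₁ x).le)
    rw [h1, Pi.add_apply, h2, h3, h4, ← mul_assoc, sw₁_mul_sa₁, sψ_sφ₁]
    simp
  · change weightedComp isWeight_sφ₂ _ =ᵐ[volume] p.snd
    rw [map_add]
    filter_upwards [Lp.coeFn_add (weightedComp isWeight_sφ₂ (weightedComp isWeight_sa₁ p.fst))
      (weightedComp isWeight_sφ₂ (weightedComp isWeight_sa₂ p.snd)),
      weightedComp_comp isWeight_sφ₂ isWeight_sa₁ p.fst,
      weightedComp_comp isWeight_sφ₂ isWeight_sa₂ p.snd, hae] with x h1 h2 h3 hx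
    have h4 : sa₁ (sφ₂ x) = 0 := if_neg (not_lt.2 (abs_sφ₂ hx).le)
    rw [h1, Pi.add_apply, h2, h3, h4, ← mul_assoc (sw₂ x) (sa₂ _), sw₂_mul_sa₂ hx, sψ_sφ₂ hx]
    simp

/-- The unitary operator `S : L²(ℝ) → L²(ℝ, ℂ²)`,
`(S f)₁(x) = √2 e^{x/2} (1 + e^x)⁻¹ f((1 - e^x) (1 + e^x)⁻¹)`,
`(S f)₂(x) = √2 e^{x/2} i (1 - e^x)⁻¹ f((1 + e^x) (1 - e^x)⁻¹)`. -/
def opS : L2 volume ≃ₗᵢ[ℂ] WithLp 2 (L2 volume × L2 volume) :=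
  LinearIsometryEquiv.ofSurjective opSIsometry opSIsometry_surjective

/-! ### The projections `P_±` and their adjoints -/

/-- The restriction `P : L²(ℝ) → L²(T)`; for `T = ℝ_±` this is `P_±`. -/
def projP (T : Set ℝ) : L2 volume →L[ℂ] L2 (volume.restrict T) :=
  LpToLpRestrictCLM ℝ ℂ ℂ volume 2 T

/-! ### The spectral functions and the kernels `q_±` -/

/-- The function `Q_s` on `ℂ \ [-1, 1]`. -/
def specQ (s : ℝ) (w : ℂ) : ℂ :=
  w / (w ^ 2 - 1) * Complex.exp (-(1 / 2) * Complex.log (w ^ 2 / (w ^ 2 - 1))) *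
    Complex.exp (Complex.I / (2 * Real.pi) * (Real.log (1 / s - 1) : ℝ) *
      Complex.log ((w - 1) / (w + 1)))

/-- `(2π)^{-1/2} ∫ e^{-ixw} Q_s(w) dw` over the segment from `-A + iβ` to `A + iβ`. -/
def specTrunc (β s x A : ℝ) : ℂ :=
  (((Real.sqrt (2 * Real.pi))⁻¹ : ℝ) : ℂ) *
    ∫ u in (-A)..A, Complex.exp (-Complex.I * x * (u + Complex.I * β)) *
      specQ s (u + Complex.I * β)

/-- The (improper) integral `(2π)^{-1/2} ∫ e^{-ixw} Q_s(w) dw` over the line `Im w = β`. For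
`b > 0` the spectral functions are `q_s^±(x) = specFun (±b) s x`. -/
def specFun (β s x : ℝ) : ℂ := limUnder atTop (specTrunc β s x)

/-- The normalisation factor `n(s) = (i/π) (2s)^{-1/2}`. -/
def nrm (s : ℝ) : ℂ := Complex.I / Real.pi * (((Real.sqrt (2 * s))⁻¹ : ℝ) : ℂ)

/-- `q_+(s, x) = n(s) q_s^+(x)`, with `q_s^+` computed on the line `Im w = b`. -/
def qPlus (b s x : ℝ) : ℂ := nrm s * specFun b s x

/-- `q_-(s, x) = -n(1 - s) q_s^-(x)`, with `q_s^-` computed on the line `Im w = -b`. -/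
def qMinus (b s x : ℝ) : ℂ := -nrm (1 - s) * specFun (-b) s x

/-! ### Limits in the mean of integrals -/

/-- `G = l.i.m. ∫_{a i}^{c i} k(y, ·) f(y) dy` along the filter `l` in `L²(T)`: eventually the
integrals exist at every point of `T` and are square integrable on `T`, and they converge to `G`
in `L²(T)`. -/
def IsLimIntegral {ι : Type} (l : Filter ι) (a c : ι → ℝ) (k : ℝ → ℝ → ℂ) (f : ℝ → ℂ)
    (T : Set ℝ) (G : L2 (volume.restrict T)) : Prop :=
  (∀ᶠ i in l, (∀ t ∈ T, IntervalIntegrable (fun y => k y t * f y) volume (a i) (c i)) ∧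
      MemLp (fun t => ∫ y in (a i)..(c i), k y t * f y) 2 (volume.restrict T)) ∧
    Tendsto (fun i => eLpNorm (fun t => (∫ y in (a i)..(c i), k y t * f y) - G t) 2
      (volume.restrict T)) l (𝓝 0)

end

end SincWH

open SincWH

/-!
The starting point is `specQ_eq`: off the real axis the branches in `Q_s` combine into
`Q_s(w) = (w - 1)⁻¹ z^{1/2 + iλ}` with `z = (w - 1) / (w + 1)` and `λ = (2π)⁻¹ ln (1/s - 1)`. Hence
`Q_s` is holomorphic in the open half planes, `|Q_s(w)| ≤ e^{π|λ|} |w² - 1|^{-1/2}`, and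
`Q_s'` decays like `|w|⁻²`.

*Spectral functions.* Partial integration on the line `Im w = β` turns the improper integral into
an absolutely convergent one (`tendsto_specTrunc`), and Cauchy's theorem makes it independent of
`β > 0` (`specFun_eq_specFun`). Moving the line to `+i∞` shows that `q_s^+` vanishes on `]-∞, 0[`
(`specFun_of_neg`); taking `β = 1 + 1/x` gives a bound for `x > 0` which is uniform near `x = 0`
and locally uniform in `s` (`norm_specFun_le`). The conjugation symmetries of `Q_s` show that
`q_±` are real and that `q_-(s, x) = q_+(1 - s, -x)`, so that everything about `q_-` follows by
reflection.

*The factorisation.* Let `U_± = 𝓕⁻¹ S⁻¹ (𝓕⁻¹ ⊕ 𝓕⁻¹) R_±`. For a test function `G` supported away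
from the origin, `⟨G, U_± h⟩ = ⟨R_±^* (𝓕 ⊕ 𝓕) S 𝓕 G, h⟩`. The components of `(𝓕 ⊕ 𝓕) S 𝓕 G` are
integrals of `𝓕 G` against explicit kernels, after the substitution `u = (1 - e^x) (1 + e^x)⁻¹`
for `|u| < 1` and `u = (1 + e^x) (1 - e^x)⁻¹` for `|u| > 1` (`fourierL2_opS_fst`,
`fourierL2_opS_snd`). For `U_+` the weights of `R_+^*` assemble these two kernels into exactly the
boundary value `n(s) Q_s(u + i0)` (`tendsto_nrm_mul_specQ`). On the other hand, Parseval's identity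
on the lines `Im w = ε` and the limit `ε → 0` give
`∫ n(s) Q_s(u + i0) (𝓕 G)(u) du = ∫_0^∞ q_+(s, x) G(x) dx` (`integral_bdry_mul_fourierInt`). So
`q_±` is the kernel of `U_±` in a weak sense, recorded in `IsKernel`.

*Conclusion.* By Fubini's theorem and the bounds on the kernel, `U_±` acts as an integral operator
on functions supported in a compact subset of `]0, 1[` (`IsKernel.apply_ae`); by density its values
are supported in `ℝ_±`, and truncation yields the formula for `V_± = P_± U_±`. The vectors
`(l_+, l_-)` and `(l_-, -l_+)` are orthogonal in `ℂ²`, so `R_+` and `R_-` have complementary ranges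
(`Rplus_add_Rminus`), and hence so have `U_+` and `U_-`; since these ranges lie in the complementary
subspaces `L²(ℝ_+)` and `L²(ℝ_-)`, each of them fills its subspace
(`IsKernel.restrictOp_surjective`). Finally `V_±⁻¹ = V_±^*` is the integral operator with the
transposed kernel, because the kernel is real (`IsKernel.symm_truncL_ae`).
-/

namespace SincWH

noncomputable section

/-! ### The functions `Q_s` off the real axis -/

/-- The spectral parameter `λ = (2π)⁻¹ ln (1/s - 1)`; it is minus the inverse function of `sig`. -/
def lam (s : ℝ) : ℝ := (2 * Real.pi)⁻¹ * Real.log (1 / s - 1)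

/-- The Cayley-type transform `w ↦ (w - 1) / (w + 1)`, which maps `ℂ \ [-1, 1]` into the slit
plane. -/
def cay (w : ℂ) : ℂ := (w - 1) / (w + 1)

theorem sub_one_ne {w : ℂ} (hw : w.im ≠ 0) : w - 1 ≠ 0 :=
  fun h => hw (by simpa using congrArg Complex.im h)

theorem add_one_ne {w : ℂ} (hw : w.im ≠ 0) : w + 1 ≠ 0 :=
  fun h => hw (by simpa using congrArg Complex.im h)

theorem sq_sub_one_ne {w : ℂ} (hw : w.im ≠ 0) : w ^ 2 - 1 ≠ 0 := by
  have : w ^ 2 - 1 = (w - 1) * (w + 1) := by ring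
  rw [this]; exact mul_ne_zero (sub_one_ne hw) (add_one_ne hw)

theorem cay_im (w : ℂ) : (cay w).im = 2 * w.im / Complex.normSq (w + 1) := by
  unfold cay
  rw [Complex.div_im]
  simp
  ring

theorem cay_mem_slitPlane {w : ℂ} (hw : w.im ≠ 0) : cay w ∈ Complex.slitPlane := by
  refine Or.inr ?_
  rw [cay_im]
  have := Complex.normSq_pos.2 (add_one_ne hw)
  exact div_ne_zero (mul_ne_zero two_ne_zero hw) this.ne'

/-- The principal square root of `v²` is `v` if `v` lies in the right half plane. -/
theorem exp_half_log_sq {v : ℂ} (hv : 0 < v.re) :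
    Complex.exp (1 / 2 * Complex.log (v ^ 2)) = v := by
  have h0 : v ≠ 0 := fun h => by simp [h] at hv
  have h1 := Complex.abs_arg_lt_pi_div_two_iff.2 (Or.inl hv)
  have h2 := abs_lt.1 h1
  have h3 : v ^ 2 = Complex.exp (2 * Complex.log v) := by
    rw [two_mul, Complex.exp_add, Complex.exp_log h0, sq]
  have h4 : (2 * Complex.log v).im = 2 * v.arg := by simp [Complex.log_im]
  rw [h3, Complex.log_exp (by rw [h4]; linarith) (by rw [h4]; linarith), ← mul_assoc, one_div,
    inv_mul_cancel₀ two_ne_zero, one_mul, Complex.exp_log h0]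

/-- Off the real axis the two branches in the definition of `Q_s` combine into
`Q_s(w) = (w - 1)⁻¹ z^{1/2 + iλ}` with `z = (w - 1) / (w + 1)`. The point is that
`w² / (w² - 1)` is the square of `(ζ + ζ⁻¹) / 2`, where `ζ = z^{1/2}` has positive real part. -/
theorem specQ_eq (s : ℝ) {w : ℂ} (hw : w.im ≠ 0) :
    specQ s w = (w - 1)⁻¹ * Complex.exp ((1 / 2 + Complex.I * lam s) * Complex.log (cay w)) := by
  have hw0 : w ≠ 0 := fun h => hw (by simp [h])
  have hm := sub_one_ne hw
  have hp := add_one_ne hw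
  have hq := sq_sub_one_ne hw
  have hz := cay_mem_slitPlane hw
  have hz0 := Complex.slitPlane_ne_zero hz
  set ζ := Complex.exp (1 / 2 * Complex.log (cay w)) with hζ
  have hζ0 : ζ ≠ 0 := Complex.exp_ne_zero _
  have hζ2 : ζ ^ 2 = cay w := by
    rw [hζ, ← Complex.exp_nat_mul]
    push_cast
    rw [← mul_assoc, mul_one_div_cancel two_ne_zero, one_mul, Complex.exp_log hz0]
  have hζre : 0 < ζ.re := by
    rw [hζ, Complex.exp_re]
    have h1 := Complex.mem_slitPlane_iff_arg.1 hz
    have h2 := Complex.neg_pi_lt_arg (cay w)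
    have h3 := lt_of_le_of_ne (Complex.arg_le_pi (cay w)) h1.1
    refine mul_pos (Real.exp_pos _) (Real.cos_pos_of_mem_Ioo ⟨?_, ?_⟩)
    · simp [Complex.log_im]; linarith
    · simp [Complex.log_im]; linarith
  -- `(ζ + ζ⁻¹) / 2` lies in the right half plane, so the principal branch recovers it from its
  -- square `w² / (w² - 1)`.
  have hvre : 0 < ((ζ + ζ⁻¹) / 2).re := by
    have h1 : 0 < (ζ⁻¹).re := by
      rw [Complex.inv_re]; exact div_pos hζre (Complex.normSq_pos.2 hζ0)
    have h2 : ((ζ + ζ⁻¹) / 2).re = (ζ.re + (ζ⁻¹).re) / 2 := by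
      rw [← Complex.add_re]; simp
    rw [h2]; positivity
  have hsum : 1 + cay w = 2 * w / (w + 1) := by unfold cay; field_simp; ring
  have hv : (ζ + ζ⁻¹) / 2 = w / ((w + 1) * ζ) := by
    have : (ζ + ζ⁻¹) / 2 = (1 + ζ ^ 2) / (2 * ζ) := by field_simp; ring
    rw [this, hζ2, hsum]
    field_simp
  have hv2 : ((ζ + ζ⁻¹) / 2) ^ 2 = w ^ 2 / (w ^ 2 - 1) := by
    rw [hv, div_pow, mul_pow, hζ2]
    unfold cay
    have : w ^ 2 - 1 = (w - 1) * (w + 1) := by ring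
    rw [this]
    field_simp
  have h1 : Complex.exp (-(1 / 2) * Complex.log (w ^ 2 / (w ^ 2 - 1))) = (w + 1) * ζ / w := by
    rw [neg_mul, Complex.exp_neg, ← hv2, exp_half_log_sq hvre, hv, inv_div]
  have h2 : Complex.I / (2 * Real.pi) * (Real.log (1 / s - 1) : ℝ) *
      Complex.log ((w - 1) / (w + 1)) = Complex.I * lam s * Complex.log (cay w) := by
    unfold lam cay
    push_cast
    ring
  unfold specQ
  rw [h1, h2, add_mul (1 / 2 : ℂ), Complex.exp_add, ← hζ]
  have h3 : w / (w ^ 2 - 1) * ((w + 1) * ζ / w) = (w - 1)⁻¹ * ζ := by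
    have : w ^ 2 - 1 = (w - 1) * (w + 1) := by ring
    rw [this]
    field_simp
  rw [h3, mul_assoc]

/-- The logarithmic derivative of `Q_s` is `(2iλ - w) / (w² - 1)`. -/
theorem hasDerivAt_specQ (s : ℝ) {w : ℂ} (hw : w.im ≠ 0) :
    HasDerivAt (specQ s) (specQ s w * ((2 * Complex.I * lam s - w) / (w ^ 2 - 1))) w := by
  have hm := sub_one_ne hw
  have hp := add_one_ne hw
  have hq := sq_sub_one_ne hw
  have hc : HasDerivAt cay (2 / (w + 1) ^ 2) w := by
    refine (((hasDerivAt_id w).sub_const 1).div ((hasDerivAt_id w).add_const 1) hp).congr_deriv ?_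
    simp only [id]
    congr 1
    ring
  have hl := hc.clog (cay_mem_slitPlane hw)
  have h1 := ((hl.const_mul (1 / 2 + Complex.I * lam s : ℂ)).cexp)
  have h2 := (((hasDerivAt_id w).sub_const (1 : ℂ)).inv hm).mul h1
  have hopen : ∀ᶠ v in 𝓝 w, v.im ≠ 0 :=
    Complex.continuous_im.continuousAt.eventually_ne hw
  have h3 := h2.congr_of_eventuallyEq (f₁ := specQ s)
    (hopen.mono fun v hv => by rw [specQ_eq s hv]; simp)
  refine h3.congr_deriv ?_
  rw [specQ_eq s hw]
  simp only [id, Pi.inv_apply]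
  set e := Complex.exp ((1 / 2 + Complex.I * lam s) * Complex.log (cay w))
  have : w ^ 2 - 1 = (w - 1) * (w + 1) := by ring
  rw [this]
  unfold cay
  field_simp
  ring

/-- The two factors `|w - 1|⁻¹` and `|z|^{1/2}` combine to `|w² - 1|^{-1/2}`; the exponential comes
from the argument of `z`. -/
theorem norm_specQ (s : ℝ) {w : ℂ} (hw : w.im ≠ 0) :
    ‖specQ s w‖ = Real.exp (-(lam s * (cay w).arg)) * (Real.sqrt ‖w ^ 2 - 1‖)⁻¹ := by
  have hm := norm_pos_iff.2 (sub_one_ne hw)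
  have hp := norm_pos_iff.2 (add_one_ne hw)
  have hz := Complex.slitPlane_ne_zero (cay_mem_slitPlane hw)
  have h0 : ((1 / 2 + Complex.I * lam s) * Complex.log (cay w)).re =
      Real.log ‖cay w‖ / 2 + -(lam s * (cay w).arg) := by
    simp [Complex.log_re, Complex.log_im]
    ring
  have h1 : Real.exp (Real.log ‖cay w‖ / 2) = Real.sqrt ‖cay w‖ := by
    rw [Real.exp_half, Real.exp_log (norm_pos_iff.2 hz)]
  have h2 : w ^ 2 - 1 = (w - 1) * (w + 1) := by ring
  rw [specQ_eq s hw, norm_mul, norm_inv, Complex.norm_exp, h0, Real.exp_add, h1, h2, norm_mul,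
    Real.sqrt_mul hm.le, cay, norm_div, Real.sqrt_div hm.le]
  have e1 := Real.sqrt_pos.2 hm
  have e2 := Real.sqrt_pos.2 hp
  have e3 := Real.sq_sqrt hm.le
  set a := Real.sqrt ‖w - 1‖
  rw [← e3]
  field_simp

theorem norm_specQ_le (s : ℝ) {w : ℂ} (hw : w.im ≠ 0) :
    ‖specQ s w‖ ≤ Real.exp (Real.pi * |lam s|) * (Real.sqrt ‖w ^ 2 - 1‖)⁻¹ := by
  rw [norm_specQ s hw]
  gcongr
  calc -(lam s * (cay w).arg) ≤ |lam s * (cay w).arg| := neg_le_abs _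
    _ = |(cay w).arg| * |lam s| := by rw [abs_mul, mul_comm]
    _ ≤ Real.pi * |lam s| := by gcongr; exact Complex.abs_arg_le_pi _

theorem measurable_specQ : Measurable (Function.uncurry specQ) := by
  unfold Function.uncurry specQ
  fun_prop

/-! ### Symmetries of the spectral functions -/

theorem lam_one_sub {s : ℝ} (hs : s ∈ Ioo (0 : ℝ) 1) : lam (1 - s) = -lam s := by
  unfold lam
  have h0 := hs.1
  have h1 : 0 < 1 - s := by linarith [hs.2]
  have e1 : 1 / s - 1 = (1 - s) / s := by field_simp
  have e2 : 1 / (1 - s) - 1 = s / (1 - s) := by field_simp; ring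
  rw [e1, e2, Real.log_div h0.ne' h1.ne', Real.log_div h1.ne' h0.ne']
  ring

theorem exp_pi_lam {s : ℝ} (hs : s ∈ Ioo (0 : ℝ) 1) :
    Real.exp (-(Real.pi * lam s)) = Real.sqrt s / Real.sqrt (1 - s) := by
  have h0 := hs.1
  have h1 : 0 < 1 - s := by linarith [hs.2]
  have e : -(Real.pi * lam s) = Real.log (s / (1 - s)) / 2 := by
    unfold lam
    have e1 : 1 / s - 1 = (1 - s) / s := by field_simp
    rw [e1, Real.log_div h0.ne' h1.ne', Real.log_div h1.ne' h0.ne']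
    have := Real.pi_ne_zero
    field_simp
    ring
  rw [e, Real.exp_half, Real.exp_log (by positivity), Real.sqrt_div h0.le]

theorem cay_conj (w : ℂ) : cay (starRingEnd ℂ w) = starRingEnd ℂ (cay w) := by
  unfold cay; simp

/-- Conjugation symmetry: `Q_s(w̄) = conj Q_{1-s}(w)`. -/
theorem specQ_conj {s : ℝ} (hs : s ∈ Ioo (0 : ℝ) 1) {w : ℂ} (hw : w.im ≠ 0) :
    specQ s (starRingEnd ℂ w) = starRingEnd ℂ (specQ (1 - s) w) := by
  have hw' : (starRingEnd ℂ w).im ≠ 0 := by simpa using hw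
  rw [specQ_eq s hw', specQ_eq (1 - s) hw, cay_conj,
    Complex.log_conj _ (Complex.mem_slitPlane_iff_arg.1 (cay_mem_slitPlane hw)).1, lam_one_sub hs,
    map_mul, ← Complex.exp_conj]
  simp [Complex.conj_ofNat]

/-- Reflection symmetry: `Q_s(-w̄) = -conj Q_s(w)`. -/
theorem specQ_neg_conj (s : ℝ) {w : ℂ} (hw : w.im ≠ 0) :
    specQ s (-starRingEnd ℂ w) = -starRingEnd ℂ (specQ s w) := by
  have hw' : (-starRingEnd ℂ w).im ≠ 0 := by simpa using hw
  have hz := cay_mem_slitPlane hw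
  have hm := sub_one_ne hw
  have hp := add_one_ne hw
  have harg := (Complex.mem_slitPlane_iff_arg.1 hz).1
  set v := starRingEnd ℂ w with hv
  have hvm : v - 1 ≠ 0 := sub_one_ne (by simpa [hv] using hw)
  have hvp : v + 1 ≠ 0 := add_one_ne (by simpa [hv] using hw)
  have h1 : cay (-v) = (starRingEnd ℂ (cay w))⁻¹ := by
    rw [← cay_conj, ← hv]
    unfold cay
    rw [inv_div, ← neg_div_neg_eq]
    congr 1 <;> ring
  have hcz : starRingEnd ℂ (cay w) ≠ 0 := by
    simpa using Complex.slitPlane_ne_zero hz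
  have harg' : (starRingEnd ℂ (cay w)).arg ≠ Real.pi := by
    rw [Complex.arg_conj, if_neg harg]
    have := Complex.neg_pi_lt_arg (cay w)
    intro h; linarith
  have h2 : Complex.log (cay (-v)) = -starRingEnd ℂ (Complex.log (cay w)) := by
    rw [h1, Complex.log_inv _ harg', Complex.log_conj _ harg]
  rw [specQ_eq s hw', specQ_eq s hw, h2, map_mul, ← Complex.exp_conj]
  -- `log z` passes into minus its conjugate, which suits the exponent `iλ` but not the exponent
  -- `1/2`; the extra term is compensated by the factor `(w - 1)⁻¹`.
  have e3 : starRingEnd ℂ ((1 / 2 + Complex.I * lam s) * Complex.log (cay w)) =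
      (1 / 2 + Complex.I * lam s) * -starRingEnd ℂ (Complex.log (cay w)) +
        starRingEnd ℂ (Complex.log (cay w)) := by
    simp [Complex.conj_ofNat]
    ring
  rw [e3, Complex.exp_add, Complex.exp_conj, Complex.exp_log (Complex.slitPlane_ne_zero hz),
    ← cay_conj, ← hv]
  have e4 : starRingEnd ℂ (w - 1)⁻¹ = (v - 1)⁻¹ := by simp [hv]
  rw [e4]
  unfold cay
  have e5 : -v - 1 = -(v + 1) := by ring
  rw [e5]
  field_simp

/-! ### The spectral functions on horizontal lines -/

/-- The derivative of `Q_s` off the real axis. -/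
def specDQ (s : ℝ) (w : ℂ) : ℂ := specQ s w * ((2 * Complex.I * lam s - w) / (w ^ 2 - 1))

/-- The character `w ↦ e^{-ixw}` on the line `Im w = β`. -/
def expLine (β x u : ℝ) : ℂ := Complex.exp (-Complex.I * x * (u + Complex.I * β))

theorem norm_expLine (β x u : ℝ) : ‖expLine β x u‖ = Real.exp (x * β) := by
  unfold expLine
  rw [Complex.norm_exp]
  congr 1
  simp

theorem line_im (β u : ℝ) : ((u : ℂ) + Complex.I * β).im = β := by simp

theorem normSq_line_sq_sub_one (β u : ℝ) :
    ‖((u : ℂ) + Complex.I * β) ^ 2 - 1‖ ^ 2 = (1 + β ^ 2 + u ^ 2) ^ 2 - 4 * u ^ 2 := by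
  rw [← Complex.normSq_eq_norm_sq, Complex.normSq_apply]
  simp [pow_two]
  ring

/-- On the line `Im w = β` the distance of `w²` from `1` is bounded below, with quadratic growth in
`u = Re w`. -/
theorem le_norm_line_sq_sub_one {β : ℝ} (hβ : β ≠ 0) (u : ℝ) :
    β ^ 2 / (1 + β ^ 2) * (1 + β ^ 2 + u ^ 2) ≤ ‖((u : ℂ) + Complex.I * β) ^ 2 - 1‖ := by
  refine (sq_le_sq₀ (by positivity) (norm_nonneg _)).1 ?_
  rw [normSq_line_sq_sub_one]
  set N := 1 + β ^ 2 + u ^ 2 with hN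
  have h1 : β ^ 2 / (1 + β ^ 2) ≤ 1 := by rw [div_le_one (by positivity)]; linarith
  have h2 : 4 * u ^ 2 ≤ N ^ 2 / (1 + β ^ 2) := by
    rw [le_div_iff₀ (by positivity)]
    nlinarith [sq_nonneg (1 + β ^ 2 - u ^ 2)]
  calc (β ^ 2 / (1 + β ^ 2) * N) ^ 2 = (β ^ 2 / (1 + β ^ 2)) * (β ^ 2 / (1 + β ^ 2)) * N ^ 2 := by
        ring
    _ ≤ (β ^ 2 / (1 + β ^ 2)) * 1 * N ^ 2 := by gcongr
    _ = N ^ 2 - N ^ 2 / (1 + β ^ 2) := by field_simp; ring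
    _ ≤ _ := by linarith

theorem norm_line_le (β u : ℝ) :
    ‖(u : ℂ) + Complex.I * β‖ ≤ Real.sqrt (1 + β ^ 2 + u ^ 2) := by
  refine Real.le_sqrt_of_sq_le ?_
  rw [← Complex.normSq_eq_norm_sq, Complex.normSq_apply]
  simp
  nlinarith

/-- The constant in the estimate `norm_specDQ_le`; it is locally bounded in `s ∈ (0,1)`. -/
def bdConst (s : ℝ) : ℝ := Real.exp (Real.pi * |lam s|) * (2 * |lam s| + 1)

theorem bdConst_nonneg (s : ℝ) : 0 ≤ bdConst s := by unfold bdConst; positivity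

/-- The constant is controlled as `β → ∞`, which is what allows the line of integration to be moved
to infinity. -/
theorem norm_specDQ_le (s : ℝ) {β : ℝ} (hβ : β ≠ 0) (u : ℝ) :
    ‖specDQ s (u + Complex.I * β)‖ ≤
      bdConst s * ((1 + β ^ 2) / β ^ 2) ^ 2 * (β ^ 2 + u ^ 2)⁻¹ := by
  have him : ((u : ℂ) + Complex.I * β).im ≠ 0 := by rwa [line_im]
  have hQ := norm_specQ_le s him
  have hD := le_norm_line_sq_sub_one hβ u
  have hw := norm_line_le β u
  set w : ℂ := u + Complex.I * β
  set N := 1 + β ^ 2 + u ^ 2 with hN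
  set ρ := β ^ 2 / (1 + β ^ 2) with hρ
  have hρ0 : 0 < ρ := by positivity
  have hρ1 : ρ ≤ 1 := by rw [hρ, div_le_one (by positivity)]; linarith
  have hN1 : 1 ≤ N := by nlinarith [sq_nonneg β, sq_nonneg u]
  have hN0 : 0 < N := by linarith
  have hsN : 1 ≤ Real.sqrt N := Real.one_le_sqrt.2 hN1
  have hsD : ρ * Real.sqrt N ≤ Real.sqrt ‖w ^ 2 - 1‖ := by
    refine Real.le_sqrt_of_sq_le ?_
    rw [mul_pow, Real.sq_sqrt hN0.le]
    refine le_trans ?_ hD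
    gcongr
    nlinarith
  have hnum : ‖2 * Complex.I * lam s - w‖ ≤ (2 * |lam s| + 1) * Real.sqrt N := by
    calc ‖2 * Complex.I * lam s - w‖ ≤ ‖2 * Complex.I * lam s‖ + ‖w‖ := norm_sub_le _ _
      _ ≤ 2 * |lam s| + Real.sqrt N := by
        gcongr
        simp
      _ ≤ 2 * |lam s| * Real.sqrt N + Real.sqrt N := by
        have := le_mul_of_one_le_right (by positivity : 0 ≤ 2 * |lam s|) hsN
        linarith
      _ = _ := by ring
  unfold specDQ
  rw [norm_mul, norm_div]
  calc ‖specQ s w‖ * (‖2 * Complex.I * lam s - w‖ / ‖w ^ 2 - 1‖)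
      ≤ (Real.exp (Real.pi * |lam s|) * (ρ * Real.sqrt N)⁻¹) *
        ((2 * |lam s| + 1) * Real.sqrt N / (ρ * N)) := by
        refine mul_le_mul (hQ.trans ?_) ?_ (by positivity) (by positivity)
        · gcongr
        · gcongr
    _ = bdConst s * (ρ⁻¹) ^ 2 * N⁻¹ := by
        unfold bdConst
        field_simp
    _ ≤ bdConst s * ((1 + β ^ 2) / β ^ 2) ^ 2 * (β ^ 2 + u ^ 2)⁻¹ := by
        rw [hρ, inv_div]
        have := bdConst_nonneg s
        have : 0 < β ^ 2 + u ^ 2 := by positivity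
        gcongr
        linarith

theorem inv_sq_add_sq_eq {β : ℝ} (hβ : 0 < β) (u : ℝ) :
    (β ^ 2 + u ^ 2)⁻¹ = (β ^ 2)⁻¹ * (1 + (u / β) ^ 2)⁻¹ := by
  rw [← mul_inv]
  congr 1
  field_simp

theorem integrable_inv_sq_add_sq {β : ℝ} (hβ : 0 < β) :
    Integrable fun u : ℝ => (β ^ 2 + u ^ 2)⁻¹ := by
  simp_rw [inv_sq_add_sq_eq hβ]
  exact (integrable_inv_one_add_sq.comp_div hβ.ne').const_mul _

theorem integral_inv_sq_add_sq {β : ℝ} (hβ : 0 < β) :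
    ∫ u : ℝ, (β ^ 2 + u ^ 2)⁻¹ = Real.pi / β := by
  simp_rw [inv_sq_add_sq_eq hβ]
  rw [integral_const_mul, Measure.integral_comp_div (fun u => (1 + u ^ 2)⁻¹) β,
    integral_univ_inv_one_add_sq, abs_of_pos hβ, smul_eq_mul]
  field_simp

theorem measurable_specDQ : Measurable (Function.uncurry specDQ) := by
  have h := measurable_specQ
  unfold Function.uncurry at h
  unfold Function.uncurry specDQ lam
  fun_prop

theorem measurable_expLine : Measurable fun p : (ℝ × ℝ) × ℝ => expLine p.1.1 p.1.2 p.2 := by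
  unfold expLine
  fun_prop

theorem integrable_specDQ_line (s : ℝ) {β : ℝ} (hβ : 0 < β) (x : ℝ) :
    Integrable fun u : ℝ => expLine β x u * specDQ s (u + Complex.I * β) := by
  refine Integrable.mono' (((integrable_inv_sq_add_sq hβ).const_mul
    (Real.exp (x * β) * (bdConst s * ((1 + β ^ 2) / β ^ 2) ^ 2)))) ?_
    (Eventually.of_forall fun u => ?_)
  · have h1 : Measurable fun u : ℝ => specDQ s (u + Complex.I * β) :=
      measurable_specDQ.comp (f := fun u : ℝ => (s, (u : ℂ) + Complex.I * β)) (by fun_prop)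
    have h2 : Measurable fun u : ℝ => expLine β x u :=
      measurable_expLine.comp (f := fun u : ℝ => ((β, x), u)) (by fun_prop)
    exact (h2.mul h1).aestronglyMeasurable
  · rw [norm_mul, norm_expLine, mul_assoc]
    gcongr
    exact norm_specDQ_le s hβ.ne' u

/-- The absolutely convergent form `-(2π)^{-1/2} (i/x) ∫ e^{-ixw} Q_s'(w) dw` of the spectral
function, obtained by partial integration. -/
def specAlt (β s x : ℝ) : ℂ :=
  -((((Real.sqrt (2 * Real.pi))⁻¹ : ℝ) : ℂ) *
    (Complex.I / x * ∫ u : ℝ, expLine β x u * specDQ s (u + Complex.I * β)))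

theorem hasDerivAt_expLine (β x u : ℝ) :
    HasDerivAt (expLine β x) (-Complex.I * x * expLine β x u) u := by
  have h1 : HasDerivAt (fun v : ℝ => -Complex.I * x * ((v : ℂ) + Complex.I * β))
      (-Complex.I * x) u := by
    simpa using ((Complex.ofRealCLM.hasDerivAt (x := u)).add_const (Complex.I * β)).const_mul
      (-Complex.I * x)
  refine h1.cexp.congr_deriv ?_
  unfold expLine
  ring

theorem hasDerivAt_specQ_line (s : ℝ) {β : ℝ} (hβ : β ≠ 0) (u : ℝ) :
    HasDerivAt (fun v : ℝ => specQ s (v + Complex.I * β)) (specDQ s (u + Complex.I * β)) u := by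
  have h1 : HasDerivAt (fun v : ℝ => (v : ℂ) + Complex.I * β) 1 u := by
    simpa using (Complex.ofRealCLM.hasDerivAt (x := u)).add_const (Complex.I * β)
  have h2 := hasDerivAt_specQ s (w := u + Complex.I * β) (by rwa [line_im])
  exact (h2.comp u h1).congr_deriv (mul_one _)

theorem continuous_specQ_line (s : ℝ) {β : ℝ} (hβ : β ≠ 0) :
    Continuous fun v : ℝ => specQ s (v + Complex.I * β) :=
  continuous_iff_continuousAt.2 fun u => (hasDerivAt_specQ_line s hβ u).continuousAt

theorem continuous_expLine (β x : ℝ) : Continuous (expLine β x) :=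
  continuous_iff_continuousAt.2 fun u => (hasDerivAt_expLine β x u).continuousAt

theorem continuous_specDQ_line (s : ℝ) {β : ℝ} (hβ : β ≠ 0) :
    Continuous fun v : ℝ => specDQ s (v + Complex.I * β) := by
  have h := continuous_specQ_line s hβ
  unfold specDQ
  have h0 : ∀ v : ℝ, ((v : ℂ) + Complex.I * β) ^ 2 - 1 ≠ 0 := fun v =>
    sq_sub_one_ne (by rwa [line_im])
  fun_prop (disch := exact h0 _)

/-- Partial integration over the segment from `-A + iβ` to `A + iβ`. -/
theorem specTrunc_eq (s : ℝ) {β x : ℝ} (hβ : β ≠ 0) (hx : x ≠ 0) (A : ℝ) :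
    specTrunc β s x A = (((Real.sqrt (2 * Real.pi))⁻¹ : ℝ) : ℂ) * (Complex.I / x *
      (expLine β x A * specQ s (A + Complex.I * β) -
        expLine β x (-A) * specQ s ((-A : ℝ) + Complex.I * β) -
        ∫ u in (-A)..A, expLine β x u * specDQ s (u + Complex.I * β))) := by
  have hx' : (x : ℂ) ≠ 0 := by exact_mod_cast hx
  have hc1 : Continuous fun u : ℝ => -Complex.I * x *
      (expLine β x u * specQ s (u + Complex.I * β)) :=
    continuous_const.mul ((continuous_expLine β x).mul (continuous_specQ_line s hβ))
  have hc2 : Continuous fun u : ℝ => expLine β x u * specDQ s (u + Complex.I * β) :=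
    (continuous_expLine β x).mul (continuous_specDQ_line s hβ)
  have hd : ∀ u : ℝ, HasDerivAt (fun u : ℝ => expLine β x u * specQ s (u + Complex.I * β))
      (-Complex.I * x * (expLine β x u * specQ s (u + Complex.I * β)) +
        expLine β x u * specDQ s (u + Complex.I * β)) u := fun u =>
    ((hasDerivAt_expLine β x u).mul (hasDerivAt_specQ_line s hβ u)).congr_deriv (by ring)
  -- The derivative of `e^{-ixw} Q_s(w)` along the line has the two terms of the partial integration.
  have h := intervalIntegral.integral_eq_sub_of_hasDerivAt (a := -A) (b := A) (fun u _ => hd u)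
    ((hc1.add hc2).intervalIntegrable _ _)
  rw [intervalIntegral.integral_add (hc1.intervalIntegrable _ _)
    (hc2.intervalIntegrable _ _), intervalIntegral.integral_const_mul] at h
  rw [← h]
  unfold specTrunc
  congr 1
  simp only [add_sub_cancel_right]
  rw [← mul_assoc, show Complex.I / x * (-Complex.I * x) = 1 by
    field_simp; simp, one_mul]
  rfl

theorem norm_specQ_line_le (s : ℝ) {β : ℝ} (hβ : β ≠ 0) (u : ℝ) :
    ‖specQ s (u + Complex.I * β)‖ ≤ Real.exp (Real.pi * |lam s|) *
      (Real.sqrt (β ^ 2 / (1 + β ^ 2) * (1 + β ^ 2 + u ^ 2)))⁻¹ := by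
  refine (norm_specQ_le s (by rwa [line_im])).trans ?_
  gcongr
  exact le_norm_line_sq_sub_one hβ u

theorem tendsto_specQ_line (s : ℝ) {β : ℝ} (hβ : β ≠ 0) {l : Filter ℝ}
    (hl : Tendsto (fun u : ℝ => u ^ 2) l atTop) :
    Tendsto (fun u : ℝ => specQ s (u + Complex.I * β)) l (𝓝 0) := by
  refine squeeze_zero_norm (norm_specQ_line_le s hβ) ?_
  rw [← mul_zero (Real.exp (Real.pi * |lam s|))]
  refine Tendsto.const_mul _ (tendsto_inv_atTop_zero.comp (Real.tendsto_sqrt_atTop.comp ?_))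
  exact (tendsto_atTop_add_const_left _ _ hl).const_mul_atTop (by positivity)

theorem tendsto_specTrunc_specAlt (s : ℝ) {β x : ℝ} (hβ : 0 < β) (hx : x ≠ 0) :
    Tendsto (specTrunc β s x) atTop (𝓝 (specAlt β s x)) := by
  have hEQ : ∀ {l : Filter ℝ}, Tendsto (fun u : ℝ => u ^ 2) l atTop →
      Tendsto (fun u : ℝ => expLine β x u * specQ s (u + Complex.I * β)) l (𝓝 0) := by
    intro l hl
    have h := (tendsto_specQ_line s hβ.ne' hl).norm.const_mul (Real.exp (x * β))
    rw [norm_zero, mul_zero] at h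
    exact squeeze_zero_norm (fun u => by rw [norm_mul, norm_expLine]) h
  have h1 := hEQ (l := atTop) (tendsto_pow_atTop two_ne_zero)
  have h2 : Tendsto (fun A : ℝ => expLine β x (-A) * specQ s ((-A : ℝ) + Complex.I * β)) atTop
      (𝓝 0) :=
    (hEQ (l := atBot) (by
      simpa [Function.comp_def] using
        (tendsto_pow_atTop (α := ℝ) two_ne_zero).comp tendsto_abs_atBot_atTop)).comp
      tendsto_neg_atTop_atBot
  have h3 := intervalIntegral_tendsto_integral (integrable_specDQ_line s hβ x)
    tendsto_neg_atTop_atBot tendsto_id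
  have h4 := (((h1.sub h2).sub h3).const_mul (Complex.I / x)).const_mul
    ((((Real.sqrt (2 * Real.pi))⁻¹ : ℝ) : ℂ))
  have h5 := h4.congr fun A => (specTrunc_eq s hβ.ne' hx A).symm
  refine h5.trans (le_of_eq ?_)
  unfold specAlt
  congr 1
  ring

theorem specFun_eq_specAlt (s : ℝ) {β x : ℝ} (hβ : 0 < β) (hx : x ≠ 0) :
    specFun β s x = specAlt β s x := (tendsto_specTrunc_specAlt s hβ hx).limUnder_eq

theorem tendsto_specTrunc (s : ℝ) {β x : ℝ} (hβ : 0 < β) (hx : x ≠ 0) :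
    Tendsto (specTrunc β s x) atTop (𝓝 (specFun β s x)) := by
  rw [specFun_eq_specAlt s hβ hx]; exact tendsto_specTrunc_specAlt s hβ hx

theorem measurable_specAlt (β : ℝ) : Measurable fun p : ℝ × ℝ => specAlt β p.1 p.2 := by
  have h1 : Measurable fun q : (ℝ × ℝ) × ℝ =>
      expLine β q.1.2 q.2 * specDQ q.1.1 (q.2 + Complex.I * β) :=
    (measurable_expLine.comp (f := fun q : (ℝ × ℝ) × ℝ => ((β, q.1.2), q.2)) (by fun_prop)).mul
      (measurable_specDQ.comp (f := fun q : (ℝ × ℝ) × ℝ => (q.1.1, (q.2 : ℂ) + Complex.I * β))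
        (by fun_prop))
  have h2 := (h1.stronglyMeasurable.integral_prod_right' (ν := volume)).measurable
  unfold specAlt
  fun_prop

/-- The estimate is explicit in `β`, for the shifts of the line of integration. -/
theorem norm_specAlt_le (s : ℝ) {β : ℝ} (hβ : 1 ≤ β) (x : ℝ) :
    ‖specAlt β s x‖ ≤ 4 * Real.pi * bdConst s * (Real.exp (x * β) / (|x| * β)) := by
  have hβ0 : 0 < β := by linarith
  have hb := bdConst_nonneg s
  have hc : ‖(((Real.sqrt (2 * Real.pi))⁻¹ : ℝ) : ℂ)‖ ≤ 1 := by
    rw [Complex.norm_real, Real.norm_eq_abs, abs_of_nonneg (by positivity)]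
    refine inv_le_one_of_one_le₀ (Real.one_le_sqrt.2 ?_)
    linarith [Real.pi_gt_three]
  have h1 : ‖∫ u : ℝ, expLine β x u * specDQ s (u + Complex.I * β)‖ ≤
      Real.exp (x * β) * (bdConst s * 4) * (Real.pi / β) := by
    rw [← integral_inv_sq_add_sq hβ0, ← integral_const_mul]
    refine norm_integral_le_of_norm_le ((integrable_inv_sq_add_sq hβ0).const_mul _)
      (Eventually.of_forall fun u => ?_)
    rw [norm_mul, norm_expLine, mul_assoc]
    gcongr
    refine (norm_specDQ_le s hβ0.ne' u).trans ?_
    have h2 : (1 + β ^ 2) / β ^ 2 ≤ 2 := by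
      rw [div_le_iff₀ (by positivity)]; nlinarith
    have h4 : ((1 + β ^ 2) / β ^ 2) ^ 2 ≤ 4 := by
      calc ((1 + β ^ 2) / β ^ 2) ^ 2 ≤ 2 ^ 2 := by gcongr
        _ = 4 := by norm_num
    gcongr
  unfold specAlt
  rw [norm_neg, norm_mul, norm_mul, norm_div, Complex.norm_I, Complex.norm_real x,
    Real.norm_eq_abs x]
  calc _ ≤ 1 * (1 / |x| * (Real.exp (x * β) * (bdConst s * 4) * (Real.pi / β))) := by gcongr
    _ = _ := by
      have := hβ0.ne'
      -- For `x = 0` both sides vanish, by the convention on division by zero.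
      by_cases hx : |x| = 0
      · simp [hx]
      · field_simp

/-- Independence of the line of integration: Cauchy's theorem for the rectangle with vertices
`±A + iβ₁`, `±A + iβ₂`, whose vertical sides contribute
`O(A^{-1/2})`. -/
theorem specFun_eq_specFun (s : ℝ) {β₁ β₂ x : ℝ} (h₁ : 0 < β₁) (h₁₂ : β₁ ≤ β₂) (hx : x ≠ 0) :
    specFun β₁ s x = specFun β₂ s x := by
  have h₂ : 0 < β₂ := h₁.trans_le h₁₂
  set f : ℂ → ℂ := fun w => Complex.exp (-Complex.I * x * w) * specQ s w with hf
  set V : ℝ → ℂ := fun A => ∫ y in β₁..β₂, f (A + y * Complex.I) with hV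
  have hrect : ∀ A : ℝ, (∫ u in (-A)..A, f (u + β₁ * Complex.I)) -
      (∫ u in (-A)..A, f (u + β₂ * Complex.I)) + Complex.I • V A - Complex.I • V (-A) = 0 := by
    intro A
    have h := Complex.integral_boundary_rect_eq_zero_of_differentiableOn f
      (-A + β₁ * Complex.I) (A + β₂ * Complex.I) (fun w hw => ?_)
    · simpa [hV] using h
    · have him : w.im ≠ 0 := by
        have h2 := hw.2
        simp only [mem_preimage, Complex.add_im, Complex.neg_im, Complex.ofReal_im,
          Complex.mul_im, Complex.ofReal_re, Complex.I_im, Complex.I_re, mul_one, mul_zero,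
          add_zero, neg_zero, zero_add, uIcc_of_le h₁₂] at h2
        exact (h₁.trans_le h2.1).ne'
      refine DifferentiableAt.differentiableWithinAt ?_
      exact (by fun_prop : DifferentiableAt ℂ (fun w => Complex.exp (-Complex.I * x * w)) w).mul
        (hasDerivAt_specQ s him).differentiableAt
  -- The vertical sides: `|w² - 1| ≥ |A - 1| |A + 1| ≥ |A| - 1` there.
  have hVbd : ∀ A : ℝ, 1 < |A| → ‖V A‖ ≤ Real.exp (|x| * β₂) *
      (Real.exp (Real.pi * |lam s|) * (Real.sqrt (|A| - 1))⁻¹) * |β₂ - β₁| := by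
    intro A hA
    refine intervalIntegral.norm_integral_le_of_norm_le_const fun y hy => ?_
    rw [uIoc_of_le h₁₂] at hy
    have hy0 : 0 < y := h₁.trans hy.1
    have him : ((A : ℂ) + y * Complex.I).im ≠ 0 := by simpa using hy0.ne'
    simp only [hf]
    rw [norm_mul]
    refine mul_le_mul ?_ ?_ (norm_nonneg _) (by positivity)
    · rw [Complex.norm_exp]
      refine Real.exp_le_exp.2 ?_
      simp only [neg_mul, Complex.neg_re, Complex.mul_re, Complex.I_re, Complex.ofReal_re, zero_mul,
        Complex.I_im, Complex.ofReal_im, mul_zero, sub_self, Complex.add_re, mul_one, add_zero,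
        Complex.mul_im, one_mul, zero_add, Complex.add_im, zero_sub, neg_neg]
      calc x * y ≤ |x| * y := by gcongr; exact le_abs_self x
        _ ≤ |x| * β₂ := by gcongr; exact hy.2
    · refine (norm_specQ_le s him).trans ?_
      have h3 : |A| - 1 ≤ ‖((A : ℂ) + y * Complex.I) ^ 2 - 1‖ := by
        have e : ((A : ℂ) + y * Complex.I) ^ 2 - 1 =
            ((A : ℂ) + y * Complex.I - 1) * ((A : ℂ) + y * Complex.I + 1) := by ring
        have a1 := Complex.abs_re_le_norm ((A : ℂ) + y * Complex.I - 1)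
        have a2 := Complex.abs_re_le_norm ((A : ℂ) + y * Complex.I + 1)
        simp only [Complex.sub_re, Complex.add_re, Complex.ofReal_re, Complex.mul_re, Complex.I_re,
          mul_zero, Complex.ofReal_im, Complex.I_im, mul_one, sub_self, add_zero,
          Complex.one_re] at a1 a2
        rw [e, norm_mul]
        calc |A| - 1 ≤ |A - 1| * |A + 1| := by
              rw [← abs_mul]
              refine le_trans ?_ (le_abs_self _)
              have : (A - 1) * (A + 1) = |A| ^ 2 - 1 := by rw [sq_abs]; ring
              rw [this]
              nlinarith
          _ ≤ _ := by gcongr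
      have : 0 < |A| - 1 := by linarith
      gcongr
  have hVlim : ∀ {l : Filter ℝ}, Tendsto (fun A : ℝ => |A|) l atTop → Tendsto V l (𝓝 0) := by
    intro l hl
    refine squeeze_zero_norm' ((hl.eventually_gt_atTop 1).mono fun A hA => hVbd A hA) ?_
    have h3 := tendsto_inv_atTop_zero.comp (Real.tendsto_sqrt_atTop.comp
      (tendsto_atTop_add_const_right l (-1) hl))
    have h4 := ((h3.const_mul (Real.exp (Real.pi * |lam s|))).const_mul
      (Real.exp (|x| * β₂))).mul_const |β₂ - β₁|
    simpa [sub_eq_add_neg] using h4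
  have hV1 := hVlim (l := atTop) tendsto_abs_atTop_atTop
  have hV2 := (hVlim (l := atBot) tendsto_abs_atBot_atTop).comp tendsto_neg_atTop_atBot
  have hdiff := ((tendsto_specTrunc s h₁ hx).sub (tendsto_specTrunc s h₂ hx)).congr
    (f₂ := fun A => (((Real.sqrt (2 * Real.pi))⁻¹ : ℝ) : ℂ) *
      (Complex.I • V (-A) - Complex.I • V A)) (fun A => by
        have h := hrect A
        have e : ∀ β : ℝ, specTrunc β s x A = (((Real.sqrt (2 * Real.pi))⁻¹ : ℝ) : ℂ) *
            ∫ u in (-A)..A, f (u + β * Complex.I) := by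
          intro β
          unfold specTrunc
          simp only [hf, mul_comm Complex.I (β : ℂ)]
        rw [e, e, ← mul_sub]
        congr 1
        linear_combination h)
  have hzero := ((hV2.const_smul Complex.I).sub (hV1.const_smul Complex.I)).const_mul
    (((Real.sqrt (2 * Real.pi))⁻¹ : ℝ) : ℂ)
  rw [smul_zero, sub_zero, mul_zero] at hzero
  exact sub_eq_zero.1 (tendsto_nhds_unique hdiff hzero)

/-- For `x < 0` the line of integration can be moved to `+i∞`. -/
theorem specFun_of_neg (s : ℝ) {β x : ℝ} (hβ : 0 < β) (hx : x < 0) : specFun β s x = 0 := by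
  have hbd : ∀ᶠ b : ℝ in atTop, ‖specFun β s x‖ ≤ 4 * Real.pi * bdConst s * (|x|⁻¹ * b⁻¹) := by
    filter_upwards [eventually_ge_atTop β, eventually_ge_atTop 1] with b hb hb1
    have hb0 : 0 < b := by linarith
    rw [specFun_eq_specFun s hβ hb hx.ne, specFun_eq_specAlt s hb0 hx.ne]
    refine (norm_specAlt_le s hb1 x).trans ?_
    have := bdConst_nonneg s
    rw [← mul_inv, ← one_div]
    gcongr
    exact Real.exp_le_one_iff.2 (mul_nonpos_of_nonpos_of_nonneg hx.le hb0.le)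
  have hlim : Tendsto (fun b : ℝ => 4 * Real.pi * bdConst s * (|x|⁻¹ * b⁻¹)) atTop (𝓝 0) := by
    have := (tendsto_inv_atTop_zero (𝕜 := ℝ)).const_mul |x|⁻¹
    simpa using this.const_mul (4 * Real.pi * bdConst s)
  exact norm_le_zero_iff.1 (ge_of_tendsto hlim hbd)

/-- The choice `β = 1 + 1/x` of the line of integration gives a bound without singularity at
`x = 0`. -/
theorem norm_specFun_le (s : ℝ) {β x : ℝ} (hβ : 0 < β) (hx : 0 < x) :
    ‖specFun β s x‖ ≤ 4 * Real.pi * bdConst s * Real.exp (x + 1) := by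
  have hc : ∀ {b₁ b₂ : ℝ}, 0 < b₁ → 0 < b₂ → specFun b₁ s x = specFun b₂ s x := by
    intro b₁ b₂ h1 h2
    rcases le_total b₁ b₂ with h | h
    · exact specFun_eq_specFun s h1 h hx.ne'
    · exact (specFun_eq_specFun s h2 h hx.ne').symm
  have h0 : (0 : ℝ) < 1 + 1 / x := by positivity
  rw [hc hβ h0, specFun_eq_specAlt s h0 hx.ne']
  refine (norm_specAlt_le s (by simp [hx.le]) x).trans ?_
  have := bdConst_nonneg s
  have e1 : x * (1 + 1 / x) = x + 1 := by field_simp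
  rw [abs_of_pos hx, e1]
  gcongr
  exact div_le_self (Real.exp_pos _).le (by linarith)

/-! ### Symmetries of the kernels -/

/-- Lines in the lower half plane reduce to lines in the upper one by `specQ_conj`. -/
theorem specTrunc_neg_line {s : ℝ} (hs : s ∈ Ioo (0 : ℝ) 1) {β : ℝ} (hβ : β ≠ 0) (x A : ℝ) :
    specTrunc (-β) s x A = starRingEnd ℂ (specTrunc β (1 - s) (-x) A) := by
  unfold specTrunc
  rw [map_mul, Complex.conj_ofReal, intervalIntegral.intervalIntegral_eq_integral_uIoc,
    intervalIntegral.intervalIntegral_eq_integral_uIoc, Complex.real_smul, Complex.real_smul,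
    map_mul, Complex.conj_ofReal, ← integral_conj]
  congr 3
  refine funext fun u => ?_
  have h : (u : ℂ) + Complex.I * (-β : ℝ) = starRingEnd ℂ ((u : ℂ) + Complex.I * β) := by simp
  rw [h, specQ_conj hs (by rwa [line_im]), map_mul, ← Complex.exp_conj]
  simp

/-- The truncated integrals are purely imaginary, by `specQ_neg_conj`. -/
theorem specTrunc_conj (s : ℝ) {β : ℝ} (hβ : β ≠ 0) (x A : ℝ) :
    starRingEnd ℂ (specTrunc β s x A) = -specTrunc β s x A := by
  unfold specTrunc
  rw [map_mul, Complex.conj_ofReal, ← mul_neg]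
  congr 1
  have h := intervalIntegral.integral_comp_neg (a := -A) (b := A) (fun u : ℝ =>
    Complex.exp (-Complex.I * x * (u + Complex.I * β)) * specQ s (u + Complex.I * β))
  rw [neg_neg] at h
  conv_rhs => rw [← h]
  rw [← intervalIntegral.integral_neg, intervalIntegral.intervalIntegral_eq_integral_uIoc,
    intervalIntegral.intervalIntegral_eq_integral_uIoc, Complex.real_smul, Complex.real_smul,
    map_mul, Complex.conj_ofReal, ← integral_conj]
  congr 2
  refine funext fun u => ?_
  have h : ((-u : ℝ) : ℂ) + Complex.I * β = -starRingEnd ℂ ((u : ℂ) + Complex.I * β) := by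
    simp
    ring
  rw [h, specQ_neg_conj s (by rwa [line_im]), map_mul, ← Complex.exp_conj, mul_neg, neg_neg]
  congr 2
  simp
  ring

theorem tendsto_specTrunc_neg {s : ℝ} (hs : s ∈ Ioo (0 : ℝ) 1) {β x : ℝ} (hβ : 0 < β)
    (hx : x ≠ 0) :
    Tendsto (specTrunc (-β) s x) atTop (𝓝 (starRingEnd ℂ (specFun β (1 - s) (-x)))) := by
  have h := (Complex.continuous_conj.tendsto _).comp
    (tendsto_specTrunc (1 - s) hβ (neg_ne_zero.2 hx))
  exact h.congr fun A => (specTrunc_neg_line hs hβ.ne' x A).symm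

theorem specFun_neg_line {s : ℝ} (hs : s ∈ Ioo (0 : ℝ) 1) {β x : ℝ} (hβ : 0 < β) (hx : x ≠ 0) :
    specFun (-β) s x = starRingEnd ℂ (specFun β (1 - s) (-x)) :=
  (tendsto_specTrunc_neg hs hβ hx).limUnder_eq

theorem specFun_conj (s : ℝ) {β x : ℝ} (hβ : 0 < β) (hx : x ≠ 0) :
    starRingEnd ℂ (specFun β s x) = -specFun β s x := by
  have h := tendsto_specTrunc s hβ hx
  refine tendsto_nhds_unique ((Complex.continuous_conj.tendsto _).comp h) ?_
  exact h.neg.congr fun A => (specTrunc_conj s hβ.ne' x A).symm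

theorem nrm_conj (s : ℝ) : starRingEnd ℂ (nrm s) = -nrm s := by
  unfold nrm
  simp [neg_div]

/-- The kernel `q_+` is real: both `n(s)` and `q_s^+(x)` are purely imaginary. -/
theorem qPlus_conj (s : ℝ) {b x : ℝ} (hb : 0 < b) (hx : x ≠ 0) :
    starRingEnd ℂ (qPlus b s x) = qPlus b s x := by
  unfold qPlus
  rw [map_mul, nrm_conj, specFun_conj s hb hx, neg_mul_neg]

/-- The two kernels are related by the reflection `(s, x) ↦ (1 - s, -x)`. -/
theorem qMinus_eq {s : ℝ} (hs : s ∈ Ioo (0 : ℝ) 1) {b x : ℝ} (hb : 0 < b) (hx : x ≠ 0) :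
    qMinus b s x = qPlus b (1 - s) (-x) := by
  unfold qMinus
  rw [specFun_neg_line hs hb hx, ← nrm_conj, ← map_mul]
  exact qPlus_conj (1 - s) hb (neg_ne_zero.2 hx)

/-- A jointly measurable version of the kernel `q_+`. -/
def kPlus (b s x : ℝ) : ℂ := nrm s * specAlt b s x

theorem measurable_kPlus (b : ℝ) : Measurable (Function.uncurry (kPlus b)) := by
  have h1 := measurable_specAlt b
  have h2 : Measurable nrm := by unfold nrm; fun_prop
  exact (h2.comp measurable_fst).mul h1

theorem qPlus_eq_kPlus (s : ℝ) {b x : ℝ} (hb : 0 < b) (hx : x ≠ 0) :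
    qPlus b s x = kPlus b s x := by
  unfold qPlus kPlus
  rw [specFun_eq_specAlt s hb hx]

theorem continuousOn_lam : ContinuousOn lam (Ioo 0 1) := by
  unfold lam
  refine ContinuousOn.mul continuousOn_const (ContinuousOn.log ?_ fun s hs => ?_)
  · exact (continuousOn_const.div continuousOn_id fun s hs => hs.1.ne').sub continuousOn_const
  · have : 1 < 1 / s := by rw [lt_div_iff₀ hs.1]; linarith [hs.2]
    linarith

theorem exists_norm_qPlus_le {b : ℝ} (hb : 0 < b) {K : Set ℝ} (hK : IsCompact K)
    (hK1 : K ⊆ Ioo 0 1) (X : ℝ) :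
    ∃ C, ∀ s ∈ K, ∀ x, 0 < x → x ≤ X → ‖qPlus b s x‖ ≤ C := by
  have hl := continuousOn_lam.mono hK1
  have hc : ContinuousOn (fun s => ‖nrm s‖ * (4 * Real.pi * bdConst s * Real.exp (X + 1))) K := by
    refine ContinuousOn.mul (ContinuousOn.norm ?_) ?_
    · unfold nrm
      refine continuousOn_const.mul (Complex.continuous_ofReal.comp_continuousOn ?_)
      refine ContinuousOn.inv₀ (by fun_prop) fun s hs => ?_
      exact (Real.sqrt_pos.2 (mul_pos two_pos (hK1 hs).1)).ne'
    · unfold bdConst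
      fun_prop
  obtain ⟨C, hC⟩ := hK.exists_bound_of_continuousOn hc
  refine ⟨C, fun s hs x hx hxX => le_trans ?_ ((le_abs_self _).trans (hC s hs))⟩
  unfold qPlus
  rw [norm_mul]
  gcongr
  refine (norm_specFun_le s hb hx).trans ?_
  have := bdConst_nonneg s
  gcongr

/-! ### Boundary values on the real axis -/

/-- The boundary value `n(s) Q_s(u + i0)`, see `tendsto_nrm_mul_specQ`. -/
def bdry (s u : ℝ) : ℂ :=
  (((2 * Real.pi)⁻¹ : ℝ) : ℂ) *
    (((((Real.sqrt (1 - s))⁻¹ : ℝ) : ℂ) * sa₁ u - (((Real.sqrt s)⁻¹ : ℝ) : ℂ) * sa₂ u) *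
      Complex.exp (Complex.I * lam s * sψ u))

theorem tendsto_line_zero (u : ℝ) :
    Tendsto (fun ε : ℝ => (u : ℂ) + Complex.I * ε) (𝓝[>] 0) (𝓝 u) := by
  have h : Continuous fun ε : ℝ => (u : ℂ) + Complex.I * ε := by fun_prop
  have := h.tendsto 0
  simp only [Complex.ofReal_zero, mul_zero, add_zero] at this
  exact this.mono_left nhdsWithin_le_nhds

theorem tendsto_cay_line {u : ℝ} (hu : u ≠ -1) :
    Tendsto (fun ε : ℝ => cay ((u : ℂ) + Complex.I * ε)) (𝓝[>] 0)
      (𝓝 (((u - 1) / (u + 1) : ℝ) : ℂ)) := by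
  have h0 : (u : ℂ) + 1 ≠ 0 := by
    intro h
    apply hu
    have := congrArg Complex.re h
    simp at this
    linarith
  have h1 : ContinuousAt cay (u : ℂ) := by
    unfold cay
    fun_prop (disch := exact h0)
  have h2 := h1.tendsto.comp (tendsto_line_zero u)
  refine h2.trans (le_of_eq ?_)
  unfold cay
  push_cast
  rfl

theorem tendsto_specQ_of_tendsto_log {s u : ℝ} (hu : u ≠ 1) {L : ℂ}
    (hL : Tendsto (fun ε : ℝ => Complex.log (cay ((u : ℂ) + Complex.I * ε))) (𝓝[>] 0) (𝓝 L)) :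
    Tendsto (fun ε : ℝ => specQ s ((u : ℂ) + Complex.I * ε)) (𝓝[>] 0)
      (𝓝 ((u - 1 : ℂ)⁻¹ * Complex.exp ((1 / 2 + Complex.I * lam s) * L))) := by
  have h0 : (u : ℂ) - 1 ≠ 0 := by
    rw [sub_ne_zero]; exact_mod_cast hu
  have h1 := (((tendsto_line_zero u).sub_const 1).inv₀ h0).mul
    ((hL.const_mul (1 / 2 + Complex.I * lam s)).cexp)
  refine h1.congr' ?_
  filter_upwards [self_mem_nhdsWithin] with ε hε
  rw [specQ_eq s (by rw [line_im]; exact (ne_of_gt hε))]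

theorem abs_cay_eq (u : ℝ) : |(u - 1) / (u + 1)| = |(1 - u) / (1 + u)| := by
  rw [abs_div, abs_div, abs_sub_comm, add_comm]

/-- Approaching the real axis from above, `z = (w - 1) / (w + 1)` tends through the upper
half plane to a negative number if `|u| < 1` and to a positive number if `|u| > 1`. In the first case the boundary value of
`ln z` has imaginary part `π`, and the resulting factor `e^{-πλ} = (s / (1 - s))^{1/2}` turns
`s^{-1/2}` into `(1 - s)^{-1/2}`. -/
theorem tendsto_nrm_mul_specQ {s : ℝ} (hs : s ∈ Ioo (0 : ℝ) 1) {u : ℝ} (h1 : u ≠ 1)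
    (h2 : u ≠ -1) :
    Tendsto (fun ε : ℝ => nrm s * specQ s ((u : ℂ) + Complex.I * ε)) (𝓝[>] 0)
      (𝓝 (bdry s u)) := by
  have hm : u - 1 ≠ 0 := sub_ne_zero.2 h1
  have hp : u + 1 ≠ 0 := fun h => h2 (by linarith)
  have hs0 := hs.1
  have hs1 : 0 < 1 - s := by linarith [hs.2]
  have hpi := Real.pi_ne_zero
  have hsψ : sψ u = Real.log |(u - 1) / (u + 1)| := by rw [abs_cay_eq]; rfl
  have hab : 0 < |(u - 1) / (u + 1)| := abs_pos.2 (div_ne_zero hm hp)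
  have hhalf : Complex.exp (1 / 2 * (sψ u : ℂ)) =
      ((Real.sqrt |u - 1| / Real.sqrt |u + 1| : ℝ) : ℂ) := by
    have : (1 / 2 * (sψ u : ℂ)) = ((sψ u / 2 : ℝ) : ℂ) := by push_cast; ring
    rw [this, ← Complex.ofReal_exp, Real.exp_half, hsψ, Real.exp_log hab, abs_div,
      Real.sqrt_div (abs_nonneg _)]
  set p := Real.sqrt |u - 1| with hpdef
  set q := Real.sqrt |u + 1| with hqdef
  have hp0 : 0 < p := Real.sqrt_pos.2 (abs_pos.2 hm)
  have hq0 : 0 < q := Real.sqrt_pos.2 (abs_pos.2 hp)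
  have hp2 : p ^ 2 = |u - 1| := Real.sq_sqrt (abs_nonneg _)
  have hpq : Real.sqrt |1 - u ^ 2| = p * q := by
    rw [hpdef, hqdef, ← Real.sqrt_mul (abs_nonneg _), ← abs_mul, ← abs_neg]
    congr 2
    ring
  set a := Real.sqrt s with ha
  set c := Real.sqrt (1 - s) with hc
  have ha0 : 0 < a := Real.sqrt_pos.2 hs0
  have hc0 : 0 < c := Real.sqrt_pos.2 hs1
  set r := Real.sqrt 2 with hr
  have hr0 : 0 < r := Real.sqrt_pos.2 two_pos
  have hr2 : r ^ 2 = 2 := Real.sq_sqrt two_pos.le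
  have hrs : Real.sqrt (2 * s) = r * a := Real.sqrt_mul two_pos.le s
  have hp' : (p : ℂ) ≠ 0 := by exact_mod_cast hp0.ne'
  have hq' : (q : ℂ) ≠ 0 := by exact_mod_cast hq0.ne'
  have ha' : (a : ℂ) ≠ 0 := by exact_mod_cast ha0.ne'
  have hc' : (c : ℂ) ≠ 0 := by exact_mod_cast hc0.ne'
  have hr' : (r : ℂ) ≠ 0 := by exact_mod_cast hr0.ne'
  have hpi' : (Real.pi : ℂ) ≠ 0 := by exact_mod_cast hpi
  have hr2' : (r : ℂ) ^ 2 = 2 := by exact_mod_cast hr2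
  rcases lt_or_ge |u| 1 with hu | hu
  · obtain ⟨hu1, hu2⟩ := abs_lt.1 hu
    have hneg : (u - 1) / (u + 1) < 0 := div_neg_of_neg_of_pos (by linarith) (by linarith)
    have hL : Tendsto (fun ε : ℝ => Complex.log (cay ((u : ℂ) + Complex.I * ε))) (𝓝[>] 0)
        (𝓝 (sψ u + Real.pi * Complex.I)) := by
      have h := Complex.tendsto_log_nhdsWithin_im_nonneg_of_re_neg_of_im_zero
        (z := (((u - 1) / (u + 1) : ℝ) : ℂ)) (by rwa [Complex.ofReal_re]) (Complex.ofReal_im _)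
      rw [Complex.norm_real, Real.norm_eq_abs, ← hsψ] at h
      refine h.comp (tendsto_nhdsWithin_iff.2 ⟨tendsto_cay_line h2, ?_⟩)
      filter_upwards [self_mem_nhdsWithin] with ε hε
      rw [cay_im, line_im]
      exact div_nonneg (mul_nonneg two_pos.le (le_of_lt hε)) (Complex.normSq_nonneg _)
    refine ((tendsto_specQ_of_tendsto_log (s := s) h1 hL).const_mul (nrm s)).trans (le_of_eq ?_)
    congr 1
    have hu1' : ((u : ℂ) - 1) = -(p : ℂ) ^ 2 := by
      have : u - 1 = -p ^ 2 := by rw [hp2, abs_of_neg (by linarith)]; ring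
      exact_mod_cast this
    have e1 : (1 / 2 + Complex.I * lam s) * (sψ u + Real.pi * Complex.I) =
        1 / 2 * (sψ u : ℂ) + Real.pi / 2 * Complex.I + ((-(Real.pi * lam s) : ℝ) : ℂ) +
          Complex.I * lam s * sψ u := by
      push_cast
      linear_combination (lam s * Real.pi : ℂ) * Complex.I_sq
    rw [e1, Complex.exp_add, Complex.exp_add, Complex.exp_add, hhalf, Complex.exp_pi_div_two_mul_I,
      ← Complex.ofReal_exp, exp_pi_lam hs, ← ha, ← hc, hu1']
    unfold bdry nrm sa₁ sa₂
    rw [if_pos hu, if_neg (not_lt.2 hu.le), mul_zero, sub_zero, hpq, hrs, ← hc, ← hr]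
    set e := Complex.exp (Complex.I * lam s * sψ u)
    push_cast
    field_simp
    linear_combination (-2 * e) * Complex.I_sq - e * hr2'
  · have hu' : 1 < |u| := by
      refine lt_of_le_of_ne hu fun h => ?_
      rcases eq_or_eq_neg_of_abs_eq h.symm with h3 | h3
      · exact h1 h3
      · exact h2 h3
    have hpos : 0 < (u - 1) / (u + 1) := by
      rcases lt_abs.1 hu' with h | h
      · exact div_pos (by linarith) (by linarith)
      · exact div_pos_of_neg_of_neg (by linarith) (by linarith)
    have hL : Tendsto (fun ε : ℝ => Complex.log (cay ((u : ℂ) + Complex.I * ε))) (𝓝[>] 0)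
        (𝓝 (sψ u)) := by
      have h := (continuousAt_clog (x := (((u - 1) / (u + 1) : ℝ) : ℂ))
        (Or.inl (by rwa [Complex.ofReal_re]))).tendsto.comp (tendsto_cay_line h2)
      rw [← Complex.ofReal_log hpos.le] at h
      rw [hsψ, abs_of_pos hpos]
      exact h
    refine ((tendsto_specQ_of_tendsto_log (s := s) h1 hL).const_mul (nrm s)).trans (le_of_eq ?_)
    congr 1
    -- `σ` is the sign of `u`, which is also the sign of `u - 1`.
    obtain ⟨σ, hσ, hσ2, hσu⟩ : ∃ σ : ℝ, u / |u| = σ ∧ σ ^ 2 = 1 ∧ u - 1 = σ * p ^ 2 := by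
      rcases lt_abs.1 hu' with h | h
      · exact ⟨1, by rw [abs_of_pos (by linarith), div_self (by linarith)], by norm_num,
          by rw [hp2, abs_of_pos (by linarith), one_mul]⟩
      · exact ⟨-1, by rw [abs_of_neg (by linarith), div_neg, div_self (by linarith)],
          by norm_num, by rw [hp2, abs_of_neg (by linarith)]; ring⟩
    have hσ0 : (σ : ℂ) ≠ 0 := by
      have : σ ≠ 0 := by rintro rfl; norm_num at hσ2
      exact_mod_cast this
    have hσ2' : (σ : ℂ) ^ 2 = 1 := by exact_mod_cast hσ2
    have hu1' : ((u : ℂ) - 1) = σ * (p : ℂ) ^ 2 := by exact_mod_cast hσu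
    have e1 : (1 / 2 + Complex.I * lam s) * (sψ u : ℂ) =
        1 / 2 * (sψ u : ℂ) + Complex.I * lam s * sψ u := by ring
    rw [e1, Complex.exp_add, hhalf, hu1']
    unfold bdry nrm sa₁ sa₂
    rw [if_pos hu', if_neg (not_lt.2 hu'.le), mul_zero, zero_sub, hpq, hrs, ← ha, ← hr, hσ]
    set e := Complex.exp (Complex.I * lam s * sψ u)
    push_cast
    rw [mul_inv Complex.I, Complex.inv_I]
    field_simp
    linear_combination (-e) * hr2'

/-- A majorant of `|u² - 1|^{-1/2}` with separated singularities. -/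
def singBd (u : ℝ) : ℝ := (Real.sqrt |u - 1|)⁻¹ + (Real.sqrt |u + 1|)⁻¹

theorem inv_sqrt_mul_le_singBd (u : ℝ) :
    (Real.sqrt |u - 1|)⁻¹ * (Real.sqrt |u + 1|)⁻¹ ≤ singBd u := by
  unfold singBd
  have i1 : 0 ≤ (Real.sqrt |u - 1|)⁻¹ := by positivity
  have i2 : 0 ≤ (Real.sqrt |u + 1|)⁻¹ := by positivity
  rcases le_total 0 u with hu | hu
  · have : (Real.sqrt |u + 1|)⁻¹ ≤ 1 :=
      inv_le_one_of_one_le₀ (Real.one_le_sqrt.2 (by rw [abs_of_nonneg] <;> linarith))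
    nlinarith
  · have : (Real.sqrt |u - 1|)⁻¹ ≤ 1 :=
      inv_le_one_of_one_le₀ (Real.one_le_sqrt.2 (by rw [abs_of_nonpos] <;> linarith))
    nlinarith

/-- A majorant independent of the height `ε`, for the limit `ε → 0`. -/
theorem norm_specQ_le_singBd (s : ℝ) {ε : ℝ} (hε : ε ≠ 0) {u : ℝ} (h1 : u ≠ 1) (h2 : u ≠ -1) :
    ‖specQ s ((u : ℂ) + Complex.I * ε)‖ ≤ Real.exp (Real.pi * |lam s|) * singBd u := by
  have hm : 0 < |u - 1| := abs_pos.2 (sub_ne_zero.2 h1)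
  have hp : 0 < |u + 1| := abs_pos.2 fun h => h2 (by linarith)
  refine (norm_specQ_le s (by rwa [line_im])).trans ?_
  gcongr
  have h3 : |u - 1| * |u + 1| ≤ ‖((u : ℂ) + Complex.I * ε) ^ 2 - 1‖ := by
    refine (sq_le_sq₀ (by positivity) (norm_nonneg _)).1 ?_
    rw [normSq_line_sq_sub_one, mul_pow, sq_abs, sq_abs]
    nlinarith [sq_nonneg ε, sq_nonneg (ε ^ 2), mul_nonneg (sq_nonneg ε) (sq_nonneg u)]
  have h4 : (Real.sqrt ‖((u : ℂ) + Complex.I * ε) ^ 2 - 1‖)⁻¹ ≤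
      (Real.sqrt (|u - 1| * |u + 1|))⁻¹ := by
    gcongr
  refine h4.trans ?_
  rw [Real.sqrt_mul hm.le, mul_inv]
  exact inv_sqrt_mul_le_singBd u

/-- The singularity `|u - a|^{-1/2}` is integrable near `a` and bounded by `1` outside
`]a - 1, a + 1[`. -/
theorem integrable_inv_sqrt_mul {G : ℝ → ℂ} (hG : Integrable G) {M : ℝ} (hM : ∀ u, ‖G u‖ ≤ M)
    (a : ℝ) : Integrable fun u => (Real.sqrt |u - a|)⁻¹ * ‖G u‖ := by
  have h0 : IntervalIntegrable (fun u : ℝ => |u| ^ (-(1 / 2) : ℝ)) volume (-1) 1 := by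
    have h := intervalIntegral.intervalIntegrable_rpow' (a := 0) (b := 1) (r := -(1 / 2))
      (by norm_num)
    have h1 : IntervalIntegrable (fun u : ℝ => |u| ^ (-(1 / 2) : ℝ)) volume 0 1 := by
      refine h.congr fun u hu => ?_
      rw [uIoc_of_le zero_le_one] at hu
      simp only [abs_of_pos hu.1]
    refine IntervalIntegrable.trans (b := 0) ?_ h1
    have := h1.comp_sub_left 0
    simpa using this.symm
  rw [intervalIntegrable_iff_integrableOn_Ioo_of_le (by norm_num)] at h0
  have h1 : Integrable ((Ioo (-1 : ℝ) 1).indicator fun u : ℝ => |u| ^ (-(1 / 2) : ℝ)) :=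
    h0.integrable_indicator measurableSet_Ioo
  have h2 := ((h1.comp_sub_right a).const_mul M).add hG.norm
  refine h2.mono' ?_ (Eventually.of_forall fun u => ?_)
  · exact (Measurable.aestronglyMeasurable (by fun_prop)).mul hG.norm.aestronglyMeasurable
  · have hM0 : 0 ≤ M := (norm_nonneg _).trans (hM u)
    rw [Real.norm_eq_abs, abs_of_nonneg (by positivity), Pi.add_apply]
    have e : (Real.sqrt |u - a|)⁻¹ = |u - a| ^ (-(1 / 2) : ℝ) := by
      rw [Real.rpow_neg (abs_nonneg _), Real.sqrt_eq_rpow]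
    by_cases hu : u - a ∈ Ioo (-1 : ℝ) 1
    · rw [indicator_of_mem hu, ← e, mul_comm M]
      have : (Real.sqrt |u - a|)⁻¹ * ‖G u‖ ≤ (Real.sqrt |u - a|)⁻¹ * M := by
        gcongr; exact hM u
      linarith [norm_nonneg (G u)]
    · rw [indicator_of_notMem hu, mul_zero, zero_add]
      have h3 : 1 ≤ |u - a| := by
        by_contra h
        exact hu (abs_lt.1 (not_le.1 h))
      exact mul_le_of_le_one_left (norm_nonneg _)
        (inv_le_one_of_one_le₀ (Real.one_le_sqrt.2 h3))

theorem integrable_singBd_mul {G : ℝ → ℂ} (hG : Integrable G) {M : ℝ} (hM : ∀ u, ‖G u‖ ≤ M) :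
    Integrable fun u => singBd u * ‖G u‖ := by
  unfold singBd
  simp_rw [add_mul]
  refine (integrable_inv_sqrt_mul hG hM 1).add ?_
  simpa using integrable_inv_sqrt_mul hG hM (-1)

/-! ### The Fourier transformation on `L¹ ∩ L²` -/

/-- The Fourier integral `(2π)^{-1/2} ∫ e^{-iuy} f(y) dy`. -/
def fourierInt (f : ℝ → ℂ) (u : ℝ) : ℂ :=
  (((Real.sqrt (2 * Real.pi))⁻¹ : ℝ) : ℂ) * ∫ y : ℝ, Complex.exp (-Complex.I * u * y) * f y

theorem fourierInt_eq (f : ℝ → ℂ) (u : ℝ) :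
    fourierInt f u = (((Real.sqrt (2 * Real.pi))⁻¹ : ℝ) : ℂ) *
      FourierTransform.fourier f ((2 * Real.pi)⁻¹ * u) := by
  unfold fourierInt
  rw [Real.fourier_real_eq_integral_exp_smul]
  congr 1
  refine integral_congr_ae (Eventually.of_forall fun y => ?_)
  simp only [smul_eq_mul]
  congr 2
  have : (Real.pi : ℂ) ≠ 0 := by exact_mod_cast Real.pi_ne_zero
  push_cast
  field_simp

theorem fourierInt_congr {f g : ℝ → ℂ} (h : f =ᵐ[volume] g) (u : ℝ) :
    fourierInt f u = fourierInt g u := by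
  unfold fourierInt
  congr 1
  exact integral_congr_ae (h.mono fun y hy => by simp only [hy])

theorem continuous_fourier_of_integrable {f : ℝ → ℂ} (hf : Integrable f) :
    Continuous (FourierTransform.fourier f : ℝ → ℂ) :=
  VectorFourier.fourierIntegral_continuous Real.continuous_fourierChar
    (by exact continuous_inner) hf

/-- On `L¹ ∩ L²` the Plancherel extension of the Fourier transformation agrees with the integral: both
give the same pairing with test functions. -/
theorem lp_fourier_ae_eq (f : L2 volume) (hf : Integrable f) :
    (Lp.fourierTransformₗᵢ ℝ ℂ f : L2 volume) =ᵐ[volume] FourierTransform.fourier (f : ℝ → ℂ) := by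
  refine ae_eq_of_integral_contDiff_smul_eq ((Lp.memLp _).locallyIntegrable (by norm_num))
    (continuous_fourier_of_integrable hf).locallyIntegrable fun g hg hgc => ?_
  have hgC : ContDiff ℝ (⊤ : ℕ∞) (fun x => (g x : ℂ)) := Complex.ofRealCLM.contDiff.comp hg
  have hgs : HasCompactSupport (fun x => (g x : ℂ)) := hgc.comp_left Complex.ofReal_zero
  set φ : SchwartzMap ℝ ℂ := hgs.toSchwartzMap hgC with hφ
  have hφe : ∀ x, φ x = (g x : ℂ) := fun x => rfl
  have h1 : FourierTransform.fourier (f : TemperedDistribution ℝ ℂ) φ =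
      ((Lp.fourierTransformₗᵢ ℝ ℂ f : L2 volume) : TemperedDistribution ℝ ℂ) φ :=
    congrArg (fun T : TemperedDistribution ℝ ℂ => T φ) (Lp.fourier_toTemperedDistribution_eq f)
  rw [TemperedDistribution.fourier_apply, Lp.toTemperedDistribution_apply,
    Lp.toTemperedDistribution_apply] at h1
  have h2 := VectorFourier.integral_fourierIntegral_smul_eq_flip (L := innerₗ ℝ)
    (μ := volume) (ν := volume) (f := φ) (g := f) Real.continuous_fourierChar
    (by exact continuous_inner) φ.integrable hf
  have h3 : ∫ x, φ x • (FourierTransform.fourier (f : ℝ → ℂ)) x =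
      ∫ x, (FourierTransform.fourier φ) x • f x := by
    rw [flip_innerₗ] at h2
    exact h2.symm
  simp only [hφe, smul_eq_mul] at h1 h3
  simp only [Complex.real_smul]
  rw [h3, ← h1]

/-- On `L¹ ∩ L²` the Fourier transformation is given by the integral. -/
theorem fourierL2_ae_eq (f : L2 volume) (hf : Integrable f) :
    fourierL2 f =ᵐ[volume] fourierInt f := by
  have hpos : (0 : ℝ) < (2 * Real.pi)⁻¹ := by positivity
  have h1 := coeFn_dilation (2 * Real.pi)⁻¹ hpos (Lp.fourierTransformₗᵢ ℝ ℂ f)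
  have h2 := (isWeight_dilation (2 * Real.pi)⁻¹ hpos).congr (lp_fourier_ae_eq f hf)
  refine (h1.trans h2).trans (Eventually.of_forall fun x => ?_)
  rw [fourierInt_eq, Real.sqrt_inv]

theorem fourierInt_schwartz (G : SchwartzMap ℝ ℂ) :
    fourierL2 (G.toLp 2) =ᵐ[volume] fourierInt G :=
  fourierL2_schwartz G

theorem continuous_fourierInt_schwartz (G : SchwartzMap ℝ ℂ) : Continuous (fourierInt G) := by
  have h := (FourierTransform.fourier G).continuous
  rw [SchwartzMap.fourier_coe] at h
  simp_rw [funext (fourierInt_eq G)]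
  fun_prop

theorem integrable_fourierInt_schwartz (G : SchwartzMap ℝ ℂ) : Integrable (fourierInt G) := by
  have h := (FourierTransform.fourier G).integrable (μ := volume)
  rw [SchwartzMap.fourier_coe] at h
  simp_rw [funext (fourierInt_eq G)]
  exact (h.comp_mul_left' (by positivity)).const_mul _

theorem exists_norm_fourierInt_le (G : SchwartzMap ℝ ℂ) : ∃ M, ∀ u, ‖fourierInt G u‖ ≤ M := by
  refine ⟨‖(((Real.sqrt (2 * Real.pi))⁻¹ : ℝ) : ℂ)‖ * ∫ y, ‖G y‖, fun u => ?_⟩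
  unfold fourierInt
  rw [norm_mul]
  gcongr
  refine (norm_integral_le_integral_norm _).trans (le_of_eq ?_)
  refine integral_congr_ae (Eventually.of_forall fun y => ?_)
  simp only [norm_mul, Complex.norm_exp]
  simp

/-! ### The Fourier transforms of the boundary values -/

theorem expLine_eq (β x u : ℝ) :
    expLine β x u = (Real.exp (x * β) : ℂ) * Complex.exp (-Complex.I * u * x) := by
  unfold expLine
  rw [Complex.ofReal_exp, ← Complex.exp_add]
  congr 1
  push_cast
  linear_combination (-(x * β) : ℂ) * Complex.I_sq

theorem norm_specQ_line_le_const (s : ℝ) {β : ℝ} (hβ : β ≠ 0) (u : ℝ) :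
    ‖specQ s (u + Complex.I * β)‖ ≤ Real.exp (Real.pi * |lam s|) *
      (Real.sqrt (β ^ 2 / (1 + β ^ 2) * (1 + β ^ 2)))⁻¹ := by
  refine (norm_specQ_line_le s hβ u).trans ?_
  refine mul_le_mul_of_nonneg_left (inv_anti₀ (by positivity) (Real.sqrt_le_sqrt
    (mul_le_mul_of_nonneg_left ?_ (by positivity)))) (by positivity)
  linarith [sq_nonneg u]

theorem integrable_specQ_line_mul (s : ℝ) {β : ℝ} (hβ : β ≠ 0) {G : ℝ → ℂ} (hG : Integrable G) :
    Integrable fun u : ℝ => specQ s (u + Complex.I * β) * G u := by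
  exact hG.bdd_mul (continuous_specQ_line s hβ).aestronglyMeasurable
    (Eventually.of_forall (norm_specQ_line_le_const s hβ))

/-- A bound uniform in `A`, for dominated convergence. Its singularity at `x = 0` is the reason for
using test functions supported away from the origin. -/
theorem exists_norm_specTrunc_le (s : ℝ) {β : ℝ} (hβ : 0 < β) :
    ∃ K, 0 ≤ K ∧ ∀ x ≠ 0, ∀ A, ‖specTrunc β s x A‖ ≤ Real.exp (x * β) * K * |x|⁻¹ := by
  set B := Real.exp (Real.pi * |lam s|) * (Real.sqrt (β ^ 2 / (1 + β ^ 2) * (1 + β ^ 2)))⁻¹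
    with hB
  have hQ : ∀ u : ℝ, ‖specQ s (u + Complex.I * β)‖ ≤ B :=
    norm_specQ_line_le_const s hβ.ne'
  have hB0 : 0 ≤ B := (norm_nonneg _).trans (hQ 0)
  set J := ∫ u : ℝ, ‖specDQ s (u + Complex.I * β)‖ with hJ
  have hJ0 : 0 ≤ J := integral_nonneg fun _ => norm_nonneg _
  refine ⟨B + B + J, by positivity, fun x hx A => ?_⟩
  have hc : ‖(((Real.sqrt (2 * Real.pi))⁻¹ : ℝ) : ℂ)‖ ≤ 1 := by
    rw [Complex.norm_real, Real.norm_eq_abs, abs_of_nonneg (by positivity)]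
    refine inv_le_one_of_one_le₀ (Real.one_le_sqrt.2 ?_)
    linarith [Real.pi_gt_three]
  have hint := integrable_specDQ_line s hβ x
  have hI : ‖∫ u in (-A)..A, expLine β x u * specDQ s (u + Complex.I * β)‖ ≤
      Real.exp (x * β) * J := by
    refine (intervalIntegral.norm_integral_le_integral_norm_uIoc).trans ?_
    refine (setIntegral_le_integral hint.norm (Eventually.of_forall fun _ => norm_nonneg _)).trans
      (le_of_eq ?_)
    rw [hJ, ← integral_const_mul]
    refine integral_congr_ae (Eventually.of_forall fun u => ?_)
    simp only [norm_mul, norm_expLine]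
  rw [specTrunc_eq s hβ.ne' hx, norm_mul, norm_mul, norm_div, Complex.norm_I, Complex.norm_real x,
    Real.norm_eq_abs x]
  calc _ ≤ 1 * (1 / |x| *
          (Real.exp (x * β) * B + Real.exp (x * β) * B + Real.exp (x * β) * J)) := by
        gcongr
        refine (norm_sub_le _ _).trans (add_le_add ((norm_sub_le _ _).trans (add_le_add ?_ ?_)) hI)
        · rw [norm_mul, norm_expLine]; gcongr; exact hQ A
        · rw [norm_mul, norm_expLine]; gcongr; exact hQ (-A)
    _ = _ := by rw [one_div]; ring

theorem integrable_inv_mul {G : ℝ → ℂ} (hG : Continuous G) (hGc : HasCompactSupport G)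
    (hG0 : (0 : ℝ) ∉ tsupport G) : Integrable fun x => |x|⁻¹ * ‖G x‖ := by
  have hsub : tsupport (fun x => |x|⁻¹ * ‖G x‖) ⊆ tsupport G := by
    refine closure_mono fun x hx => ?_
    rw [Function.mem_support] at hx ⊢
    intro h
    apply hx
    simp [h]
  have hcont : Continuous fun x => |x|⁻¹ * ‖G x‖ := by
    refine continuous_of_tsupport fun x hx => ?_
    have hx0 : x ≠ 0 := fun h => hG0 (h ▸ hsub hx)
    exact (continuous_abs.continuousAt.inv₀ (abs_ne_zero.2 hx0)).mul hG.norm.continuousAt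
  exact hcont.integrable_of_hasCompactSupport (hGc.of_isClosed_subset (isClosed_tsupport _) hsub)

/-- Parseval's identity for `Q_s` on a line in the upper half plane and a test function which
vanishes near the origin. -/
theorem integral_specQ_line_mul_fourierInt (s : ℝ) {β : ℝ} (hβ : 0 < β) (G : SchwartzMap ℝ ℂ)
    (hGc : HasCompactSupport G) (hG0 : (0 : ℝ) ∉ tsupport G) :
    ∫ u : ℝ, specQ s (u + Complex.I * β) * fourierInt G u =
      ∫ x : ℝ, (Real.exp (-(x * β)) : ℂ) * specFun β s x * G x := by
  have hGi := G.integrable (μ := volume)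
  have h1 := intervalIntegral_tendsto_integral
    (integrable_specQ_line_mul s hβ.ne' (integrable_fourierInt_schwartz G))
    tendsto_neg_atTop_atBot tendsto_id
  -- Fubini's theorem over `[-A, A] × ℝ`, since `Q_s` is not integrable over the whole line.
  have hswap : ∀ A : ℝ, ∫ u in (-A)..A, specQ s (u + Complex.I * β) * fourierInt G u =
      ∫ x : ℝ, (Real.exp (-(x * β)) : ℂ) * specTrunc β s x A * G x := by
    intro A
    have hprod : Integrable (Function.uncurry fun (u x : ℝ) => specQ s (u + Complex.I * β) *
        (Complex.exp (-Complex.I * u * x) * G x)) ((volume.restrict (uIoc (-A) A)).prod volume) := by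
      have hb : IntegrableOn (fun u : ℝ => specQ s (u + Complex.I * β)) (uIoc (-A) A) :=
        ((continuous_specQ_line s hβ.ne').intervalIntegrable (-A) A).def'
      have h := (hb.mul_prod hGi).bdd_mul (c := 1)
        (f := fun p : ℝ × ℝ => Complex.exp (-Complex.I * p.1 * p.2))
        (Continuous.aestronglyMeasurable (by fun_prop)) (Eventually.of_forall fun p => by
          rw [Complex.norm_exp]; simp)
      refine h.congr (Eventually.of_forall fun p => ?_)
      simp only [Function.uncurry]
      ring
    have h := intervalIntegral_integral_swap hprod
    have h0 : ∀ u : ℝ, specQ s (u + Complex.I * β) * fourierInt G u =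
        (((Real.sqrt (2 * Real.pi))⁻¹ : ℝ) : ℂ) *
          ∫ x : ℝ, specQ s (u + Complex.I * β) * (Complex.exp (-Complex.I * u * x) * G x) := by
      intro u
      unfold fourierInt
      rw [integral_const_mul]
      ring
    simp_rw [h0]
    rw [intervalIntegral.integral_const_mul, h, ← integral_const_mul]
    refine integral_congr_ae (Eventually.of_forall fun x => ?_)
    unfold specTrunc
    simp only
    have e : ∫ u in (-A)..A, specQ s (u + Complex.I * β) *
          (Complex.exp (-Complex.I * u * x) * G x) =
        (Real.exp (-(x * β)) : ℂ) * (∫ u in (-A)..A, Complex.exp (-Complex.I * x *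
          (u + Complex.I * β)) * specQ s (u + Complex.I * β)) * G x := by
      rw [← intervalIntegral.integral_const_mul, ← intervalIntegral.integral_mul_const]
      refine intervalIntegral.integral_congr fun u _ => ?_
      have := expLine_eq β x u
      unfold expLine at this
      simp only [this]
      have e2 : (Real.exp (-(x * β)) : ℂ) * (Real.exp (x * β) : ℂ) = 1 := by
        rw [← Complex.ofReal_mul, ← Real.exp_add]; simp
      linear_combination (-(Complex.exp (-Complex.I * u * x) * specQ s (u + Complex.I * β) * G x)) *
        e2
    rw [e]
    ring
  have h2 : Tendsto (fun A : ℝ => ∫ x : ℝ, (Real.exp (-(x * β)) : ℂ) * specTrunc β s x A * G x)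
      atTop (𝓝 (∫ x : ℝ, (Real.exp (-(x * β)) : ℂ) * specFun β s x * G x)) := by
    obtain ⟨K, hK0, hK⟩ := exists_norm_specTrunc_le s hβ
    have hmeas : ∀ A : ℝ, Measurable fun x => specTrunc β s x A := by
      intro A
      have hm : Measurable fun p : ℝ × ℝ => Complex.exp (-Complex.I * p.1 *
          (p.2 + Complex.I * β)) * specQ s (p.2 + Complex.I * β) :=
        (by fun_prop : Measurable fun p : ℝ × ℝ =>
          Complex.exp (-Complex.I * p.1 * (p.2 + Complex.I * β))).mul
          ((continuous_specQ_line s hβ.ne').measurable.comp measurable_snd)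
      unfold specTrunc
      simp_rw [intervalIntegral.intervalIntegral_eq_integral_uIoc]
      have := (hm.stronglyMeasurable.integral_prod_right'
        (ν := volume.restrict (uIoc (-A) A))).measurable
      fun_prop
    refine tendsto_integral_filter_of_dominated_convergence (fun x => K * (|x|⁻¹ * ‖G x‖))
      (Eventually.of_forall fun A => ?_) (Eventually.of_forall fun A => ?_)
      ((integrable_inv_mul G.continuous hGc hG0).const_mul K) ?_
    · exact ((Measurable.mul (by fun_prop) (hmeas A)).mul
        G.continuous.measurable).aestronglyMeasurable
    · refine Eventually.of_forall fun x => ?_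
      by_cases hx : x = 0
      · have : G x = 0 := by rw [hx]; exact image_eq_zero_of_notMem_tsupport hG0
        simp [this]
      · rw [norm_mul, norm_mul, Complex.norm_real, Real.norm_eq_abs, abs_of_pos (Real.exp_pos _),
          ← mul_assoc]
        refine mul_le_mul_of_nonneg_right ?_ (norm_nonneg _)
        calc Real.exp (-(x * β)) * ‖specTrunc β s x A‖
            ≤ Real.exp (-(x * β)) * (Real.exp (x * β) * K * |x|⁻¹) := by gcongr; exact hK x hx A
          _ = (Real.exp (-(x * β)) * Real.exp (x * β)) * (K * |x|⁻¹) := by ring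
          _ = K * |x|⁻¹ := by rw [← Real.exp_add]; simp
    · have hae : ∀ᵐ x : ℝ, x ≠ 0 := by simp [ae_iff]
      filter_upwards [hae] with x hx
      exact ((tendsto_specTrunc s hβ hx).const_mul _).mul_const _
  exact tendsto_nhds_unique h1 (h2.congr fun A => (hswap A).symm)

/-- The Fourier transform of the boundary value of `n(s) Q_s` from above is `q_+(s, ·)` on
`]0, ∞[` and `0` on `]-∞, 0[`, in the sense of distributions on `ℝ \ {0}`. -/
theorem integral_bdry_mul_fourierInt {s : ℝ} (hs : s ∈ Ioo (0 : ℝ) 1) {b : ℝ} (hb : 0 < b)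
    (G : SchwartzMap ℝ ℂ) (hGc : HasCompactSupport G) (hG0 : (0 : ℝ) ∉ tsupport G) :
    ∫ u : ℝ, bdry s u * fourierInt G u = ∫ x in Ioi 0, qPlus b s x * G x := by
  have hGi := integrable_fourierInt_schwartz G
  obtain ⟨M, hM⟩ := exists_norm_fourierInt_le G
  have hne : ∀ᵐ u : ℝ, u ∉ ({1, -1} : Set ℝ) :=
    measure_eq_zero_iff_ae_notMem.1 ((toFinite _).measure_zero _)
  -- The limit `ε → 0` on the side of the boundary values.
  have h1 : Tendsto (fun ε : ℝ => ∫ u : ℝ, nrm s * specQ s (u + Complex.I * ε) * fourierInt G u)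
      (𝓝[>] 0) (𝓝 (∫ u : ℝ, bdry s u * fourierInt G u)) := by
    refine tendsto_integral_filter_of_dominated_convergence
      (fun u => ‖nrm s‖ * Real.exp (Real.pi * |lam s|) * (singBd u * ‖fourierInt G u‖)) ?_ ?_
      ((integrable_singBd_mul hGi hM).const_mul _) ?_
    · filter_upwards [self_mem_nhdsWithin] with ε hε
      exact ((continuous_const.mul (continuous_specQ_line s (ne_of_gt hε))).mul
        (continuous_fourierInt_schwartz G)).aestronglyMeasurable
    · filter_upwards [self_mem_nhdsWithin] with ε hε
      filter_upwards [hne] with u hu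
      simp only [mem_insert_iff, mem_singleton_iff, not_or] at hu
      have h := norm_specQ_le_singBd s (ne_of_gt hε) hu.1 hu.2
      calc _ = ‖nrm s‖ * ‖specQ s (u + Complex.I * ε)‖ * ‖fourierInt G u‖ := by
            rw [norm_mul, norm_mul]
        _ ≤ ‖nrm s‖ * (Real.exp (Real.pi * |lam s|) * singBd u) * ‖fourierInt G u‖ := by gcongr
        _ = _ := by ring
    · filter_upwards [hne] with u hu
      simp only [mem_insert_iff, mem_singleton_iff, not_or] at hu
      exact (tendsto_nrm_mul_specQ hs hu.1 hu.2).mul_const _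
  have hq : ∀ x : ℝ, 0 < x → ∀ ε : ℝ, 0 < ε → specFun ε s x = specFun b s x := by
    intro x hx ε hε
    rcases le_total ε b with h | h
    · exact specFun_eq_specFun s hε h hx.ne'
    · exact (specFun_eq_specFun s hb h hx.ne').symm
  have h2 : ∀ᶠ ε : ℝ in 𝓝[>] 0,
      ∫ u : ℝ, nrm s * specQ s (u + Complex.I * ε) * fourierInt G u =
        ∫ x in Ioi 0, (Real.exp (-(x * ε)) : ℂ) * (qPlus b s x * G x) := by
    filter_upwards [self_mem_nhdsWithin] with ε hε
    simp_rw [mul_assoc]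
    rw [integral_const_mul, integral_specQ_line_mul_fourierInt s hε G hGc hG0,
      ← integral_const_mul, ← integral_indicator measurableSet_Ioi]
    have hae : ∀ᵐ x : ℝ, x ≠ 0 := by simp [ae_iff]
    refine integral_congr_ae (hae.mono fun x hx => ?_)
    simp only
    rcases lt_or_gt_of_ne hx with h | h
    · rw [indicator_of_notMem (by simpa using h.le), specFun_of_neg s hε h]
      simp
    · rw [indicator_of_mem (mem_Ioi.2 h), hq x h ε hε]
      unfold qPlus
      ring
  -- The limit `ε → 0` on the side of the kernel.
  have h3 : Tendsto (fun ε : ℝ => ∫ x in Ioi 0, (Real.exp (-(x * ε)) : ℂ) * (qPlus b s x * G x))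
      (𝓝[>] 0) (𝓝 (∫ x in Ioi 0, qPlus b s x * G x)) := by
    have hbint : Integrable fun x : ℝ =>
        ‖nrm s‖ * (4 * Real.pi * bdConst s * Real.exp (x + 1)) * ‖G x‖ := by
      refine Continuous.integrable_of_hasCompactSupport ?_ ?_
      · have := G.continuous
        fun_prop
      · exact hGc.norm.mul_left
    have hae : ∀ᵐ x : ℝ ∂(volume.restrict (Ioi 0)), x ∈ Ioi (0 : ℝ) :=
      ae_restrict_mem measurableSet_Ioi
    refine tendsto_integral_filter_of_dominated_convergence _ ?_ ?_ hbint.integrableOn ?_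
    · refine Eventually.of_forall fun ε => ?_
      have hk : Measurable fun x => kPlus b s x := (measurable_kPlus b).of_uncurry_left
      have : Measurable fun x => (Real.exp (-(x * ε)) : ℂ) * (kPlus b s x * G x) :=
        Measurable.mul (by fun_prop) (hk.mul G.continuous.measurable)
      refine this.aestronglyMeasurable.congr (hae.mono fun x hx => ?_)
      simp only [qPlus_eq_kPlus s hb (ne_of_gt hx)]
    · filter_upwards [self_mem_nhdsWithin] with ε hε
      filter_upwards [hae] with x hx
      rw [norm_mul, norm_mul, Complex.norm_real, Real.norm_eq_abs, abs_of_pos (Real.exp_pos _)]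
      have h4 : Real.exp (-(x * ε)) ≤ 1 :=
        Real.exp_le_one_iff.2 (neg_nonpos.2 (mul_pos hx hε).le)
      refine (mul_le_of_le_one_left (by positivity) h4).trans ?_
      gcongr
      unfold qPlus
      rw [norm_mul]
      gcongr
      exact norm_specFun_le s hb hx
    · refine Eventually.of_forall fun x => ?_
      have h5 : Continuous fun ε : ℝ => (Real.exp (-(x * ε)) : ℂ) * (qPlus b s x * G x) := by
        fun_prop
      have h6 := h5.tendsto 0
      simp only [mul_zero, neg_zero, Real.exp_zero, Complex.ofReal_one, one_mul] at h6
      exact h6.mono_left nhdsWithin_le_nhds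
  exact tendsto_nhds_unique h1 (h3.congr' (h2.mono fun ε h => h.symm))

/-! ### The operators `R_±` -/

theorem lam_sig (x : ℝ) : lam (sig x) = -x := by
  unfold lam sig
  rw [one_div, inv_inv, add_sub_cancel_left, Real.log_exp]
  have := Real.pi_ne_zero
  field_simp

/-- The weight `(2π (1 - s))^{-1/2}`. -/
def rv₁ (s : ℝ) : ℂ := (((Real.sqrt (2 * Real.pi * (1 - s)))⁻¹ : ℝ) : ℂ)

/-- The weight `(2π s)^{-1/2}`. -/
def rv₂ (s : ℝ) : ℂ := (((Real.sqrt (2 * Real.pi * s))⁻¹ : ℝ) : ℂ)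

/-- The weighted composition operators with `s ↦ -λ(s)`, the inverse of `sig`, are contractions as soon
as the Jacobian weight `m` is at most `1`. -/
theorem isWeight_lam {v : ℝ → ℂ} {c m : ℝ → ℝ} (hv : Measurable v)
    (hvc : ∀ s ∈ Ioo (0 : ℝ) 1, ‖v s‖ ^ 2 = c s) (hm : ∀ s ∈ Ioo (0 : ℝ) 1, 0 ≤ m s ∧ m s ≤ 1)
    (hmc : ∀ s ∈ Ioo (0 : ℝ) 1, m s = 2 * Real.pi * (s * (1 - s)) * c s) :
    IsWeight volume (volume.restrict (Ioo 0 1)) v (fun s => -lam s) where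
  meas_w := hv
  meas_φ := by unfold lam; fun_prop
  le g _ := by
    have h := lintegral_sig (w := fun x => ((Real.sqrt (m (sig x)) : ℝ) : ℂ)) (c := c)
      (fun x => by
        rw [Complex.norm_real, Real.norm_eq_abs, sq_abs, Real.sq_sqrt (hm _ (sig_mem x)).1,
          hmc _ (sig_mem x)]) (fun s => g (-lam s))
    have h1 : ∫⁻ s in Ioo (0 : ℝ) 1, ‖v s‖ₑ ^ 2 * g (-lam s) =
        ∫⁻ s in Ioo (0 : ℝ) 1, ENNReal.ofReal (c s) * g (-lam s) := by
      refine setLIntegral_congr_fun measurableSet_Ioo fun s hs => ?_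
      rw [← hvc s hs, ← ofReal_norm, ENNReal.ofReal_pow (norm_nonneg _)]
    rw [h1, ← h]
    refine lintegral_mono fun x => ?_
    rw [lam_sig, neg_neg]
    refine mul_le_of_le_one_left' ?_
    rw [← ofReal_norm, ← ENNReal.ofReal_pow (norm_nonneg _), Complex.norm_real, Real.norm_eq_abs,
      sq_abs, Real.sq_sqrt (hm _ (sig_mem x)).1]
    simpa using (hm _ (sig_mem x)).2

theorem isWeight_rv₁ : IsWeight volume (volume.restrict (Ioo 0 1)) rv₁ (fun s => -lam s) :=
  isWeight_lam (c := fun s => (2 * Real.pi * (1 - s))⁻¹) (m := fun s => s)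
    (by unfold rv₁; fun_prop)
    (fun s hs => by
      have : 0 < 1 - s := by linarith [hs.2]
      unfold rv₁
      rw [Complex.norm_real, Real.norm_eq_abs, sq_abs, inv_pow, Real.sq_sqrt (by positivity)])
    (fun s hs => ⟨hs.1.le, hs.2.le⟩)
    (fun s hs => by
      have : 0 < 1 - s := by linarith [hs.2]
      field_simp)

theorem isWeight_rv₂ : IsWeight volume (volume.restrict (Ioo 0 1)) rv₂ (fun s => -lam s) :=
  isWeight_lam (c := fun s => (2 * Real.pi * s)⁻¹) (m := fun s => 1 - s)
    (by unfold rv₂; fun_prop)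
    (fun s hs => by
      have := hs.1
      unfold rv₂
      rw [Complex.norm_real, Real.norm_eq_abs, sq_abs, inv_pow, Real.sq_sqrt (by positivity)])
    (fun s hs => ⟨by linarith [hs.2], by linarith [hs.1]⟩)
    (fun s hs => by
      have := hs.1
      field_simp)

/-- The adjoint of `R₊`, as a weighted composition operator. -/
def RplusAdj (p : WithLp 2 (L2 volume × L2 volume)) : L2 (volume.restrict (Ioo 0 1)) :=
  weightedComp isWeight_rv₁ p.fst + weightedComp isWeight_rv₂ p.snd

/-- The adjoint of `R₋`, as a weighted composition operator. -/
def RminusAdj (p : WithLp 2 (L2 volume × L2 volume)) : L2 (volume.restrict (Ioo 0 1)) :=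
  weightedComp isWeight_rv₂ p.fst - weightedComp isWeight_rv₁ p.snd

theorem isWeight_rp : IsWeight (volume.restrict (Ioo 0 1)) volume rp sig :=
  isWeight_sig (c := fun s => s) measurable_rp norm_rp_sq fun _ hs => hs.2.le

theorem isWeight_rm : IsWeight (volume.restrict (Ioo 0 1)) volume rm sig :=
  isWeight_sig (c := fun s => 1 - s) measurable_rm norm_rm_sq fun s hs => by linarith [hs.1]

theorem Rplus_fst (h : L2 (volume.restrict (Ioo 0 1))) :
    (Rplus h).fst =ᵐ[volume] fun x => rp x * h (sig x) := coeFn_weightedComp isWeight_rp h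

theorem Rplus_snd (h : L2 (volume.restrict (Ioo 0 1))) :
    (Rplus h).snd =ᵐ[volume] fun x => rm x * h (sig x) := coeFn_weightedComp isWeight_rm h

theorem Rminus_fst (h : L2 (volume.restrict (Ioo 0 1))) :
    (Rminus h).fst =ᵐ[volume] fun x => rm x * h (sig x) := coeFn_weightedComp isWeight_rm h

theorem Rminus_snd (h : L2 (volume.restrict (Ioo 0 1))) :
    (Rminus h).snd =ᵐ[volume] fun x => -rp x * h (sig x) :=
  coeFn_weightedComp (isWeight_sig (w := fun x => -rp x) (c := fun s => s) measurable_rp.neg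
      (fun x => by rw [norm_neg]; exact norm_rp_sq x) fun _ hs => hs.2.le) h

theorem RplusAdj_ae (p : WithLp 2 (L2 volume × L2 volume)) :
    RplusAdj p =ᵐ[volume.restrict (Ioo 0 1)] fun s =>
      rv₁ s * p.fst (-lam s) + rv₂ s * p.snd (-lam s) := by
  filter_upwards [Lp.coeFn_add (weightedComp isWeight_rv₁ p.fst) (weightedComp isWeight_rv₂ p.snd),
    coeFn_weightedComp isWeight_rv₁ p.fst, coeFn_weightedComp isWeight_rv₂ p.snd] with s h1 h2 h3
  rw [RplusAdj, h1, Pi.add_apply, h2, h3]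

theorem RminusAdj_ae (p : WithLp 2 (L2 volume × L2 volume)) :
    RminusAdj p =ᵐ[volume.restrict (Ioo 0 1)] fun s =>
      rv₂ s * p.fst (-lam s) - rv₁ s * p.snd (-lam s) := by
  filter_upwards [Lp.coeFn_sub (weightedComp isWeight_rv₂ p.fst) (weightedComp isWeight_rv₁ p.snd),
    coeFn_weightedComp isWeight_rv₂ p.fst, coeFn_weightedComp isWeight_rv₁ p.snd] with s h1 h2 h3
  rw [RminusAdj, h1, Pi.sub_apply, h2, h3]

theorem ne_zero_of_sig_weight {w : ℝ → ℂ} (hw : w = rp ∨ w = rm) (x : ℝ) : w x ≠ 0 := by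
  have h := sig_mem x
  have h1 : 0 < 1 - sig x := by linarith [h.2]
  have h2 : 0 < ‖w x‖ ^ 2 := by
    rcases hw with rfl | rfl
    · rw [norm_rp_sq]; have := h.1; positivity
    · rw [norm_rm_sq]; have := h.1; positivity
  intro h0
  simp [h0] at h2

/-- The products of weights occurring in `R₊ R₊^* + R₋ R₋^*`. -/
theorem r_weights (x : ℝ) :
    rp x * rv₁ (sig x) = sig x ∧ rm x * rv₂ (sig x) = 1 - sig x ∧
      rp x * rv₂ (sig x) = rm x * rv₁ (sig x) := by
  have h := sig_mem x
  have h0 := h.1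
  have h1 : 0 < 1 - sig x := by linarith [h.2]
  have e2 : Real.sqrt (1 - (1 - sig x)) = Real.sqrt (sig x) := by rw [sub_sub_cancel]
  unfold rp rm rv₁ rv₂ lMinus lPlus
  have hpi : (0 : ℝ) ≤ 2 * Real.pi := by positivity
  rw [e2, Real.sqrt_mul hpi (1 - sig x), Real.sqrt_mul hpi (sig x)]
  have s1 := Real.sqrt_pos.2 h0
  have s2 := Real.sqrt_pos.2 h1
  have s3 : 0 < Real.sqrt (2 * Real.pi) := Real.sqrt_pos.2 (by positivity)
  have q1 := Real.sq_sqrt h0.le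
  have q2 := Real.sq_sqrt h1.le
  set a := Real.sqrt (sig x)
  set c := Real.sqrt (1 - sig x)
  set d := Real.sqrt (2 * Real.pi)
  refine ⟨?_, ?_, ?_⟩
  · rw [← Complex.ofReal_mul]
    congr 1
    field_simp
  · rw [← Complex.ofReal_mul, ← Complex.ofReal_one, ← Complex.ofReal_sub]
    congr 1
    field_simp
  · rw [← Complex.ofReal_mul, ← Complex.ofReal_mul]
    congr 1
    rw [← q2, ← q1]
    field_simp

/-- The ranges of `R₊` and `R₋` span `L²(ℝ, ℂ²)`. -/
theorem Rplus_add_Rminus (p : WithLp 2 (L2 volume × L2 volume)) :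
    Rplus (RplusAdj p) + Rminus (RminusAdj p) = p := by
  have a1 := RplusAdj_ae p
  have a2 := RminusAdj_ae p
  refine WithLp.ofLp_injective 2 (Prod.ext (Lp.ext ?_) (Lp.ext ?_))
  · change ((Rplus (RplusAdj p)).fst + (Rminus (RminusAdj p)).fst : L2 volume) =ᵐ[volume] p.fst
    filter_upwards [Lp.coeFn_add (Rplus (RplusAdj p)).fst (Rminus (RminusAdj p)).fst,
      Rplus_fst (RplusAdj p), Rminus_fst (RminusAdj p), isWeight_rp.ae a1, isWeight_rm.ae a2] with
      x h1 h2 h3 h4 h5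
    obtain ⟨e1, e2, e3⟩ := r_weights x
    rw [h1, Pi.add_apply, h2, h3, h4 (ne_zero_of_sig_weight (Or.inl rfl) x),
      h5 (ne_zero_of_sig_weight (Or.inr rfl) x), lam_sig, neg_neg]
    linear_combination (p.fst x) * e1 + (p.fst x) * e2 + (p.snd x) * e3
  · change ((Rplus (RplusAdj p)).snd + (Rminus (RminusAdj p)).snd : L2 volume) =ᵐ[volume] p.snd
    filter_upwards [Lp.coeFn_add (Rplus (RplusAdj p)).snd (Rminus (RminusAdj p)).snd,
      Rplus_snd (RplusAdj p), Rminus_snd (RminusAdj p), isWeight_rm.ae a1, isWeight_rp.ae a2] with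
      x h1 h2 h3 h4 h5
    obtain ⟨e1, e2, e3⟩ := r_weights x
    rw [h1, Pi.add_apply, h2, h3, h4 (ne_zero_of_sig_weight (Or.inr rfl) x),
      h5 (ne_zero_of_sig_weight (Or.inl rfl) x), lam_sig, neg_neg]
    linear_combination (p.snd x) * e1 + (p.snd x) * e2 - (p.fst x) * e3

theorem inner_Rminus_Rplus (h' h : L2 (volume.restrict (Ioo 0 1))) :
    inner ℂ (Rminus h') (Rplus h) = 0 := by
  rw [WithLp.prod_inner_apply, L2.inner_def, L2.inner_def, add_eq_zero_iff_eq_neg, ← integral_neg]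
  refine integral_congr_ae ?_
  have e1 : ∀ x, starRingEnd ℂ (rp x) = rp x := fun x => by unfold rp; exact Complex.conj_ofReal _
  have e2 : ∀ x, starRingEnd ℂ (rm x) = rm x := fun x => by unfold rm; exact Complex.conj_ofReal _
  filter_upwards [Rplus_fst h, Rplus_snd h, Rminus_fst h', Rminus_snd h'] with x h1 h2 h3 h4
  change inner ℂ ((Rminus h').fst x) ((Rplus h).fst x) =
    -inner ℂ ((Rminus h').snd x) ((Rplus h).snd x)
  rw [h1, h2, h3, h4]
  simp only [RCLike.inner_apply, map_mul, map_neg, e1, e2]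
  ring

/-- `RplusAdj` is the adjoint of `R₊`, since the ranges of `R₊` and `R₋` are orthogonal and span the
whole space. -/
theorem inner_Rplus (p : WithLp 2 (L2 volume × L2 volume)) (h : L2 (volume.restrict (Ioo 0 1))) :
    inner ℂ p (Rplus h) = inner ℂ (RplusAdj p) h := by
  conv_lhs => rw [← Rplus_add_Rminus p]
  rw [inner_add_left, inner_Rminus_Rplus, add_zero, LinearIsometry.inner_map_map]

theorem inner_Rminus (p : WithLp 2 (L2 volume × L2 volume)) (h : L2 (volume.restrict (Ioo 0 1))) :
    inner ℂ p (Rminus h) = inner ℂ (RminusAdj p) h := by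
  conv_lhs => rw [← Rplus_add_Rminus p]
  have h0 : inner ℂ (Rplus (RplusAdj p)) (Rminus h) = 0 := by
    rw [← inner_conj_symm, inner_Rminus_Rplus, map_zero]
  rw [inner_add_left, h0, zero_add, LinearIsometry.inner_map_map]

/-! ### The operator `S` on Fourier transforms of test functions -/

theorem norm_sa_le (u : ℝ) :
    Real.sqrt 2 * (Real.sqrt |1 - u ^ 2|)⁻¹ ≤ Real.sqrt 2 * singBd u := by
  gcongr
  have : |1 - u ^ 2| = |u - 1| * |u + 1| := by
    rw [← abs_mul, ← abs_neg]; congr 1; ring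
  rw [this, Real.sqrt_mul (abs_nonneg _), mul_inv]
  exact inv_sqrt_mul_le_singBd u

theorem singBd_nonneg (u : ℝ) : 0 ≤ singBd u := by unfold singBd; positivity

theorem norm_sa₁_le (u : ℝ) : ‖sa₁ u‖ ≤ Real.sqrt 2 * singBd u := by
  unfold sa₁
  split_ifs
  · rw [Complex.norm_real, Real.norm_eq_abs, abs_of_nonneg (by positivity)]
    exact norm_sa_le u
  · have := singBd_nonneg u
    rw [norm_zero]; positivity

theorem norm_sa₂_le (u : ℝ) : ‖sa₂ u‖ ≤ Real.sqrt 2 * singBd u := by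
  unfold sa₂
  split_ifs with h
  · have hu : |u| ≠ 0 := by intro h0; rw [h0] at h; linarith
    rw [norm_mul, Complex.norm_real, Real.norm_eq_abs, abs_of_nonneg (by positivity), norm_inv,
      norm_mul, Complex.norm_I, Complex.norm_real, Real.norm_eq_abs, abs_div, abs_abs,
      div_self hu]
    simpa using norm_sa_le u
  · have := singBd_nonneg u
    rw [norm_zero]; positivity

theorem measurable_sa₁ : Measurable sa₁ := isWeight_sa₁.meas_w

theorem measurable_sa₂ : Measurable sa₂ := isWeight_sa₂.meas_w

theorem integrable_sa_mul {a : ℝ → ℂ} (ha : Measurable a)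
    (hb : ∀ u, ‖a u‖ ≤ Real.sqrt 2 * singBd u) (G : SchwartzMap ℝ ℂ) :
    Integrable fun u => a u * fourierInt G u := by
  obtain ⟨M, hM⟩ := exists_norm_fourierInt_le G
  refine ((integrable_singBd_mul (integrable_fourierInt_schwartz G) hM).const_mul
    (Real.sqrt 2)).mono' (ha.aestronglyMeasurable.mul
      (continuous_fourierInt_schwartz G).aestronglyMeasurable) (Eventually.of_forall fun u => ?_)
  rw [norm_mul, ← mul_assoc]
  gcongr
  exact hb u

/-- Change of variables for the components of `S`, in the form of an identity between integrals. -/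
theorem integral_weight_comp {φ φ' : ℝ → ℝ} {w a H : ℝ → ℂ} {s t : Set ℝ} (hs : MeasurableSet s)
    (hd : ∀ x ∈ s, HasDerivAt φ (φ' x) x) (hi : InjOn φ s) (ht : φ '' s = t)
    (hw : ∀ x ∈ s, w x = |φ' x| • a (φ x)) (ha : ∀ u ∉ t, a u = 0) (hsn : volume sᶜ = 0)
    (hint : Integrable fun u => a u * H u) :
    Integrable (fun x => w x * H (φ x)) ∧ ∫ x, w x * H (φ x) = ∫ u, a u * H u := by
  have hd' : ∀ x ∈ s, HasDerivWithinAt φ (φ' x) s x := fun x hx => (hd x hx).hasDerivWithinAt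
  have hr : (volume : Measure ℝ).restrict s = volume :=
    Measure.restrict_eq_self_of_ae_mem (by rw [ae_iff]; exact hsn)
  have hc : ∀ x ∈ s, |φ' x| • (a (φ x) * H (φ x)) = w x * H (φ x) := fun x hx => by
    rw [hw x hx, smul_mul_assoc]
  constructor
  · have h := (integrableOn_image_iff_integrableOn_abs_deriv_smul hs hd' hi
      (fun u => a u * H u)).1 hint.integrableOn
    have h' := h.congr_fun hc hs
    rwa [IntegrableOn, hr] at h'
  · have h := integral_image_eq_integral_abs_deriv_smul hs hd' hi (fun u => a u * H u)
    rw [setIntegral_congr_fun hs hc, hr, ht,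
      setIntegral_eq_integral_of_forall_compl_eq_zero fun u hu => by rw [ha u hu, zero_mul]] at h
    exact h.symm

/-- The weight of the first component of `S` equals the Jacobian times the reciprocal weight. -/
theorem sw₁_eq (x : ℝ) : sw₁ x = |-(2 * Real.exp x * ((1 + Real.exp x) ^ 2)⁻¹)| • sa₁ (sφ₁ x) := by
  have h := sw₁_mul_sa₁ x
  have h1 : sw₁ x * sw₁ x = ((‖sw₁ x‖ ^ 2 : ℝ) : ℂ) := by
    unfold sw₁
    rw [Complex.norm_real, Real.norm_eq_abs, sq_abs, ← Complex.ofReal_mul, sq]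
  rw [abs_neg, abs_of_nonneg (by positivity), ← norm_sw₁_sq, Complex.real_smul, ← h1, mul_assoc, h,
    mul_one]

/-- The analogue of `sw₁_eq` for the second component; the sign arises because `sw₂` is purely
imaginary, so that its square is the negative of the Jacobian. -/
theorem sw₂_eq {x : ℝ} (hx : x ≠ 0) :
    sw₂ x = |2 * Real.exp x * ((1 - Real.exp x) ^ 2)⁻¹| • (-sa₂ (sφ₂ x)) := by
  have h := sw₂_mul_sa₂ hx
  have h1 : sw₂ x * sw₂ x = -((‖sw₂ x‖ ^ 2 : ℝ) : ℂ) := by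
    unfold sw₂
    rw [norm_mul, Complex.norm_I, one_mul, Complex.norm_real, Real.norm_eq_abs, sq_abs,
      mul_mul_mul_comm, Complex.I_mul_I, ← Complex.ofReal_mul, sq, neg_one_mul]
  have h2 : ((‖sw₂ x‖ ^ 2 : ℝ) : ℂ) = -(sw₂ x * sw₂ x) := by rw [h1, neg_neg]
  rw [abs_of_nonneg (by positivity), ← norm_sw₂_sq, Complex.real_smul, h2, neg_mul_neg, mul_assoc, h,
    mul_one]

/-- The character `u ↦ e^{-itψ(u)}`, where `ψ(u) = ln |(1 - u) / (1 + u)|`. -/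
def psiChar (t u : ℝ) : ℂ := Complex.exp (-Complex.I * t * sψ u)

theorem norm_psiChar (t u : ℝ) : ‖psiChar t u‖ = 1 := by
  unfold psiChar
  rw [Complex.norm_exp]
  simp

theorem measurable_psiChar (t : ℝ) : Measurable (psiChar t) := by
  unfold psiChar sψ
  fun_prop

/-- The Fourier integral of a component of `S 𝓕 G`, transformed to the variable `u = φ(x)`, in which
the character `e^{-iyx}` becomes `psiChar y u`. -/
theorem fourierInt_comp {φ φ' : ℝ → ℝ} {w a : ℝ → ℂ} {s t : Set ℝ} (hs : MeasurableSet s)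
    (hd : ∀ x ∈ s, HasDerivAt φ (φ' x) x) (hi : InjOn φ s) (ht : φ '' s = t)
    (hw : ∀ x ∈ s, w x = |φ' x| • a (φ x)) (ha : ∀ u ∉ t, a u = 0) (hsn : volume sᶜ = 0)
    (hψ : ∀ x ∈ s, sψ (φ x) = x) (ham : Measurable a)
    (hab : ∀ u, ‖a u‖ ≤ Real.sqrt 2 * singBd u) (G : SchwartzMap ℝ ℂ) :
    Integrable (fun x => w x * fourierInt G (φ x)) ∧
      ∀ y, fourierInt (fun x => w x * fourierInt G (φ x)) y =
        (((Real.sqrt (2 * Real.pi))⁻¹ : ℝ) : ℂ) * ∫ u, a u * (psiChar y u * fourierInt G u) := by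
  have h0 := integrable_sa_mul ham hab G
  refine ⟨(integral_weight_comp hs hd hi ht hw ha hsn h0).1, fun y => ?_⟩
  have h1 : Integrable fun u => a u * (psiChar y u * fourierInt G u) := by
    refine (h0.bdd_mul (measurable_psiChar y).aestronglyMeasurable
      (Eventually.of_forall fun u => (norm_psiChar y u).le)).congr (Eventually.of_forall fun u => ?_)
    simp only
    ring
  rw [← (integral_weight_comp hs hd hi ht hw ha hsn h1).2]
  unfold fourierInt
  congr 1
  have hae : ∀ᵐ x : ℝ, x ∈ s := by rw [ae_iff]; exact hsn
  refine integral_congr_ae (hae.mono fun x hx => ?_)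
  simp only [psiChar, hψ x hx]
  ring

theorem fourierL2_opS_fst (G : SchwartzMap ℝ ℂ) :
    fourierL2 (opS (fourierL2 (G.toLp 2))).fst =ᵐ[volume] fun y =>
      (((Real.sqrt (2 * Real.pi))⁻¹ : ℝ) : ℂ) * ∫ u, sa₁ u * (psiChar y u * fourierInt G u) := by
  obtain ⟨h1, h2⟩ := fourierInt_comp (w := sw₁) (a := sa₁) MeasurableSet.univ
    (fun x _ => hasDerivAt_sφ₁ x) (Function.LeftInverse.injective sψ_sφ₁).injOn image_sφ₁
    (fun x _ => sw₁_eq x) (fun u hu => if_neg hu) (by simp) (fun x _ => sψ_sφ₁ x) measurable_sa₁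
    norm_sa₁_le G
  have h3 : (opS (fourierL2 (G.toLp 2))).fst =ᵐ[volume] fun x => sw₁ x * fourierInt G (sφ₁ x) :=
    (coeFn_weightedComp isWeight_sφ₁ _).trans (isWeight_sφ₁.congr (fourierInt_schwartz G))
  filter_upwards [fourierL2_ae_eq _ (h1.congr h3.symm)] with y hy
  rw [hy, fourierInt_congr h3, h2]

theorem fourierL2_opS_snd (G : SchwartzMap ℝ ℂ) :
    fourierL2 (opS (fourierL2 (G.toLp 2))).snd =ᵐ[volume] fun y =>
      (((Real.sqrt (2 * Real.pi))⁻¹ : ℝ) : ℂ) * ∫ u, -sa₂ u * (psiChar y u * fourierInt G u) := by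
  obtain ⟨h1, h2⟩ := fourierInt_comp (w := sw₂) (a := fun u => -sa₂ u)
    (measurableSet_singleton (0 : ℝ)).compl
    (fun x hx => hasDerivAt_sφ₂ hx)
    (fun x hx y hy hxy => by rw [← sψ_sφ₂ hx, hxy, sψ_sφ₂ hy]) image_sφ₂
    (fun x hx => sw₂_eq hx) (fun u hu => by rw [show sa₂ u = 0 from if_neg hu, neg_zero]) (by simp)
    (fun x hx => sψ_sφ₂ hx) measurable_sa₂.neg
    (fun u => by rw [norm_neg]; exact norm_sa₂_le u) G
  have h3 : (opS (fourierL2 (G.toLp 2))).snd =ᵐ[volume] fun x => sw₂ x * fourierInt G (sφ₂ x) :=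
    (coeFn_weightedComp isWeight_sφ₂ _).trans (isWeight_sφ₂.congr (fourierInt_schwartz G))
  filter_upwards [fourierL2_ae_eq _ (h1.congr h3.symm)] with y hy
  rw [hy, fourierInt_congr h3, h2]

/-! ### The factorised operators and their kernels -/

theorem integrable_sa_psiChar {a : ℝ → ℂ} (ha : Measurable a)
    (hb : ∀ u, ‖a u‖ ≤ Real.sqrt 2 * singBd u) (G : SchwartzMap ℝ ℂ) (t : ℝ) :
    Integrable fun u => a u * (psiChar t u * fourierInt G u) := by
  refine ((integrable_sa_mul ha hb G).bdd_mul (measurable_psiChar t).aestronglyMeasurable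
    (Eventually.of_forall fun u => (norm_psiChar t u).le)).congr (Eventually.of_forall fun u => ?_)
  simp only
  ring

theorem add_integral_sa (α β : ℂ) (G : SchwartzMap ℝ ℂ) (t : ℝ) :
    α * (∫ u, sa₁ u * (psiChar t u * fourierInt G u)) +
      β * (∫ u, -sa₂ u * (psiChar t u * fourierInt G u)) =
        ∫ u, ((α * sa₁ u - β * sa₂ u) * psiChar t u) * fourierInt G u := by
  have h1 := (integrable_sa_psiChar measurable_sa₁ norm_sa₁_le G t).const_mul α
  have h2 := (integrable_sa_psiChar (a := fun u => -sa₂ u) measurable_sa₂.neg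
    (fun u => by rw [norm_neg]; exact norm_sa₂_le u) G t).const_mul β
  rw [← integral_const_mul, ← integral_const_mul, ← integral_add h1 h2]
  refine integral_congr_ae (Eventually.of_forall fun u => ?_)
  simp only
  ring

/-- The weights of `R_±^*` combined with the normalisation of the Fourier integral. -/
theorem rv_mul {s : ℝ} :
    rv₁ s * (((Real.sqrt (2 * Real.pi))⁻¹ : ℝ) : ℂ) =
        (((2 * Real.pi)⁻¹ : ℝ) : ℂ) * (((Real.sqrt (1 - s))⁻¹ : ℝ) : ℂ) ∧
      rv₂ s * (((Real.sqrt (2 * Real.pi))⁻¹ : ℝ) : ℂ) =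
        (((2 * Real.pi)⁻¹ : ℝ) : ℂ) * (((Real.sqrt s)⁻¹ : ℝ) : ℂ) := by
  have hpi : (0 : ℝ) ≤ 2 * Real.pi := by positivity
  have h2 : (2 * Real.pi)⁻¹ = (Real.sqrt (2 * Real.pi))⁻¹ * (Real.sqrt (2 * Real.pi))⁻¹ := by
    rw [← mul_inv, Real.mul_self_sqrt hpi]
  unfold rv₁ rv₂
  rw [Real.sqrt_mul hpi, Real.sqrt_mul hpi, h2]
  constructor
  · push_cast
    rw [mul_inv]
    ring
  · push_cast
    rw [mul_inv]
    ring

theorem psiChar_neg_lam (s u : ℝ) :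
    psiChar (-lam s) u = Complex.exp (Complex.I * lam s * sψ u) := by
  unfold psiChar
  push_cast
  rw [neg_mul_neg]

/-- The explicit form of the reflected boundary value, which is the boundary value of
`-n(1 - s) Q_s` from below. -/
theorem bdry_neg {s : ℝ} (hs : s ∈ Ioo (0 : ℝ) 1) (u : ℝ) :
    bdry (1 - s) (-u) = (((2 * Real.pi)⁻¹ : ℝ) : ℂ) *
      (((((Real.sqrt s)⁻¹ : ℝ) : ℂ) * sa₁ u + (((Real.sqrt (1 - s))⁻¹ : ℝ) : ℂ) * sa₂ u) *
        Complex.exp (Complex.I * lam s * sψ u)) := by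
  have h1 : sa₁ (-u) = sa₁ u := by unfold sa₁; rw [abs_neg, neg_sq]
  have h2 : sa₂ (-u) = -sa₂ u := by
    unfold sa₂
    rw [abs_neg, neg_sq, neg_div]
    split_ifs
    · push_cast
      rw [mul_neg, inv_neg, mul_neg]
    · rw [neg_zero]
  have h3 : sψ (-u) = -sψ u := by
    unfold sψ
    rw [← Real.log_inv, ← abs_inv, inv_div, sub_neg_eq_add, ← sub_eq_add_neg]
  unfold bdry
  rw [h1, h2, h3, lam_one_sub hs, sub_sub_cancel]
  push_cast
  rw [mul_neg, sub_neg_eq_add, mul_neg, mul_neg, neg_mul, neg_neg]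

theorem fourierInt_comp_neg (f : ℝ → ℂ) (u : ℝ) :
    fourierInt (fun y => f (-y)) u = fourierInt f (-u) := by
  unfold fourierInt
  congr 1
  rw [← integral_neg_eq_self]
  refine integral_congr_ae (Eventually.of_forall fun y => ?_)
  simp only [neg_neg]
  push_cast
  ring_nf

/-- The analogue of `integral_bdry_mul_fourierInt` for the boundary values from below, obtained by
reflection. -/
theorem integral_bdry_neg_mul_fourierInt {s : ℝ} (hs : s ∈ Ioo (0 : ℝ) 1) {b : ℝ} (hb : 0 < b)
    (G : SchwartzMap ℝ ℂ) (hGc : HasCompactSupport G) (hG0 : (0 : ℝ) ∉ tsupport G) :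
    ∫ u : ℝ, bdry (1 - s) (-u) * fourierInt G u = ∫ x in Iio 0, qMinus b s x * G x := by
  have hs' : 1 - s ∈ Ioo (0 : ℝ) 1 := ⟨by linarith [hs.2], by linarith [hs.1]⟩
  have hc : HasCompactSupport (fun y => G (-y)) := hGc.comp_homeomorph (Homeomorph.neg ℝ)
  have hsm : ContDiff ℝ (⊤ : ℕ∞) fun y => G (-y) := (G.smooth ⊤).comp contDiff_neg
  have h := integral_bdry_mul_fourierInt hs' hb (hc.toSchwartzMap hsm) hc (by
    have e := tsupport_comp_eq_preimage G (Homeomorph.neg ℝ)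
    intro h0
    change (0 : ℝ) ∈ tsupport (G ∘ (Homeomorph.neg ℝ)) at h0
    rw [e] at h0
    apply hG0
    simpa using h0)
  have h1 : ∀ u, fourierInt (hc.toSchwartzMap hsm) u = fourierInt G (-u) := fourierInt_comp_neg G
  have h2 : ∀ x, (hc.toSchwartzMap hsm) x = G (-x) := fun x => rfl
  simp_rw [h1, h2] at h
  rw [← integral_neg_eq_self] at h
  simp_rw [neg_neg] at h
  rw [h]
  have h3 := integral_comp_neg_Ioi (0 : ℝ) (fun x => qPlus b (1 - s) (-x) * G x)
  simp only [neg_neg, neg_zero] at h3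
  rw [h3, integral_Iic_eq_integral_Iio]
  refine setIntegral_congr_fun measurableSet_Iio fun x hx => ?_
  simp only [qMinus_eq hs hb (ne_of_lt hx)]

/-- The operator `𝓕⁻¹ S⁻¹ (𝓕⁻¹ ⊕ 𝓕⁻¹) R`. -/
def factorOp (R : L2 (volume.restrict (Ioo 0 1)) →ₗᵢ[ℂ] WithLp 2 (L2 volume × L2 volume)) :
    L2 (volume.restrict (Ioo 0 1)) →ₗᵢ[ℂ] L2 volume :=
  (((LinearIsometryEquiv.withLpProdCongr 2 fourierL2.symm fourierL2.symm).trans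
    opS.symm).trans fourierL2.symm).toLinearIsometry.comp R

theorem factorOp_apply
    (R : L2 (volume.restrict (Ioo 0 1)) →ₗᵢ[ℂ] WithLp 2 (L2 volume × L2 volume))
    (h : L2 (volume.restrict (Ioo 0 1))) :
    factorOp R h = fourierL2.symm (opS.symm
      (LinearIsometryEquiv.withLpProdCongr 2 fourierL2.symm fourierL2.symm (R h))) := rfl

/-- Since all factors are unitary, they can be moved to the other side of the inner product. -/
theorem inner_factorOp
    (R : L2 (volume.restrict (Ioo 0 1)) →ₗᵢ[ℂ] WithLp 2 (L2 volume × L2 volume))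
    (h : L2 (volume.restrict (Ioo 0 1))) (f : L2 volume) :
    inner ℂ f (factorOp R h) =
      inner ℂ (WithLp.toLp 2 (fourierL2 (opS (fourierL2 f)).fst,
        fourierL2 (opS (fourierL2 f)).snd)) (R h) := by
  rw [factorOp_apply, ← LinearIsometryEquiv.inner_map_eq_flip,
    ← LinearIsometryEquiv.inner_map_eq_flip]
  rw [← (LinearIsometryEquiv.withLpProdCongr 2 fourierL2.symm fourierL2.symm).inner_map_map
    (WithLp.toLp 2 (fourierL2 (opS (fourierL2 f)).fst, fourierL2 (opS (fourierL2 f)).snd))]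
  congr 1
  refine WithLp.ofLp_injective 2 (Prod.ext ?_ ?_)
  · exact (fourierL2.symm_apply_apply _).symm
  · exact (fourierL2.symm_apply_apply _).symm

/-- The data of an integral operator `U h = ∫ q(s, ·) h(s) ds` from `L²(0,1)` to `L²(T)`, with
`L²(T)` viewed as a subspace of `L²(ℝ)`: the kernel is real, locally bounded in `s` and bounded on
bounded sets in `x`, and represents `U` weakly, on test functions supported away from the
origin. -/
structure IsKernel (q : ℝ → ℝ → ℂ) (T : Set ℝ)
    (U : L2 (volume.restrict (Ioo 0 1)) →ₗᵢ[ℂ] L2 volume) : Prop where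
  measurableSet : MeasurableSet T
  exists_measurable : ∃ k : ℝ → ℝ → ℂ, Measurable (Function.uncurry k) ∧
    ∀ s ∈ Ioo (0 : ℝ) 1, ∀ x ∈ T, q s x = k s x
  bdd : ∀ K : Set ℝ, IsCompact K → K ⊆ Ioo 0 1 → ∀ X : ℝ, ∃ C, ∀ s ∈ K, ∀ x ∈ T, |x| ≤ X →
    ‖q s x‖ ≤ C
  conj : ∀ s ∈ Ioo (0 : ℝ) 1, ∀ x ∈ T, starRingEnd ℂ (q s x) = q s x
  pairing : ∀ g : ℝ → ℝ, ContDiff ℝ (⊤ : ℕ∞) g → HasCompactSupport g → tsupport g ⊆ {0}ᶜ →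
    ∀ h : L2 (volume.restrict (Ioo 0 1)),
      ∫ x, g x • U h x = ∫ s in Ioo (0 : ℝ) 1, (∫ x in T, q s x * g x) * h s

/-- A weak representation through inner products suffices for the last field of `IsKernel`; the
conjugation in the inner product is harmless because the kernel is real. -/
theorem pairing_of_inner {q : ℝ → ℝ → ℂ} {T : Set ℝ}
    {U : L2 (volume.restrict (Ioo 0 1)) →ₗᵢ[ℂ] L2 volume} (hT : MeasurableSet T)
    (hconj : ∀ s ∈ Ioo (0 : ℝ) 1, ∀ x ∈ T, starRingEnd ℂ (q s x) = q s x)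
    (hU : ∀ G : SchwartzMap ℝ ℂ, HasCompactSupport G → (0 : ℝ) ∉ tsupport G →
      ∃ k : L2 (volume.restrict (Ioo 0 1)),
        (k =ᵐ[volume.restrict (Ioo 0 1)] fun s => ∫ x in T, q s x * G x) ∧
        ∀ h, inner ℂ (G.toLp 2 : L2 volume) (U h) = inner ℂ k h)
    (g : ℝ → ℝ) (hg : ContDiff ℝ (⊤ : ℕ∞) g) (hgc : HasCompactSupport g)
    (hg0 : tsupport g ⊆ {0}ᶜ) (h : L2 (volume.restrict (Ioo 0 1))) :
    ∫ x, g x • U h x = ∫ s in Ioo (0 : ℝ) 1, (∫ x in T, q s x * g x) * h s := by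
  have hgC : ContDiff ℝ (⊤ : ℕ∞) (fun x => (g x : ℂ)) := Complex.ofRealCLM.contDiff.comp hg
  have hgs : HasCompactSupport (fun x => (g x : ℂ)) := hgc.comp_left Complex.ofReal_zero
  set G : SchwartzMap ℝ ℂ := hgs.toSchwartzMap hgC with hG
  have hGe : ∀ x, G x = (g x : ℂ) := fun x => rfl
  have h0 : (0 : ℝ) ∉ tsupport G := by
    intro hm
    refine hg0 (closure_mono (fun x hx => ?_) hm) rfl
    rw [Function.mem_support] at hx ⊢
    intro hz
    exact hx (by rw [hGe, hz, Complex.ofReal_zero])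
  obtain ⟨k, hk, hkU⟩ := hU G hgs h0
  have h1 := hkU h
  rw [L2.inner_def, L2.inner_def] at h1
  have h2 : ∫ x, g x • U h x = ∫ x, inner ℂ ((G.toLp 2 : L2 volume) x) (U h x) := by
    refine integral_congr_ae ?_
    filter_upwards [SchwartzMap.coeFn_toLp G 2 volume] with x hx
    rw [hx, hGe, RCLike.inner_apply, Complex.conj_ofReal, Complex.real_smul, mul_comm]
  rw [h2, h1]
  refine integral_congr_ae ?_
  filter_upwards [hk, ae_restrict_mem measurableSet_Ioo] with s hs hmem
  rw [hs, RCLike.inner_apply, mul_comm, ← integral_conj]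
  congr 1
  refine setIntegral_congr_fun hT fun x hx => ?_
  rw [map_mul, hconj s hmem x hx, hGe, Complex.conj_ofReal]

/-- The weights of `R₊^*` assemble the two components of `(𝓕 ⊕ 𝓕) S 𝓕 G` into the pairing of `bdry`
with `𝓕 G`. -/
theorem isKernel_qPlus {b : ℝ} (hb : 0 < b) : IsKernel (qPlus b) (Ioi 0) (factorOp Rplus) where
  measurableSet := measurableSet_Ioi
  exists_measurable := ⟨kPlus b, measurable_kPlus b, fun s _ x hx =>
    qPlus_eq_kPlus s hb (ne_of_gt hx)⟩
  bdd K hK hK1 X := by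
    obtain ⟨C, hC⟩ := exists_norm_qPlus_le hb hK hK1 X
    exact ⟨C, fun s hs x hx hX => hC s hs x hx ((le_abs_self x).trans hX)⟩
  conj s _ x hx := qPlus_conj s hb (ne_of_gt hx)
  pairing := by
    refine pairing_of_inner measurableSet_Ioi (fun s _ x hx => qPlus_conj s hb (ne_of_gt hx))
      fun G hGc hG0 => ⟨RplusAdj (WithLp.toLp 2 (fourierL2 (opS (fourierL2 (G.toLp 2))).fst,
        fourierL2 (opS (fourierL2 (G.toLp 2))).snd)), ?_, fun h => ?_⟩
    · filter_upwards [ae_restrict_mem measurableSet_Ioo, RplusAdj_ae (WithLp.toLp 2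
        (fourierL2 (opS (fourierL2 (G.toLp 2))).fst, fourierL2 (opS (fourierL2 (G.toLp 2))).snd)),
        isWeight_rv₁.ae (fourierL2_opS_fst G), isWeight_rv₂.ae (fourierL2_opS_snd G)] with
        s hs h1 h2 h3
      have hv : rv₁ s ≠ 0 ∧ rv₂ s ≠ 0 := by
        have i1 := hs.1
        have i2 : 0 < 1 - s := by linarith [hs.2]
        unfold rv₁ rv₂
        constructor <;> exact_mod_cast (by positivity)
      rw [h1, ← integral_bdry_mul_fourierInt hs hb G hGc hG0]
      simp only [WithLp.toLp_fst, WithLp.toLp_snd]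
      rw [h2 hv.1, h3 hv.2]
      rw [← mul_assoc, ← mul_assoc, add_integral_sa, rv_mul.1, rv_mul.2]
      refine integral_congr_ae (Eventually.of_forall fun u => ?_)
      simp only [psiChar_neg_lam, bdry]
      ring
    · rw [inner_factorOp, inner_Rplus]

theorem isKernel_qMinus {b : ℝ} (hb : 0 < b) : IsKernel (qMinus b) (Iio 0) (factorOp Rminus) where
  measurableSet := measurableSet_Iio
  exists_measurable := by
    refine ⟨fun s x => kPlus b (1 - s) (-x), (measurable_kPlus b).comp
      (f := fun p : ℝ × ℝ => (1 - p.1, -p.2)) (by fun_prop), fun s hs x hx => ?_⟩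
    rw [qMinus_eq hs hb (ne_of_lt hx), qPlus_eq_kPlus _ hb (neg_ne_zero.2 (ne_of_lt hx))]
  bdd K hK hK1 X := by
    obtain ⟨C, hC⟩ := exists_norm_qPlus_le hb (hK.image (f := fun s => 1 - s) (by fun_prop))
      (by
        rintro _ ⟨s, hs, rfl⟩
        exact ⟨by linarith [(hK1 hs).2], by linarith [(hK1 hs).1]⟩) X
    refine ⟨C, fun s hs x hx hX => ?_⟩
    rw [qMinus_eq (hK1 hs) hb (ne_of_lt hx)]
    exact hC _ ⟨s, hs, rfl⟩ _ (neg_pos.2 hx) ((neg_le_abs x).trans hX)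
  conj s hs x hx := by
    rw [qMinus_eq hs hb (ne_of_lt hx)]
    exact qPlus_conj _ hb (neg_ne_zero.2 (ne_of_lt hx))
  pairing := by
    refine pairing_of_inner measurableSet_Iio (fun s hs x hx => ?_)
      fun G hGc hG0 => ⟨RminusAdj (WithLp.toLp 2 (fourierL2 (opS (fourierL2 (G.toLp 2))).fst,
        fourierL2 (opS (fourierL2 (G.toLp 2))).snd)), ?_, fun h => ?_⟩
    · rw [qMinus_eq hs hb (ne_of_lt hx)]
      exact qPlus_conj _ hb (neg_ne_zero.2 (ne_of_lt hx))
    · filter_upwards [ae_restrict_mem measurableSet_Ioo, RminusAdj_ae (WithLp.toLp 2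
        (fourierL2 (opS (fourierL2 (G.toLp 2))).fst, fourierL2 (opS (fourierL2 (G.toLp 2))).snd)),
        isWeight_rv₂.ae (fourierL2_opS_fst G), isWeight_rv₁.ae (fourierL2_opS_snd G)] with
        s hs h1 h2 h3
      have hv : rv₁ s ≠ 0 ∧ rv₂ s ≠ 0 := by
        have i1 := hs.1
        have i2 : 0 < 1 - s := by linarith [hs.2]
        unfold rv₁ rv₂
        constructor <;> exact_mod_cast (by positivity)
      rw [h1, ← integral_bdry_neg_mul_fourierInt hs hb G hGc hG0]
      simp only [WithLp.toLp_fst, WithLp.toLp_snd]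
      rw [h2 hv.2, h3 hv.1]
      rw [← mul_assoc, ← mul_assoc, sub_eq_add_neg, ← neg_mul, add_integral_sa, rv_mul.1, rv_mul.2]
      refine integral_congr_ae (Eventually.of_forall fun u => ?_)
      simp only [psiChar_neg_lam, bdry_neg hs]
      ring
    · rw [inner_factorOp, inner_Rminus]

/-! ### Truncation in `L²` -/

/-- The restriction of an `L²`-function to a measurable set, extended by zero. -/
def truncL {μ : Measure ℝ} {E : Set ℝ} (hE : MeasurableSet E) (f : L2 μ) : L2 μ :=
  ((Lp.memLp f).indicator hE).toLp (E.indicator f)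

theorem coeFn_truncL {μ : Measure ℝ} {E : Set ℝ} (hE : MeasurableSet E) (f : L2 μ) :
    truncL hE f =ᵐ[μ] E.indicator f := MemLp.coeFn_toLp _

theorem tendsto_of_enorm_sub_sq {ι : Type} {l : Filter ι} {E : Type*} [NormedAddCommGroup E]
    {f : ι → E} {a : E} (h : Tendsto (fun i => ‖f i - a‖ₑ ^ 2) l (𝓝 0)) : Tendsto f l (𝓝 a) := by
  rw [tendsto_iff_edist_tendsto_0]
  have h1 := (ENNReal.continuous_rpow_const (y := (1 / 2 : ℝ))).tendsto 0 |>.comp h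
  rw [ENNReal.zero_rpow_of_pos (by norm_num)] at h1
  refine h1.congr fun i => ?_
  simp only [Function.comp]
  rw [← ENNReal.rpow_natCast, ← ENNReal.rpow_mul, edist_eq_enorm_sub]
  norm_num

theorem tendsto_truncL {ι : Type} {l : Filter ι} [l.IsCountablyGenerated] {μ : Measure ℝ}
    {E : ι → Set ℝ} (hE : ∀ i, MeasurableSet (E i)) (f : L2 μ)
    (h : ∀ᵐ x ∂μ, ∀ᶠ i in l, x ∈ E i) : Tendsto (fun i => truncL (hE i) f) l (𝓝 f) := by
  refine tendsto_of_enorm_sub_sq ?_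
  have hm : Measurable f := (Lp.stronglyMeasurable f).measurable
  have h1 : ∀ i, ‖truncL (hE i) f - f‖ₑ ^ 2 = ∫⁻ x, ‖(E i)ᶜ.indicator f x‖ₑ ^ 2 ∂μ := by
    intro i
    rw [enorm_sq_eq_lintegral]
    refine lintegral_congr_ae ?_
    filter_upwards [Lp.coeFn_sub (truncL (hE i) f) f, coeFn_truncL (hE i) f] with x hx hx'
    rw [hx, Pi.sub_apply, hx']
    by_cases hmem : x ∈ E i
    · rw [indicator_of_mem hmem, indicator_of_notMem (notMem_compl_iff.2 hmem), sub_self]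
    · rw [indicator_of_notMem hmem, indicator_of_mem (mem_compl hmem), zero_sub, enorm_neg]
  simp_rw [h1]
  rw [← lintegral_zero (μ := μ)]
  refine tendsto_lintegral_filter_of_dominated_convergence (fun x => ‖f x‖ₑ ^ 2)
    (Eventually.of_forall fun i => ((hm.indicator (hE i).compl).enorm.pow_const 2))
    (Eventually.of_forall fun i => Eventually.of_forall fun x => ?_) ?_ ?_
  · by_cases hmem : x ∈ (E i)ᶜ
    · rw [indicator_of_mem hmem]
    · rw [indicator_of_notMem hmem]; simp
  · rw [← enorm_sq_eq_lintegral]; finiteness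
  · filter_upwards [h] with x hx
    refine tendsto_const_nhds.congr' (hx.mono fun i hi => ?_)
    simp [indicator_of_notMem (notMem_compl_iff.2 hi)]

/-! ### Restriction operators -/

theorem coeFn_projP (T : Set ℝ) (f : L2 volume) : projP T f =ᵐ[volume.restrict T] f :=
  LpToLpRestrictCLM_coeFn ℂ T f

theorem inner_projP (T : Set ℝ) (f g : L2 volume) :
    inner ℂ (projP T f) (projP T g) = ∫ x in T, inner ℂ (f x) (g x) := by
  rw [L2.inner_def]
  refine integral_congr_ae ?_
  filter_upwards [coeFn_projP T f, coeFn_projP T g] with x h1 h2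
  rw [h1, h2]

theorem adjoint_projP_projP {T : Set ℝ} (hT : MeasurableSet T) {f : L2 volume}
    (hf : f =ᵐ[volume.restrict Tᶜ] 0) : (projP T).adjoint (projP T f) = f := by
  refine ext_inner_right ℂ fun g => ?_
  rw [ContinuousLinearMap.adjoint_inner_left, inner_projP, L2.inner_def]
  refine setIntegral_eq_integral_of_ae_compl_eq_zero ?_
  rw [EventuallyEq, ae_restrict_iff' hT.compl] at hf
  filter_upwards [hf] with x hx hxT
  rw [hx hxT]
  simp

theorem projP_surjective {T : Set ℝ} (hT : MeasurableSet T) (g : L2 (volume.restrict T)) :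
    ∃ f, projP T f = g := by
  have hm : MemLp (T.indicator g) 2 volume := (memLp_indicator_iff_restrict hT).2 (Lp.memLp g)
  refine ⟨hm.toLp _, Lp.ext ?_⟩
  filter_upwards [coeFn_projP T (hm.toLp _), ae_restrict_of_ae hm.coeFn_toLp,
    ae_restrict_mem hT] with x h1 h2 h3
  rw [h1, h2, indicator_of_mem h3]

/-! ### Integral operators from weak kernels -/

theorem L2.integrable_Ioo (h : L2 (volume.restrict (Ioo (0 : ℝ) 1))) :
    Integrable h (volume.restrict (Ioo 0 1)) := (Lp.memLp h).integrable one_le_two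

section Kernel

variable {q : ℝ → ℝ → ℂ} {T : Set ℝ} {U : L2 (volume.restrict (Ioo 0 1)) →ₗᵢ[ℂ] L2 volume}

theorem IsKernel.integrable_prod (H : IsKernel q T U) {K : Set ℝ} (hK : IsCompact K)
    (hK1 : K ⊆ Ioo 0 1) {X : ℝ} {f₁ f₂ : ℝ → ℂ} (h₁ : Integrable f₁ (volume.restrict (Ioo 0 1)))
    (h₁0 : ∀ s ∉ K, f₁ s = 0) (h₂ : Integrable f₂ (volume.restrict T))
    (h₂0 : ∀ x, X < |x| → f₂ x = 0) :
    Integrable (fun p : ℝ × ℝ => q p.1 p.2 * (f₁ p.1 * f₂ p.2))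
      ((volume.restrict (Ioo 0 1)).prod (volume.restrict T)) := by
  obtain ⟨k, hkm, hk⟩ := H.exists_measurable
  obtain ⟨C, hC⟩ := H.bdd K hK hK1 X
  have hmem : ∀ᵐ p ∂((volume.restrict (Ioo (0 : ℝ) 1)).prod (volume.restrict T)),
      p ∈ Ioo (0 : ℝ) 1 ×ˢ T := by
    rw [Measure.prod_restrict]
    exact ae_restrict_mem (measurableSet_Ioo.prod H.measurableSet)
  have hprod := h₁.mul_prod h₂
  refine (hprod.norm.const_mul |C|).mono' ?_ ?_
  · refine (hkm.aestronglyMeasurable.mul hprod.aestronglyMeasurable).congr (hmem.mono fun p hp => ?_)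
    simp only [Pi.mul_apply, Function.uncurry]
    rw [hk _ hp.1 _ hp.2]
  · filter_upwards [hmem] with p hp
    rw [norm_mul]
    by_cases hs : p.1 ∈ K
    · by_cases hx : |p.2| ≤ X
      · gcongr
        exact (hC _ hs _ hp.2 hx).trans (le_abs_self C)
      · rw [h₂0 _ (not_le.1 hx)]; simp
    · rw [h₁0 _ hs]; simp

theorem IsKernel.integral_swap (H : IsKernel q T U) {K : Set ℝ} (hK : IsCompact K)
    (hK1 : K ⊆ Ioo 0 1) {X : ℝ} {f₁ f₂ : ℝ → ℂ} (h₁ : Integrable f₁ (volume.restrict (Ioo 0 1)))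
    (h₁0 : ∀ s ∉ K, f₁ s = 0) (h₂ : Integrable f₂ (volume.restrict T))
    (h₂0 : ∀ x, X < |x| → f₂ x = 0) :
    ∫ x in T, (∫ s in Ioo (0 : ℝ) 1, q s x * f₁ s) * f₂ x =
      ∫ s in Ioo (0 : ℝ) 1, (∫ x in T, q s x * f₂ x) * f₁ s := by
  have h := integral_integral_swap (f := fun s x => q s x * (f₁ s * f₂ x))
    (H.integrable_prod hK hK1 h₁ h₁0 h₂ h₂0)
  refine Eq.trans ?_ (h.symm.trans ?_)
  · refine integral_congr_ae (Eventually.of_forall fun x => ?_)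
    simp only
    rw [← integral_mul_const]
    simp only [mul_assoc]
  · refine integral_congr_ae (Eventually.of_forall fun s => ?_)
    simp only
    rw [← integral_mul_const]
    refine integral_congr_ae (Eventually.of_forall fun x => ?_)
    simp only
    ring

theorem IsKernel.locallyIntegrable (H : IsKernel q T U) {K : Set ℝ} (hK : IsCompact K)
    (hK1 : K ⊆ Ioo 0 1) {f₁ : ℝ → ℂ} (h₁ : Integrable f₁ (volume.restrict (Ioo 0 1)))
    (h₁0 : ∀ s ∉ K, f₁ s = 0) :
    LocallyIntegrable (T.indicator fun x => ∫ s in Ioo (0 : ℝ) 1, q s x * f₁ s) volume := by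
  rw [locallyIntegrable_iff]
  intro C hC
  obtain ⟨X, hX⟩ := hC.isBounded.exists_norm_le
  have h₂ : Integrable ((Icc (-X) X).indicator fun _ => (1 : ℂ)) (volume.restrict T) :=
    (((integrable_indicator_iff measurableSet_Icc).2
      (integrableOn_const isCompact_Icc.measure_lt_top.ne) : Integrable _ volume)).restrict
  have h₂0 : ∀ x, X < |x| → (Icc (-X) X).indicator (fun _ => (1 : ℂ)) x = 0 := fun x hx =>
    indicator_of_notMem (fun hm => absurd (abs_le.2 ⟨hm.1, hm.2⟩) (not_le.2 hx)) _
  have h := (H.integrable_prod hK hK1 h₁ h₁0 h₂ h₂0).integral_prod_right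
  have h3 : IntegrableOn (fun x => ∫ s in Ioo (0 : ℝ) 1, q s x * (f₁ s *
      (Icc (-X) X).indicator (fun _ => (1 : ℂ)) x)) T volume := h
  rw [← integrable_indicator_iff H.measurableSet] at h3
  refine (h3.integrableOn (s := C)).congr ?_
  filter_upwards [ae_restrict_mem hC.measurableSet] with x hx
  have hx' : x ∈ Icc (-X) X := abs_le.1 (hX x hx)
  by_cases hT : x ∈ T
  · rw [indicator_of_mem hT, indicator_of_mem hT]
    simp only [indicator_of_mem hx', mul_one]
  · rw [indicator_of_notMem hT, indicator_of_notMem hT]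

/-- On functions supported in a compact subset of `(0,1)`, the operator `U` is the integral operator
with kernel `q`, and its values are supported in `T`. -/
theorem IsKernel.apply_ae (H : IsKernel q T U) {K : Set ℝ} (hK : IsCompact K) (hK1 : K ⊆ Ioo 0 1)
    (h : L2 (volume.restrict (Ioo 0 1))) {f₁ : ℝ → ℂ} (hf : h =ᵐ[volume.restrict (Ioo 0 1)] f₁)
    (h₁0 : ∀ s ∉ K, f₁ s = 0) :
    U h =ᵐ[volume] T.indicator fun x => ∫ s in Ioo (0 : ℝ) 1, q s x * f₁ s := by
  have h₁ : Integrable f₁ (volume.restrict (Ioo 0 1)) := (L2.integrable_Ioo h).congr hf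
  have hl1 : LocallyIntegrable (U h) volume := (Lp.memLp _).locallyIntegrable (by norm_num)
  have hl2 := H.locallyIntegrable hK hK1 h₁ h₁0
  -- Test functions supported away from the origin determine a function almost everywhere.
  have h0 : ∀ᵐ x : ℝ, x ∈ ({0}ᶜ : Set ℝ) → U h x -
      T.indicator (fun x => ∫ s in Ioo (0 : ℝ) 1, q s x * f₁ s) x = 0 := by
    refine isOpen_compl_singleton.ae_eq_zero_of_integral_contDiff_smul_eq_zero
      ((hl1.sub hl2).locallyIntegrableOn _) fun g hg hgc hgs => ?_
    have i1 := hl1.integrable_smul_left_of_hasCompactSupport hg.continuous hgc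
    have i2 := hl2.integrable_smul_left_of_hasCompactSupport hg.continuous hgc
    simp only [smul_sub]
    rw [integral_sub i1 i2, H.pairing g hg hgc hgs h, sub_eq_zero]
    obtain ⟨X, hX⟩ := hgc.isCompact.isBounded.exists_norm_le
    have hgi : Integrable (fun x => (g x : ℂ)) (volume.restrict T) :=
      (hg.continuous.integrable_of_hasCompactSupport hgc).ofReal.restrict
    have hsw := H.integral_swap hK hK1 h₁ h₁0 (X := X) hgi (fun x hx => by
      rw [image_eq_zero_of_notMem_tsupport (f := g)
        (fun hm => absurd (hX x hm) (not_le.2 hx)), Complex.ofReal_zero])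
    have e1 : ∫ s in Ioo (0 : ℝ) 1, (∫ x in T, q s x * g x) * h s =
        ∫ s in Ioo (0 : ℝ) 1, (∫ x in T, q s x * g x) * f₁ s :=
      integral_congr_ae (hf.mono fun s hs => by simp only [hs])
    rw [e1, ← hsw, ← integral_indicator H.measurableSet]
    refine integral_congr_ae (Eventually.of_forall fun x => ?_)
    by_cases hx : x ∈ T
    · simp only [indicator_of_mem hx, Complex.real_smul, mul_comm]
    · simp only [indicator_of_notMem hx, smul_zero]
  have hae : ∀ᵐ x : ℝ, x ≠ 0 := by simp [ae_iff]
  filter_upwards [h0, hae] with x hx hx0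
  exact sub_eq_zero.1 (hx hx0)

theorem eventually_corner : ∀ᶠ p : ℝ × ℝ in 𝓝[>] 0 ×ˢ 𝓝[>] 0,
    (0 < p.1 ∧ p.1 < 1 / 2) ∧ (0 < p.2 ∧ p.2 < 1 / 2) := by
  have h : ∀ᶠ a : ℝ in 𝓝[>] 0, 0 < a ∧ a < 1 / 2 := Ioo_mem_nhdsGT (by norm_num)
  exact h.prod_mk h

theorem tendsto_truncL_corner (h : L2 (volume.restrict (Ioo (0 : ℝ) 1))) :
    Tendsto (fun p : ℝ × ℝ => truncL (measurableSet_Ioo (a := p.1) (b := 1 - p.2)) h)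
      (𝓝[>] 0 ×ˢ 𝓝[>] 0) (𝓝 h) := by
  refine tendsto_truncL (fun p => measurableSet_Ioo) h ?_
  filter_upwards [ae_restrict_mem measurableSet_Ioo] with s hs
  have h1 : ∀ᶠ a : ℝ in 𝓝[>] 0, a < s := nhdsWithin_le_nhds (Iio_mem_nhds hs.1)
  have h2 : ∀ᶠ a : ℝ in 𝓝[>] 0, a < 1 - s :=
    nhdsWithin_le_nhds (Iio_mem_nhds (sub_pos.2 hs.2))
  filter_upwards [h1.prod_mk h2] with p hp
  exact ⟨hp.1, by linarith [hp.2]⟩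

theorem IsKernel.apply_truncL_ae (H : IsKernel q T U) {a c : ℝ} (ha : 0 < a) (hc : c < 1)
    (h : L2 (volume.restrict (Ioo 0 1))) :
    U (truncL (measurableSet_Ioo (a := a) (b := c)) h) =ᵐ[volume]
      T.indicator fun x => ∫ s in Ioo (0 : ℝ) 1, q s x * (Ioo a c).indicator h s :=
  H.apply_ae isCompact_Icc (Icc_subset_Ioo ha hc) _ (coeFn_truncL _ h) fun _ hs =>
    indicator_of_notMem (fun hm => hs (Ioo_subset_Icc_self hm)) _

/-- The values of `U` are supported in `T`. -/
theorem IsKernel.ae_eq_zero (H : IsKernel q T U) (h : L2 (volume.restrict (Ioo 0 1))) :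
    U h =ᵐ[volume.restrict Tᶜ] 0 := by
  have h1 : projP Tᶜ (U h) = 0 := by
    refine tendsto_nhds_unique (((projP Tᶜ).continuous.comp U.continuous).tendsto h |>.comp
      (tendsto_truncL_corner h)) (tendsto_const_nhds.congr' ?_)
    filter_upwards [eventually_corner] with p hp
    refine (Lp.ext ?_).symm
    filter_upwards [coeFn_projP Tᶜ (U (truncL (measurableSet_Ioo (a := p.1) (b := 1 - p.2)) h)),
      ae_restrict_of_ae (H.apply_truncL_ae hp.1.1 (by linarith [hp.2.1] : 1 - p.2 < 1) h),
      ae_restrict_mem H.measurableSet.compl, Lp.coeFn_zero ℂ 2 (volume.restrict Tᶜ)]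
      with x h1 h2 h3 h4
    simp only [Function.comp]
    rw [h1, h2, h4, indicator_of_notMem h3]
    rfl
  have h2 := coeFn_projP Tᶜ (U h)
  rw [h1] at h2
  exact h2.symm.trans (Lp.coeFn_zero ℂ 2 _)

/-- The operator `U`, regarded as an isometry into `L²(T)`. -/
def IsKernel.restrictOp (H : IsKernel q T U) :
    L2 (volume.restrict (Ioo 0 1)) →ₗᵢ[ℂ] L2 (volume.restrict T) where
  toLinearMap := (projP T).toLinearMap ∘ₗ U.toLinearMap
  norm_map' h := by
    have h1 := ContinuousLinearMap.adjoint_inner_left (projP T) (U h) (projP T (U h))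
    rw [adjoint_projP_projP H.measurableSet (H.ae_eq_zero h), inner_self_eq_norm_sq_to_K,
      inner_self_eq_norm_sq_to_K] at h1
    have h2 : ‖U h‖ ^ 2 = ‖projP T (U h)‖ ^ 2 := by exact_mod_cast h1
    have h3 := (pow_left_inj₀ (norm_nonneg _) (norm_nonneg _) two_ne_zero).1 h2
    rw [← U.norm_map h, h3]
    rfl

theorem IsKernel.restrictOp_apply (H : IsKernel q T U) (h : L2 (volume.restrict (Ioo 0 1))) :
    H.restrictOp h = projP T (U h) := rfl

theorem IsKernel.adjoint_restrictOp (H : IsKernel q T U) (h : L2 (volume.restrict (Ioo 0 1))) :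
    (projP T).adjoint (H.restrictOp h) = U h :=
  adjoint_projP_projP H.measurableSet (H.ae_eq_zero h)

/-- Two complementary isometries with values supported in disjoint sets map onto the respective
`L²`-spaces. -/
theorem IsKernel.restrictOp_surjective {q' : ℝ → ℝ → ℂ} {T' : Set ℝ}
    {U' : L2 (volume.restrict (Ioo 0 1)) →ₗᵢ[ℂ] L2 volume} (H : IsKernel q T U)
    (H' : IsKernel q' T' U') (hd : Disjoint T T') (hs : ∀ f, ∃ h h', U h + U' h' = f) :
    Function.Surjective H.restrictOp := by
  intro g
  obtain ⟨f, hf⟩ := projP_surjective H.measurableSet g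
  obtain ⟨h, h', rfl⟩ := hs f
  refine ⟨h, ?_⟩
  have h0 : projP T (U' h') = 0 := by
    refine Lp.ext ?_
    filter_upwards [coeFn_projP T (U' h'), Lp.coeFn_zero ℂ 2 (volume.restrict T),
      ae_restrict_of_ae_restrict_of_subset hd.subset_compl_right (H'.ae_eq_zero h')] with x h1 h2 h3
    rw [h1, h2, h3]
  rw [map_add, h0, add_zero] at hf
  exact hf

/-- The truncated integrals are the images of the truncations `h · 1_{]α, 1 - α'[}`, which converge
to `h`. -/
theorem IsKernel.isLimIntegral (H : IsKernel q T U) (h : L2 (volume.restrict (Ioo 0 1))) :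
    IsLimIntegral (𝓝[>] 0 ×ˢ 𝓝[>] 0) (fun p : ℝ × ℝ => p.1) (fun p => 1 - p.2) q h T
      (H.restrictOp h) := by
  obtain ⟨k, hkm, hk⟩ := H.exists_measurable
  have hae : ∀ p : ℝ × ℝ, (0 < p.1 ∧ p.1 < 1 / 2) ∧ (0 < p.2 ∧ p.2 < 1 / 2) →
      H.restrictOp (truncL (measurableSet_Ioo (a := p.1) (b := 1 - p.2)) h)
        =ᵐ[volume.restrict T] fun x => ∫ s in p.1..(1 - p.2), q s x * h s := by
    intro p hp
    have hsub : Ioo p.1 (1 - p.2) ⊆ Ioo 0 1 :=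
      Ioo_subset_Ioo hp.1.1.le (by linarith [hp.2.1])
    filter_upwards [coeFn_projP T (U (truncL (measurableSet_Ioo (a := p.1) (b := 1 - p.2)) h)),
      ae_restrict_of_ae (H.apply_truncL_ae hp.1.1 (by linarith [hp.2.1] : 1 - p.2 < 1) h),
      ae_restrict_mem H.measurableSet] with x h1 h2 h3
    rw [H.restrictOp_apply, h1, h2, indicator_of_mem h3,
      intervalIntegral.integral_of_le (by linarith [hp.1.2, hp.2.2]), integral_Ioc_eq_integral_Ioo]
    have e : ∀ s, q s x * (Ioo p.1 (1 - p.2)).indicator h s =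
        (Ioo p.1 (1 - p.2)).indicator (fun s => q s x * h s) s := fun s => by
      by_cases hs : s ∈ Ioo p.1 (1 - p.2)
      · rw [indicator_of_mem hs, indicator_of_mem hs]
      · rw [indicator_of_notMem hs, indicator_of_notMem hs, mul_zero]
    simp_rw [e]
    rw [setIntegral_indicator measurableSet_Ioo, inter_eq_right.2 hsub]
  refine ⟨?_, ?_⟩
  · filter_upwards [eventually_corner] with p hp
    have hsub : Ioo p.1 (1 - p.2) ⊆ Ioo 0 1 :=
      Ioo_subset_Ioo hp.1.1.le (by linarith [hp.2.1])
    refine ⟨fun x hx => ?_, (Lp.memLp _).ae_eq (hae p hp)⟩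
    rw [intervalIntegrable_iff_integrableOn_Ioo_of_le (by linarith [hp.1.2, hp.2.2])]
    obtain ⟨C, hC⟩ := H.bdd (Icc p.1 (1 - p.2)) isCompact_Icc
      (Icc_subset_Ioo hp.1.1 (by linarith [hp.2.1])) |x|
    have hhi : IntegrableOn h (Ioo p.1 (1 - p.2)) :=
      IntegrableOn.mono_set (t := Ioo 0 1) (L2.integrable_Ioo h) hsub
    have hkx : Measurable fun s => k s x := hkm.of_uncurry_right
    refine hhi.bdd_mul (c := C) (hkx.aestronglyMeasurable.congr ?_) ?_
    · filter_upwards [ae_restrict_mem measurableSet_Ioo] with s hs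
      rw [hk s (hsub hs) x hx]
    · filter_upwards [ae_restrict_mem measurableSet_Ioo] with s hs
      exact hC s (Ioo_subset_Icc_self hs) x hx le_rfl
  · have ht := (H.restrictOp.continuous.tendsto h).comp (tendsto_truncL_corner h)
    rw [Lp.tendsto_Lp_iff_tendsto_eLpNorm'] at ht
    refine ht.congr' ?_
    filter_upwards [eventually_corner] with p hp
    refine eLpNorm_congr_ae ?_
    filter_upwards [hae p hp] with x hx
    simp only [Function.comp, Pi.sub_apply, hx]

theorem integrableOn_of_L2 (g : L2 (volume.restrict T)) {lo hi : ℝ} (hI : Ioo lo hi ⊆ T) :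
    IntegrableOn g (Ioo lo hi) :=
  ((Lp.memLp g).mono_measure (Measure.restrict_mono hI le_rfl)).integrable one_le_two

/-- The inverse of the unitary operator with kernel `q` is the integral operator with the
transposed kernel, because `q` is real. -/
theorem IsKernel.symm_truncL_ae (H : IsKernel q T U)
    (V : L2 (volume.restrict (Ioo 0 1)) ≃ₗᵢ[ℂ] L2 (volume.restrict T))
    (hV : ∀ h, V h = H.restrictOp h) (g : L2 (volume.restrict T)) {lo hi : ℝ}
    (hI : Ioo lo hi ⊆ T) :
    V.symm (truncL (measurableSet_Ioo (a := lo) (b := hi)) g) =ᵐ[volume.restrict (Ioo 0 1)]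
      fun s => ∫ x in T, q s x * (Ioo lo hi).indicator g x := by
  set W := V.symm (truncL (measurableSet_Ioo (a := lo) (b := hi)) g) with hW
  set f₂ := (Ioo lo hi).indicator g with hf₂
  have h₂ : Integrable f₂ (volume.restrict T) :=
    ((integrable_indicator_iff measurableSet_Ioo).2 (integrableOn_of_L2 g hI)).restrict
  have h₂0 : ∀ x, max |lo| |hi| < |x| → f₂ x = 0 := by
    intro x hx
    refine indicator_of_notMem (fun hm => absurd hx (not_lt.2 ?_)) _
    exact abs_le_max_abs_abs hm.1.le hm.2.le
  set D : ℝ → ℂ := fun s => ∫ x in T, q s x * f₂ x with hD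
  have hWi := L2.integrable_Ioo W
  have hDl : LocallyIntegrableOn D (Ioo 0 1) volume := by
    rw [locallyIntegrableOn_iff isOpen_Ioo.isLocallyClosed]
    intro K hK1 hK
    have h₁ : Integrable (K.indicator fun _ => (1 : ℂ)) (volume.restrict (Ioo 0 1)) :=
      ((integrable_indicator_iff hK.measurableSet).2
        (integrableOn_const hK.measure_lt_top.ne)).restrict
    have h := (H.integrable_prod hK hK1 h₁ (fun s hs => indicator_of_notMem hs _) h₂
      h₂0).integral_prod_left
    have h3 := IntegrableOn.mono_set (s := K) (t := Ioo 0 1) h hK1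
    refine h3.congr ?_
    filter_upwards [ae_restrict_mem hK.measurableSet] with s hs
    simp only [indicator_of_mem hs, one_mul, hD]
  have hWl : LocallyIntegrableOn W (Ioo 0 1) volume :=
    IntegrableOn.locallyIntegrableOn (f := W) hWi
  -- Both sides have the same pairing with every real test function `φ`: by unitarity
  -- `⟨φ, V⁻¹ g⟩ = ⟨V φ, g⟩`, where `V φ` is given by the integral.
  have h0 : ∀ᵐ s : ℝ, s ∈ Ioo (0 : ℝ) 1 → W s - D s = 0 := by
    refine isOpen_Ioo.ae_eq_zero_of_integral_contDiff_smul_eq_zero (hWl.sub hDl)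
      fun φ hφ hφc hφs => ?_
    have hφm : MemLp (fun s => (φ s : ℂ)) 2 (volume.restrict (Ioo 0 1)) :=
      ((Complex.continuous_ofReal.comp hφ.continuous).memLp_of_hasCompactSupport
        (hφc.comp_left Complex.ofReal_zero)).restrict _
    have h₁ : Integrable (fun s => (φ s : ℂ)) (volume.restrict (Ioo 0 1)) :=
      hφm.integrable one_le_two
    have h₁0 : ∀ s ∉ tsupport φ, (φ s : ℂ) = 0 := fun s hs => by
      rw [image_eq_zero_of_notMem_tsupport hs, Complex.ofReal_zero]
    have hUφ := H.apply_ae hφc.isCompact hφs (hφm.toLp _) hφm.coeFn_toLp h₁0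
    have hsw := H.integral_swap hφc.isCompact hφs h₁ h₁0 h₂ h₂0
    have hin : inner ℂ (hφm.toLp _) W =
        inner ℂ (V (hφm.toLp _)) (truncL (measurableSet_Ioo (a := lo) (b := hi)) g) := by
      rw [hW, V.inner_map_eq_flip]
    rw [L2.inner_def, L2.inner_def] at hin
    have e1 : ∫ s in Ioo (0 : ℝ) 1, (inner ℂ ((hφm.toLp (fun s => (φ s : ℂ))) s) (W s) : ℂ) =
        ∫ s in Ioo (0 : ℝ) 1, φ s • W s := by
      refine integral_congr_ae (hφm.coeFn_toLp.mono fun s hs => ?_)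
      simp only [hs]
      rw [RCLike.inner_apply, Complex.conj_ofReal, Complex.real_smul, mul_comm]
    have e2 : ∫ x in T, (inner ℂ ((V (hφm.toLp (fun s => (φ s : ℂ)))) x)
        ((truncL (measurableSet_Ioo (a := lo) (b := hi)) g) x) : ℂ) =
        ∫ x in T, (∫ s in Ioo (0 : ℝ) 1, q s x * φ s) * f₂ x := by
      refine integral_congr_ae ?_
      filter_upwards [coeFn_projP T (U (hφm.toLp _)), ae_restrict_of_ae hUφ,
        ae_restrict_mem H.measurableSet,
        coeFn_truncL (measurableSet_Ioo (a := lo) (b := hi)) g] with x h1 h2 h3 h4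
      rw [hV, H.restrictOp_apply, h1, h2, h4, indicator_of_mem h3, RCLike.inner_apply,
        ← integral_conj, mul_comm]
      congr 1
      refine setIntegral_congr_fun measurableSet_Ioo fun s hs => ?_
      rw [map_mul, H.conj s hs x h3, Complex.conj_ofReal]
    have e3 : ∫ s in Ioo (0 : ℝ) 1, φ s • W s = ∫ s in Ioo (0 : ℝ) 1, φ s • D s := by
      rw [← e1, hin, e2, hsw]
      refine integral_congr_ae (Eventually.of_forall fun s => ?_)
      simp only [Complex.real_smul, mul_comm, hD]
    obtain ⟨C, hC⟩ := hφ.continuous.bounded_above_of_compact_support hφc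
    have i1 : Integrable (fun s => φ s • W s) (volume.restrict (Ioo 0 1)) :=
      hWi.bdd_smul C hφ.continuous.aestronglyMeasurable (Eventually.of_forall hC)
    have i2 : Integrable (fun s => φ s • D s) (volume.restrict (Ioo 0 1)) := by
      have h := (H.integrable_prod hφc.isCompact hφs h₁ h₁0 h₂ h₂0).integral_prod_left
      refine h.congr (Eventually.of_forall fun s => ?_)
      simp only [hD, Complex.real_smul, ← integral_const_mul]
      refine integral_congr_ae (Eventually.of_forall fun x => ?_)
      simp only
      ring
    rw [← setIntegral_eq_integral_of_forall_compl_eq_zero (s := Ioo (0 : ℝ) 1) fun s hs => by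
      rw [image_eq_zero_of_notMem_tsupport fun hm => hs (hφs hm), zero_smul]]
    simp only [smul_sub]
    rw [integral_sub i1 i2, e3, sub_self]
  rw [EventuallyEq, ae_restrict_iff' measurableSet_Ioo]
  exact h0.mono fun s hs hmem => sub_eq_zero.1 (hs hmem)

theorem IsKernel.isLimIntegral_symm (H : IsKernel q T U)
    (V : L2 (volume.restrict (Ioo 0 1)) ≃ₗᵢ[ℂ] L2 (volume.restrict T))
    (hV : ∀ h, V h = H.restrictOp h) (g : L2 (volume.restrict T)) {lo hi : ℝ → ℝ}
    (hlh : ∀ᶠ A in atTop, lo A ≤ hi A) (hI : ∀ A, Ioo (lo A) (hi A) ⊆ T)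
    (hcov : ∀ x ∈ T, ∀ᶠ A in atTop, x ∈ Ioo (lo A) (hi A)) :
    IsLimIntegral atTop lo hi (fun x s => q s x) g (Ioo 0 1) (V.symm g) := by
  obtain ⟨k, hkm, hk⟩ := H.exists_measurable
  have hae : ∀ A, lo A ≤ hi A →
      V.symm (truncL (measurableSet_Ioo (a := lo A) (b := hi A)) g)
        =ᵐ[volume.restrict (Ioo 0 1)] fun s => ∫ x in (lo A)..(hi A), q s x * g x := by
    intro A hA
    filter_upwards [H.symm_truncL_ae V hV g (hI A)] with s h1
    rw [h1, intervalIntegral.integral_of_le hA, integral_Ioc_eq_integral_Ioo]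
    have e : ∀ x, q s x * (Ioo (lo A) (hi A)).indicator g x =
        (Ioo (lo A) (hi A)).indicator (fun x => q s x * g x) x := fun x => by
      by_cases hx : x ∈ Ioo (lo A) (hi A)
      · rw [indicator_of_mem hx, indicator_of_mem hx]
      · rw [indicator_of_notMem hx, indicator_of_notMem hx, mul_zero]
    simp_rw [e]
    rw [setIntegral_indicator measurableSet_Ioo, inter_eq_right.2 (hI A)]
  refine ⟨?_, ?_⟩
  · filter_upwards [hlh] with A hA
    refine ⟨fun s hs => ?_, (Lp.memLp _).ae_eq (hae A hA)⟩
    rw [intervalIntegrable_iff_integrableOn_Ioo_of_le hA]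
    obtain ⟨C, hC⟩ := H.bdd {s} isCompact_singleton (singleton_subset_iff.2 hs)
      (max |lo A| |hi A|)
    have hks : Measurable fun x => k s x := hkm.of_uncurry_left
    refine (integrableOn_of_L2 g (hI A)).bdd_mul (c := C) (hks.aestronglyMeasurable.congr ?_) ?_
    · filter_upwards [ae_restrict_mem measurableSet_Ioo] with x hx
      rw [hk s hs x (hI A hx)]
    · filter_upwards [ae_restrict_mem measurableSet_Ioo] with x hx
      exact hC s rfl x (hI A hx) (abs_le_max_abs_abs hx.1.le hx.2.le)
  · have ht := (V.symm.continuous.tendsto g).comp (tendsto_truncL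
      (fun A => measurableSet_Ioo (a := lo A) (b := hi A)) g
      ((ae_restrict_mem H.measurableSet).mono hcov))
    rw [Lp.tendsto_Lp_iff_tendsto_eLpNorm'] at ht
    refine ht.congr' ?_
    filter_upwards [hlh] with A hA
    refine eLpNorm_congr_ae ?_
    filter_upwards [hae A hA] with s hs
    simp only [Function.comp, Pi.sub_apply, hs]

end Kernel

/-- The ranges of the two factorised operators span `L²(ℝ)`. -/
theorem exists_factorOp_add (f : L2 volume) :
    ∃ h h', factorOp Rplus h + factorOp Rminus h' = f := by
  set E := ((LinearIsometryEquiv.withLpProdCongr 2 fourierL2.symm fourierL2.symm).trans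
    opS.symm).trans fourierL2.symm with hE
  refine ⟨RplusAdj (E.symm f), RminusAdj (E.symm f), ?_⟩
  change E (Rplus _) + E (Rminus _) = f
  rw [← map_add, Rplus_add_Rminus, E.apply_symm_apply]

end

end SincWH

theorem mainTheorem2 (b : ℝ) (hb : 0 < b) :
    -- the improper integrals defining the spectral functions exist
    (∀ s ∈ Ioo (0 : ℝ) 1, ∀ x : ℝ, x ≠ 0 →
      Tendsto (specTrunc b s x) atTop (𝓝 (specFun b s x)) ∧
      Tendsto (specTrunc (-b) s x) atTop (𝓝 (specFun (-b) s x))) ∧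
    ∃ (Vp : L2 (volume.restrict (Ioo 0 1)) ≃ₗᵢ[ℂ]
          L2 (volume.restrict (Ioi 0)))
      (Vm : L2 (volume.restrict (Ioo 0 1)) ≃ₗᵢ[ℂ]
          L2 (volume.restrict (Iio 0))),
      -- the integral formulas for `V_±`
      (∀ h : L2 (volume.restrict (Ioo 0 1)), IsLimIntegral (𝓝[>] 0 ×ˢ 𝓝[>] 0)
        (fun p : ℝ × ℝ => p.1) (fun p => 1 - p.2) (fun s x => qPlus b s x) h
        (Ioi 0) (Vp h)) ∧
      (∀ h : L2 (volume.restrict (Ioo 0 1)), IsLimIntegral (𝓝[>] 0 ×ˢ 𝓝[>] 0)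
        (fun p : ℝ × ℝ => p.1) (fun p => 1 - p.2) (fun s x => qMinus b s x) h
        (Iio 0) (Vm h)) ∧
      -- the integral formulas for their inverses
      (∀ g : L2 (volume.restrict (Ioi 0)), IsLimIntegral atTop (fun _ : ℝ => 0) (fun A => A)
        (fun x s => qPlus b s x) g (Ioo 0 1) (Vp.symm g)) ∧
      (∀ g : L2 (volume.restrict (Iio 0)), IsLimIntegral atTop (fun A : ℝ => -A) (fun _ => 0)
        (fun x s => qMinus b s x) g (Ioo 0 1) (Vm.symm g)) ∧
      -- the factorisations of `P_±^* V_±`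
      (∀ h : L2 (volume.restrict (Ioo 0 1)), (projP (Ioi 0)).adjoint (Vp h) =
        fourierL2.symm (opS.symm
          (LinearIsometryEquiv.withLpProdCongr 2 fourierL2.symm fourierL2.symm (Rplus h)))) ∧
      (∀ h : L2 (volume.restrict (Ioo 0 1)), (projP (Iio 0)).adjoint (Vm h) =
        fourierL2.symm (opS.symm
          (LinearIsometryEquiv.withLpProdCongr 2 fourierL2.symm fourierL2.symm (Rminus h)))) := by
  have Hp := isKernel_qPlus hb
  have Hm := isKernel_qMinus hb
  have hd : Disjoint (Ioi (0 : ℝ)) (Iio 0) :=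
    disjoint_left.2 fun x hx hx' => lt_asymm (mem_Ioi.1 hx) (mem_Iio.1 hx')
  have hsp := Hp.restrictOp_surjective Hm hd exists_factorOp_add
  have hsm := Hm.restrictOp_surjective Hp hd.symm fun f => by
    obtain ⟨h, h', hf⟩ := exists_factorOp_add f
    exact ⟨h', h, by rw [add_comm, hf]⟩
  have hVp : ∀ h, LinearIsometryEquiv.ofSurjective Hp.restrictOp hsp h = Hp.restrictOp h :=
    fun h => rfl
  have hVm : ∀ h, LinearIsometryEquiv.ofSurjective Hm.restrictOp hsm h = Hm.restrictOp h :=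
    fun h => rfl
  -- `V_±` is the kernel operator, regarded as a map onto `L²(ℝ_±)`.
  refine ⟨fun s hs x hx => ⟨tendsto_specTrunc s hb hx, ?_⟩,
    LinearIsometryEquiv.ofSurjective Hp.restrictOp hsp,
    LinearIsometryEquiv.ofSurjective Hm.restrictOp hsm, fun h => ?_, fun h => ?_, fun g => ?_,
    fun g => ?_, fun h => ?_, fun h => ?_⟩
  · rw [specFun_neg_line hs hb hx]
    exact tendsto_specTrunc_neg hs hb hx
  · rw [hVp]
    exact Hp.isLimIntegral h
  · rw [hVm]
    exact Hm.isLimIntegral h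
  · refine Hp.isLimIntegral_symm _ hVp g (eventually_ge_atTop 0) (fun A x hx => hx.1)
      fun x hx => ?_
    filter_upwards [eventually_gt_atTop x] with A hA
    exact ⟨hx, hA⟩
  · refine Hm.isLimIntegral_symm _ hVm g ?_ (fun A x hx => hx.2) fun x hx => ?_
    · filter_upwards [eventually_ge_atTop 0] with A hA
      linarith
    · filter_upwards [eventually_gt_atTop (-x)] with A hA
      exact ⟨by linarith, hx⟩
  · rw [hVp, Hp.adjoint_restrictOp, factorOp_apply]
  · rw [hVm, Hm.adjoint_restrictOp, factorOp_apply]
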